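/- **Theorem (Polytime Constant-Approximation).** Let $G$ be an undirected graph with $n$ vertices, embedded in the Euclidean plane with straight edges (edges meet only in common end vertices, and no vertex lies in the interior of an edge). Let $k$ point agents of maximal speed $1$ start at distinct vertices $s_1,\dots,s_k$. A tour assignment gives every agent $i$ an ordered, possibly empty list of goal vertices (its initial goal agenda), such that all $m$ goals in these lists are distinct, together with a route from $s_i$ through its goals in this order, each leg of which is a shortest path with respect to Euclidean edge lengths. Let $\ell_i$ be the travel time (Euclidean length) of route $i$ and let $$L_{\mathrm{sum}}=\sum_{i=1}^k \ell_i,\qquad L_{\max}=\max_{1\le i\le k}\ell_i$$ ($L_{\max}=0$ if $k=0$). There are one program of a real RAM (unit-cost arithmetic $+,-,\times,/$, square root and comparison of real numbers, constants $0$ and $1$, list-structured memory) and one polynomial $P$ with the following property. For all $n,k$, all such data and every $\varepsilon>0$, the program, given $\varepsilon$, the vertex coordinates, the adjacency lists, the starting vertices and the routes, halts after at most $P(n+k+m)$ steps with a schedule of size at most $P(n+k+m)$ such that: 1. At time $0$ agent $i$ is at $s_i$ and holds agenda $i$. The schedule consists of finitely many intervals, in each of which every agent stands still or moves linearly, with speed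 at most $1$, along an edge of one of the given routes. 2. No two agents are ever at the same point at the same time. 3. At every time each agent holds exactly one agenda. Agendas may be exchanged at the end points of the intervals, and an agenda passes only between agents at distance at most $\varepsilon$ from each other. 4. The goals of every agenda are visited in the order of the agenda, each by the agent that holds the agenda at that moment; in the end all goals have been visited, and the agent that holds a nonempty agenda rests at the last goal of it. 5. The last agent has stopped by time $L_{\max}+\varepsilon$, and the total time used by the agents is at most $L_{\mathrm{sum}}+\varepsilon$; here an agent uses the time during which it moves or holds an agenda with unvisited goals. -/

import Mathlib

noncomputable section

/-! ## Machine model: a real RAM with list-structured memory, every operation costing one step -/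

/-- Data of the machine: the empty list, a real number, or a pair of (pointers to) data. -/
inductive Val where
  | nil : Val
  | num (r : ℝ) : Val
  | cons (a b : Val) : Val

namespace Val

/-- Number of nodes of a datum, written out as a tree. -/
def size : Val → ℕ
  | nil => 1
  | num _ => 1
  | cons a b => a.size + b.size + 1

/-- A list of data. -/
def list : List Val → Val
  | [] => nil
  | a :: l => cons a (list l)

/-- A natural number, stored as a real number. -/
def nat (m : ℕ) : Val := num (m : ℝ)

end Val

/-- The elementary operations. The only constants are `nil`, `0` and `1`. Binary operations expect
a pair of numbers; an operation applied to data of the wrong shape returns `nil`. -/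
inductive Op where
  | id | nil | zero | one | hd | tl | add | sub | mul | div | sqrt | lt

open Classical in
/-- The effect of an elementary operation. -/
def Op.apply : Op → Val → Val
  | .id, x => x
  | .nil, _ => .nil
  | .zero, _ => .num 0
  | .one, _ => .num 1
  | .hd, .cons a _ => a
  | .tl, .cons _ b => b
  | .add, .cons (.num a) (.num b) => .num (a + b)
  | .sub, .cons (.num a) (.num b) => .num (a - b)
  | .mul, .cons (.num a) (.num b) => .num (a * b)
  | .div, .cons (.num a) (.num b) => .num (a / b)
  | .sqrt, .num a => .num (Real.sqrt a)
  | .lt, .cons (.num a) (.num b) => if a < b then .cons .nil .nil else .nil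
  | _, _ => .nil

/-- Programs: finite texts built from elementary operations by sequential composition, pairing of
two results, branching and while-loops. A test succeeds if its result is not `nil`. -/
inductive Prog where
  | op (o : Op) : Prog
  | seq (p q : Prog) : Prog
  | pair (p q : Prog) : Prog
  | ite (c p q : Prog) : Prog
  | loop (c p : Prog) : Prog

/-- `Runs p x y t`: started on the datum `x`, the program `p` halts with result `y` after exactly
`t` steps. -/
inductive Runs : Prog → Val → Val → ℕ → Prop where
  | op (o : Op) (x : Val) : Runs (.op o) x (o.apply x) 1
  | seq {p q : Prog} {x y z : Val} {s t : ℕ} :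
      Runs p x y s → Runs q y z t → Runs (.seq p q) x z (s + t + 1)
  | pair {p q : Prog} {x y z : Val} {s t : ℕ} :
      Runs p x y s → Runs q x z t → Runs (.pair p q) x (.cons y z) (s + t + 1)
  | ite_true {c p q : Prog} {x v y : Val} {s t : ℕ} :
      Runs c x v s → v ≠ .nil → Runs p x y t → Runs (.ite c p q) x y (s + t + 1)
  | ite_false {c p q : Prog} {x y : Val} {s t : ℕ} :
      Runs c x .nil s → Runs q x y t → Runs (.ite c p q) x y (s + t + 1)
  | loop_step {c p : Prog} {x v y z : Val} {s t u : ℕ} :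
      Runs c x v s → v ≠ .nil → Runs p x y t → Runs (.loop c p) y z u →
        Runs (.loop c p) x z (s + t + u + 1)
  | loop_exit {c p : Prog} {x : Val} {s : ℕ} :
      Runs c x .nil s → Runs (.loop c p) x x (s + 1)

/-! ## Graphs in the plane, tours and routes -/

/-- The Euclidean plane. -/
abbrev Plane := EuclideanSpace ℝ (Fin 2)

/-- `pos` is a straight-line embedding of `G` in the plane: vertices are distinct points, no vertex
lies on an edge of which it is not an end, and two edges meet only in common ends. -/
structure IsPlaneEmbedding {n : ℕ} (G : SimpleGraph (Fin n)) (pos : Fin n → Plane) : Prop where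
  injective : Function.Injective pos
  vertex : ∀ u v w, G.Adj u v → pos w ∈ segment ℝ (pos u) (pos v) → w = u ∨ w = v
  edge : ∀ u v w x, G.Adj u v → G.Adj w x → s(u, v) ≠ s(w, x) →
    ∀ z, z ∈ segment ℝ (pos u) (pos v) → z ∈ segment ℝ (pos w) (pos x) →
      ∃ y, (y = u ∨ y = v) ∧ (y = w ∨ y = x) ∧ z = pos y

/-- Travel time (at unit speed) along a walk. -/
def walkTime {n : ℕ} {G : SimpleGraph (Fin n)} (pos : Fin n → Plane) {u v : Fin n}
    (p : G.Walk u v) : ℝ :=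
  (p.darts.map fun d => dist (pos d.fst) (pos d.snd)).sum

/-- A route from `u` through the given goals in the given order: one walk for every goal. -/
inductive Route {n : ℕ} (G : SimpleGraph (Fin n)) : Fin n → List (Fin n) → Type where
  | done (u : Fin n) : Route G u []
  | leg {u g : Fin n} {gs : List (Fin n)} (p : G.Walk u g) (rest : Route G g gs) :
      Route G u (g :: gs)

namespace Route

variable {n : ℕ} {G : SimpleGraph (Fin n)}

/-- Travel time along a route. -/
def time (pos : Fin n → Plane) : {u : Fin n} → {gs : List (Fin n)} → Route G u gs → ℝ
  | _, _, .done _ => 0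
  | _, _, .leg p rest => walkTime pos p + rest.time pos

/-- Every leg of the route is a shortest path to the next goal. -/
def IsShortest (pos : Fin n → Plane) :
    {u : Fin n} → {gs : List (Fin n)} → Route G u gs → Prop
  | _, _, .done _ => True
  | u, g :: _, .leg p rest =>
      (∀ q : G.Walk u g, walkTime pos p ≤ walkTime pos q) ∧ rest.IsShortest pos

/-- The edges used by a route, each in the direction in which it is traversed. -/
def darts : {u : Fin n} → {gs : List (Fin n)} → Route G u gs → List G.Dart
  | _, _, .done _ => []
  | _, _, .leg p rest => p.darts ++ rest.darts

/-- A route as machine data: the list of its legs, each as the list of its vertices. -/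
def encode : {u : Fin n} → {gs : List (Fin n)} → Route G u gs → Val
  | _, _, .done _ => .nil
  | _, _, .leg p rest => .cons (.list (p.support.map fun v => .nat v.val)) rest.encode

end Route

/-- `k` agents on a graph with `n` vertices placed in the plane, with a tour for each agent (an
ordered list of goals, its initial goal agenda) and a route that carries out this tour. -/
structure Mission (n k : ℕ) where
  graph : SimpleGraph (Fin n)
  pos : Fin n → Plane
  start : Fin k → Fin n
  goals : Fin k → List (Fin n)
  route : ∀ i, Route graph (start i) (goals i)

namespace Mission

variable {n k : ℕ}

/-- The standing assumptions: the graph is embedded, every leg is a shortest path, the agents start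
at different vertices, and every goal occurs once, in one tour. -/
structure IsTourAssignment (M : Mission n k) : Prop where
  embedded : IsPlaneEmbedding M.graph M.pos
  shortest : ∀ i, (M.route i).IsShortest M.pos
  start_injective : Function.Injective M.start
  goals_nodup : ∀ i, (M.goals i).Nodup
  goals_disjoint : ∀ i j, i ≠ j → (M.goals i).Disjoint (M.goals j)

/-- Sum of the travel times of the given routes. -/
def totalTime (M : Mission n k) : ℝ := ∑ i, (M.route i).time M.pos

/-- Maximum of the travel times of the given routes (`0` if there is no agent). -/
def maxTime (M : Mission n k) : ℝ := ⨆ i, (M.route i).time M.pos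

/-- Number of goals. -/
def numGoals (M : Mission n k) : ℕ := ∑ i, (M.goals i).length

/-- A point of the plane as machine data. -/
def encodePoint (p : Plane) : Val := .cons (.num (p 0)) (.num (p 1))

open Classical in
/-- The input of the collision resolution: `ε`, the coordinates of the vertices, the list of
neighbours of each vertex, the start and the route of each agent. -/
def encode (M : Mission n k) (ε : ℝ) : Val :=
  .list [.num ε,
    .list (List.ofFn fun v => encodePoint (M.pos v)),
    .list (List.ofFn fun u =>
      .list (((List.finRange n).filter fun v => M.graph.Adj u v).map fun v => .nat v.val)),
    .list (List.ofFn fun i => .cons (.nat (M.start i).val) (M.route i).encode)]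

end Mission

/-! ## Schedules -/

/-- The situation at an instant: `place a` is the position of agent `a`, `job a` the number of the
goal agenda that agent `a` holds from this instant on, `served i` the number of goals of agenda `i`
visited so far. -/
structure Snapshot (k : ℕ) where
  time : ℝ
  place : Fin k → Plane
  job : Equiv.Perm (Fin k)
  served : Fin k → ℕ

/-- A schedule: finitely many snapshots. Between consecutive snapshots every agent moves linearly
and keeps its agenda; after the last one nobody moves. -/
structure Schedule (k : ℕ) where
  first : Snapshot k
  rest : List (Snapshot k)

namespace Snapshot

variable {n k : ℕ}

/-- The agent that holds agenda `i`. -/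
def holder (s : Snapshot k) (i : Fin k) : Fin k := s.job.symm i

/-- From `before` to `s.served`, goals are ticked off in the order of the agendas, and only while
the agent holding the agenda is at the goal. -/
def Serves (M : Mission n k) (before : Fin k → ℕ) (s : Snapshot k) : Prop :=
  ∀ i, before i ≤ s.served i ∧
    ∀ m, before i ≤ m → m < s.served i →
      ∃ g, (M.goals i)[m]? = some g ∧ s.place (s.holder i) = M.pos g

/-- The points `x`, `y` coincide or lie on a common edge of one of the given routes. -/
def OnRoutes (M : Mission n k) (x y : Plane) : Prop :=
  x = y ∨ ∃ i, ∃ d ∈ (M.route i).darts,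
    x ∈ segment ℝ (M.pos d.fst) (M.pos d.snd) ∧ y ∈ segment ℝ (M.pos d.fst) (M.pos d.snd)

/-- Admissible transition between consecutive snapshots. -/
structure Step (M : Mission n k) (ε : ℝ) (s s' : Snapshot k) : Prop where
  time_lt : s.time < s'.time
  /-- unit speed is not exceeded -/
  speed : ∀ a, dist (s.place a) (s'.place a) ≤ s'.time - s.time
  onRoutes : ∀ a, OnRoutes M (s.place a) (s'.place a)
  /-- two agents are never at the same point at the same time -/
  collisionFree : ∀ a b, a ≠ b → ∀ θ ∈ Set.Icc (0 : ℝ) 1,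
    AffineMap.lineMap (s.place a) (s'.place a) θ ≠ AffineMap.lineMap (s.place b) (s'.place b) θ
  /-- agendas change hands only between agents at distance at most `ε` -/
  exchange : ∀ i, dist (s'.place (s.holder i)) (s'.place (s'.holder i)) ≤ ε
  serves : Serves M s.served s'

open Classical in
/-- Time used by all agents together between two consecutive snapshots: an agent uses the time if
it moves or if some goal of the agenda that it holds has not been visited yet. -/
def stepCost (M : Mission n k) (s s' : Snapshot k) : ℝ :=
  ∑ a, if s.place a ≠ s'.place a ∨ s.served (s.job a) < (M.goals (s.job a)).length
    then s'.time - s.time else 0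

/-- Time used by all agents together over a list of snapshots. -/
def listCost (M : Mission n k) : List (Snapshot k) → ℝ
  | s :: s' :: l => stepCost M s s' + listCost M (s' :: l)
  | _ => 0

/-- A snapshot as machine data. -/
def encode (s : Snapshot k) : Val :=
  .list [.num s.time,
    .list (List.ofFn fun a => Mission.encodePoint (s.place a)),
    .list (List.ofFn fun a => .nat (s.job a).val),
    .list (List.ofFn fun i => .nat (s.served i))]

end Snapshot

namespace Schedule

variable {n k : ℕ}

/-- All snapshots. -/
def snapshots (S : Schedule k) : List (Snapshot k) := S.first :: S.rest

/-- The last snapshot. -/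
def last (S : Schedule k) : Snapshot k := S.snapshots.getLast (List.cons_ne_nil _ _)

/-- A schedule as machine data. -/
def encode (S : Schedule k) : Val := .list (S.snapshots.map Snapshot.encode)

/-- The time at which the last agent has stopped. -/
def makespan (S : Schedule k) : ℝ := S.last.time

/-- The sum over all agents of the time they use. -/
def sumOfCosts (M : Mission n k) (S : Schedule k) : ℝ := Snapshot.listCost M S.snapshots

/-- The schedule resolves all collisions and carries out the tours: it starts at time `0` with agent
`i` at its start and holding agenda `i`; all transitions are admissible; in the end all goals of all
agendas have been visited, and the agent holding a nonempty agenda rests at its last goal. -/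
structure Resolves (M : Mission n k) (ε : ℝ) (S : Schedule k) : Prop where
  time_first : S.first.time = 0
  place_first : ∀ a, S.first.place a = M.pos (M.start a)
  job_first : S.first.job = 1
  serves_first : Snapshot.Serves M (fun _ => 0) S.first
  steps : S.snapshots.IsChain (Snapshot.Step M ε)
  served_last : ∀ i, S.last.served i = (M.goals i).length
  place_last : ∀ i g, (M.goals i).getLast? = some g → S.last.place (S.last.holder i) = M.pos g

end Schedule

end

/-! The agendas, not the agents, carry out the tours. Each agenda is treated as a ghost that follows
its route at unit speed and may pass through other ghosts. The agents are carriers; when two ghosts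
meet, their carriers swap agendas instead of passing each other. Ghosts must therefore meet only at
finitely many computable times, in pairs, and in configurations that can be resolved locally.

General position (`Generic`): tour `i` is delayed by `δ * (i + 1)`, where `δ` is small compared with
the gaps between undelayed corner times. Hence two different agendas never have a corner at the same
time, and all agendas have started before any of them arrives anywhere. An agenda without goals
might otherwise occupy the last goal of another one; it is parked at distance `ρ` from its start, on
an edge by which some route arrives there. Planarity of the embedding then shows that no three
agendas meet (`eq_of_place_eq`) and that in every meeting either one agenda passes through a resting
one or two agendas meet head-on (`meeting`). Head-on meetings happen at the mean of two corner
times, and a parked agenda is passed at a time that differs by `ρ` from a corner time. This yields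
polynomially many candidates for event times (`IsEventTime`).

Exchanges: around an event `t` there is a window from `t - h` to `t + h`, so short that agents whose
agendas do not meet at `t` stay in disjoint balls. Two carriers with meeting agendas wait during the
first half, swap at time `t`, at distance at most `2 * h ≤ ε`, and go in the second half to the
place where the new agenda is due at time `t + h`. In a head-on meeting they are already there. In a
passage one carrier follows the other around the meeting point, which is free of collisions unless
the passing agenda turns back; in that case both wait and swap back. A goal due at time `t` is
served by the carrier that rests on it, since this carrier has just received the passing agenda
(`step_before`, `no_collision_after`, `step_after`).

Costs: between windows an agent uses time only for an unfinished agenda, so the excess over the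
given routes consists of the delays, the parking time and the windows. The factors in the
definitions of `δ`, `ρ` and `h` make the total at most `ε`.

Computation: `PolyTime` is closed under the operations needed, with loops only in the form of folds
over lists (`PolyTime.foldl_of_inv`); this gives `polyTime_solve`. `Mission.solve_raw` identifies
the output with the schedule studied abstractly. The input has polynomial size because a shortest
leg is a path and so has at most `n` vertices. -/

noncomputable section

/-! ## Polynomial time on typed data -/

/-- A representation of the elements of a type as machine data. -/
class Enc (α : Type) where
  enc : α → Val

open Enc

/-- Size of the representation. -/
def esize {α : Type} [Enc α] (a : α) : ℕ := (enc a).size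

instance : Enc ℝ := ⟨Val.num⟩
instance : Enc ℕ := ⟨Val.nat⟩
instance : Enc Unit := ⟨fun _ => Val.nil⟩
instance : Enc Plane := ⟨Mission.encodePoint⟩
instance {α β : Type} [Enc α] [Enc β] : Enc (α × β) := ⟨fun x => .cons (enc x.1) (enc x.2)⟩
instance {α : Type} [Enc α] : Enc (List α) := ⟨fun l => Val.list (l.map enc)⟩

section sizes

variable {α β : Type} [Enc α] [Enc β]

@[simp] theorem esize_real (x : ℝ) : esize x = 1 := rfl
@[simp] theorem esize_nat (x : ℕ) : esize x = 1 := rfl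
@[simp] theorem esize_unit (x : Unit) : esize x = 1 := rfl
@[simp] theorem esize_plane (x : Plane) : esize x = 3 := rfl
@[simp] theorem esize_pair (x : α × β) : esize x = esize x.1 + esize x.2 + 1 := rfl
@[simp] theorem esize_nil : esize ([] : List α) = 1 := rfl
@[simp] theorem esize_cons (a : α) (l : List α) : esize (a :: l) = esize a + esize l + 1 := rfl

theorem esize_append (l l' : List α) : esize (l ++ l') + 1 = esize l + esize l' := by
  induction l with
  | nil => simp; omega
  | cons a l ih => simp only [List.cons_append, esize_cons]; omega

theorem length_le_esize (l : List α) : l.length ≤ esize l := by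
  induction l with
  | nil => simp
  | cons a l ih => simp only [List.length_cons, esize_cons]; omega

theorem esize_le_of_mem {l : List α} {a : α} (h : a ∈ l) : esize a ≤ esize l := by
  induction l with
  | nil => simp at h
  | cons b l ih =>
    rcases List.mem_cons.1 h with rfl | h
    · simp; omega
    · have := ih h; simp; omega

end sizes

theorem Polynomial.eval_mono_nat (Q : Polynomial ℕ) {m n : ℕ} (h : m ≤ n) :
    Q.eval m ≤ Q.eval n := by
  rw [Polynomial.eval_eq_sum_range, Polynomial.eval_eq_sum_range]
  gcongr

/-- `f` is computed by a program whose number of steps, and the size of whose result, are bounded by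
a polynomial in the size of the datum. -/
def PolyTime {α β : Type} [Enc α] [Enc β] (f : α → β) : Prop :=
  ∃ (p : Prog) (Q : Polynomial ℕ), ∀ a, ∃ t, Runs p (enc a) (enc (f a)) t ∧
    t + esize (f a) ≤ Q.eval (esize a)

/-- `T` is decided by a program in polynomial time. -/
def PolyTest {α : Type} [Enc α] (T : α → Prop) : Prop :=
  ∃ (p : Prog) (Q : Polynomial ℕ), ∀ a, ∃ v t, Runs p (enc a) v t ∧ (v ≠ .nil ↔ T a) ∧
    t ≤ Q.eval (esize a)

section combinators

variable {Γ α β γ σ : Type} [Enc Γ] [Enc α] [Enc β] [Enc γ] [Enc σ]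

theorem PolyTime.of_op (o : Op) {f : α → β} (c : ℕ) (h : ∀ a, o.apply (enc a) = enc (f a))
    (hc : ∀ a, esize (f a) ≤ esize a + c) : PolyTime f := by
  refine ⟨.op o, Polynomial.X + Polynomial.C (c + 1), fun a => ⟨1, ?_, ?_⟩⟩
  · rw [← h a]; exact Runs.op o _
  · have := hc a
    simp only [Polynomial.eval_add, Polynomial.eval_X, Polynomial.eval_C]; omega

theorem PolyTime.id : PolyTime (fun a : α => a) :=
  .of_op .id 0 (fun _ => rfl) fun _ => le_rfl

/-- This is why `PolyTime` bounds the size of the result along with the time: the second polynomial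
is evaluated at a bound for the size of its actual input. -/
theorem PolyTime.comp {g : β → γ} {f : α → β} (hg : PolyTime g) (hf : PolyTime f) :
    PolyTime (fun a => g (f a)) := by
  obtain ⟨p, P, hp⟩ := hf
  obtain ⟨q, Q, hq⟩ := hg
  refine ⟨.seq p q, P + Q.comp P + 1, fun a => ?_⟩
  obtain ⟨s, hs, hs'⟩ := hp a
  obtain ⟨t, ht, ht'⟩ := hq (f a)
  refine ⟨_, hs.seq ht, ?_⟩
  have h1 : Q.eval (esize (f a)) ≤ Q.eval (P.eval (esize a)) := Q.eval_mono_nat (by omega)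
  simp only [Polynomial.eval_add, Polynomial.eval_comp, Polynomial.eval_one]; omega

theorem PolyTime.mk {f : Γ → α} {g : Γ → β} (hf : PolyTime f) (hg : PolyTime g) :
    PolyTime (fun x => (f x, g x)) := by
  obtain ⟨p, P, hp⟩ := hf
  obtain ⟨q, Q, hq⟩ := hg
  refine ⟨.pair p q, P + Q + 2, fun a => ?_⟩
  obtain ⟨s, hs, hs'⟩ := hp a
  obtain ⟨t, ht, ht'⟩ := hq a
  refine ⟨_, hs.pair ht, ?_⟩
  simp only [Polynomial.eval_add, Polynomial.eval_ofNat, esize_pair]; omega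

theorem PolyTime.fst {f : Γ → α × β} (hf : PolyTime f) : PolyTime (fun x => (f x).1) :=
  PolyTime.comp (g := fun x : α × β => x.1)
    (.of_op .hd 0 (fun _ => rfl) fun a => by simp; omega) hf

theorem PolyTime.snd {f : Γ → α × β} (hf : PolyTime f) : PolyTime (fun x => (f x).2) :=
  PolyTime.comp (g := fun x : α × β => x.2)
    (.of_op .tl 0 (fun _ => rfl) fun a => by simp; omega) hf

theorem PolyTime.zero : PolyTime (fun _ : Γ => (0 : ℝ)) :=
  .of_op .zero 1 (fun _ => rfl) fun _ => by simp

theorem PolyTime.one : PolyTime (fun _ : Γ => (1 : ℝ)) :=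
  .of_op .one 1 (fun _ => rfl) fun _ => by simp

theorem PolyTime.natZero : PolyTime (fun _ : Γ => (0 : ℕ)) :=
  .of_op .zero 1 (fun _ => by simp [Op.apply, enc, Val.nat]) fun _ => by simp

theorem PolyTime.nil : PolyTime (fun _ : Γ => ([] : List α)) :=
  .of_op .nil 1 (fun _ => rfl) fun _ => by simp

theorem PolyTime.unit : PolyTime (fun _ : Γ => ()) :=
  .of_op .nil 1 (fun _ => rfl) fun _ => by simp

theorem PolyTime.add {f g : Γ → ℝ} (hf : PolyTime f) (hg : PolyTime g) :
    PolyTime (fun x => f x + g x) :=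
  PolyTime.comp (g := fun x : ℝ × ℝ => x.1 + x.2)
    (.of_op .add 0 (fun _ => rfl) fun _ => by simp) (hf.mk hg)

theorem PolyTime.sub {f g : Γ → ℝ} (hf : PolyTime f) (hg : PolyTime g) :
    PolyTime (fun x => f x - g x) :=
  PolyTime.comp (g := fun x : ℝ × ℝ => x.1 - x.2)
    (.of_op .sub 0 (fun _ => rfl) fun _ => by simp) (hf.mk hg)

theorem PolyTime.mul {f g : Γ → ℝ} (hf : PolyTime f) (hg : PolyTime g) :
    PolyTime (fun x => f x * g x) :=
  PolyTime.comp (g := fun x : ℝ × ℝ => x.1 * x.2)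
    (.of_op .mul 0 (fun _ => rfl) fun _ => by simp) (hf.mk hg)

theorem PolyTime.div {f g : Γ → ℝ} (hf : PolyTime f) (hg : PolyTime g) :
    PolyTime (fun x => f x / g x) :=
  PolyTime.comp (g := fun x : ℝ × ℝ => x.1 / x.2)
    (.of_op .div 0 (fun _ => rfl) fun _ => by simp) (hf.mk hg)

theorem PolyTime.sqrt {f : Γ → ℝ} (hf : PolyTime f) : PolyTime (fun x => Real.sqrt (f x)) :=
  PolyTime.comp (g := fun x : ℝ => Real.sqrt x)
    (.of_op .sqrt 0 (fun _ => rfl) fun _ => by simp) hf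

theorem PolyTime.natCast {f : Γ → ℕ} (hf : PolyTime f) : PolyTime (fun x => (f x : ℝ)) :=
  PolyTime.comp (g := fun x : ℕ => (x : ℝ)) (.of_op .id 0 (fun _ => rfl) fun _ => by simp) hf

theorem PolyTime.congr {f g : α → β} (hf : PolyTime f) (h : ∀ a, f a = g a) : PolyTime g := by
  rwa [← funext h]

/-- A function that agrees, up to representation, with a polynomial time function. -/
theorem PolyTime.recode {f : Γ → α} {g : Γ → β} (hf : PolyTime f)
    (h : ∀ x, enc (f x) = enc (g x)) : PolyTime g := by
  obtain ⟨p, P, hp⟩ := hf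
  refine ⟨p, P, fun a => ?_⟩
  simpa only [esize, ← h] using hp a

theorem PolyTime.succ {f : Γ → ℕ} (hf : PolyTime f) : PolyTime (fun x => f x + 1) :=
  PolyTime.recode (f := fun x => (f x : ℝ) + 1) (hf.natCast.add .one) fun x => by
    simp [enc, Val.nat]

theorem PolyTime.coordZero {f : Γ → Plane} (hf : PolyTime f) : PolyTime (fun x => f x 0) :=
  PolyTime.comp (g := fun x : Plane => x 0) (.of_op .hd 0 (fun _ => rfl) fun _ => by simp) hf

theorem PolyTime.coordOne {f : Γ → Plane} (hf : PolyTime f) : PolyTime (fun x => f x 1) :=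
  PolyTime.comp (g := fun x : Plane => x 1) (.of_op .tl 0 (fun _ => rfl) fun _ => by simp) hf

theorem PolyTime.plane {f : Γ → Plane} (h0 : PolyTime (fun x => f x 0))
    (h1 : PolyTime (fun x => f x 1)) : PolyTime f :=
  PolyTime.recode (h0.mk h1) fun _ => rfl

theorem PolyTime.dist {f g : Γ → Plane} (hf : PolyTime f) (hg : PolyTime g) :
    PolyTime (fun x => dist (f x) (g x)) := by
  have h0 := hf.coordZero.sub hg.coordZero
  have h1 := hf.coordOne.sub hg.coordOne
  refine ((h0.mul h0).add (h1.mul h1)).sqrt.congr fun x => ?_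
  simp [EuclideanSpace.dist_eq, Fin.sum_univ_two, Real.dist_eq, sq]

theorem PolyTime.lineMap {f g : Γ → Plane} {r : Γ → ℝ} (hf : PolyTime f) (hg : PolyTime g)
    (hr : PolyTime r) : PolyTime (fun x => AffineMap.lineMap (f x) (g x) (r x)) := by
  refine .plane (((hr.mul (hg.coordZero.sub hf.coordZero)).add hf.coordZero).congr fun x => ?_)
    (((hr.mul (hg.coordOne.sub hf.coordOne)).add hf.coordOne).congr fun x => ?_) <;>
  simp [AffineMap.lineMap_apply]

theorem PolyTime.origin : PolyTime (fun _ : Γ => (0 : Plane)) :=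
  .plane (PolyTime.zero.congr fun _ => rfl) (PolyTime.zero.congr fun _ => rfl)

/-! ### Tests -/

theorem PolyTest.comp {T : β → Prop} {f : α → β} (hT : PolyTest T) (hf : PolyTime f) :
    PolyTest (fun a => T (f a)) := by
  obtain ⟨p, P, hp⟩ := hf
  obtain ⟨q, Q, hq⟩ := hT
  refine ⟨.seq p q, P + Q.comp P + 1, fun a => ?_⟩
  obtain ⟨s, hs, hs'⟩ := hp a
  obtain ⟨v, t, ht, hv, ht'⟩ := hq (f a)
  refine ⟨v, _, hs.seq ht, hv, ?_⟩
  have h1 : Q.eval (esize (f a)) ≤ Q.eval (P.eval (esize a)) := Q.eval_mono_nat (by omega)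
  simp only [Polynomial.eval_add, Polynomial.eval_comp, Polynomial.eval_one]; omega

theorem PolyTest.congr {S T : α → Prop} (hS : PolyTest S) (h : ∀ a, S a ↔ T a) : PolyTest T := by
  rwa [← funext fun a => propext (h a)]

theorem PolyTest.lt {f g : Γ → ℝ} (hf : PolyTime f) (hg : PolyTime g) :
    PolyTest (fun x => f x < g x) := by
  refine PolyTest.comp (T := fun x : ℝ × ℝ => x.1 < x.2) ⟨.op .lt, 1, fun x => ?_⟩ (hf.mk hg)
  refine ⟨_, 1, Runs.op _ _, ?_, by simp⟩
  simp only [enc, Op.apply]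
  split_ifs with h <;> simp [h]

theorem PolyTest.not {S : Γ → Prop} (hS : PolyTest S) : PolyTest (fun x => ¬ S x) := by
  obtain ⟨p, P, hp⟩ := hS
  refine ⟨.ite p (.op .nil) (.op .zero), P + 2, fun a => ?_⟩
  obtain ⟨v, t, ht, hv, ht'⟩ := hp a
  by_cases h : S a
  · refine ⟨.nil, _, Runs.ite_true ht (hv.2 h) (Runs.op .nil _), by simp [h], ?_⟩
    simp only [Polynomial.eval_add, Polynomial.eval_ofNat]; omega
  · have hv' : v = .nil := by by_contra hn; exact h (hv.1 hn)
    refine ⟨.num 0, _, Runs.ite_false (hv' ▸ ht) (Runs.op .zero _), by simp [h], ?_⟩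
    simp only [Polynomial.eval_add, Polynomial.eval_ofNat]; omega

theorem PolyTest.and {S T : Γ → Prop} (hS : PolyTest S) (hT : PolyTest T) :
    PolyTest (fun x => S x ∧ T x) := by
  obtain ⟨p, P, hp⟩ := hS
  obtain ⟨q, Q, hq⟩ := hT
  refine ⟨.ite p q (.op .nil), P + Q + 2, fun a => ?_⟩
  obtain ⟨v, t, ht, hv, ht'⟩ := hp a
  obtain ⟨w, s, hs, hw, hs'⟩ := hq a
  by_cases h : S a
  · refine ⟨w, _, Runs.ite_true ht (hv.2 h) hs, by simp [h, hw], ?_⟩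
    simp only [Polynomial.eval_add, Polynomial.eval_ofNat]; omega
  · have hv' : v = .nil := by by_contra hn; exact h (hv.1 hn)
    refine ⟨.nil, _, Runs.ite_false (hv' ▸ ht) (Runs.op .nil _), by simp [h], ?_⟩
    simp only [Polynomial.eval_add, Polynomial.eval_ofNat]; omega

theorem PolyTest.le {f g : Γ → ℝ} (hf : PolyTime f) (hg : PolyTime g) :
    PolyTest (fun x => f x ≤ g x) :=
  (PolyTest.lt hg hf).not.congr fun _ => not_lt

theorem PolyTest.eq {f g : Γ → ℝ} (hf : PolyTime f) (hg : PolyTime g) :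
    PolyTest (fun x => f x = g x) :=
  ((PolyTest.le hf hg).and (PolyTest.le hg hf)).congr fun _ => le_antisymm_iff.symm

theorem PolyTest.natEq {f g : Γ → ℕ} (hf : PolyTime f) (hg : PolyTime g) :
    PolyTest (fun x => f x = g x) :=
  (PolyTest.eq hf.natCast hg.natCast).congr fun _ => Nat.cast_inj

theorem PolyTest.planeEq {f g : Γ → Plane} (hf : PolyTime f) (hg : PolyTime g) :
    PolyTest (fun x => f x = g x) :=
  ((PolyTest.eq hf.coordZero hg.coordZero).and (PolyTest.eq hf.coordOne hg.coordOne)).congr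
    fun x => by
      constructor
      · rintro ⟨h0, h1⟩; ext i; fin_cases i <;> assumption
      · intro h; rw [h]; exact ⟨rfl, rfl⟩

theorem PolyTest.isNil {f : Γ → List α} (hf : PolyTime f) : PolyTest (fun x => f x = []) := by
  refine PolyTest.comp (T := fun l : List α => l = []) (PolyTest.congr (S := fun l => ¬ l ≠ [])
    (PolyTest.not ⟨.op .id, 1, fun l => ⟨_, 1, Runs.op _ _, ?_, by simp⟩⟩) fun l => by simp) hf
  cases l <;> simp [enc, Op.apply, Val.list]

theorem PolyTime.ite {T : Γ → Prop} [∀ x, Decidable (T x)] {f g : Γ → α} (hT : PolyTest T)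
    (hf : PolyTime f) (hg : PolyTime g) : PolyTime (fun x => if T x then f x else g x) := by
  obtain ⟨c, C, hc⟩ := hT
  obtain ⟨p, P, hp⟩ := hf
  obtain ⟨q, Q, hq⟩ := hg
  refine ⟨.ite c p q, C + P + Q + 1, fun a => ?_⟩
  obtain ⟨v, t, ht, hv, ht'⟩ := hc a
  obtain ⟨r, hr, hr'⟩ := hp a
  obtain ⟨s, hs, hs'⟩ := hq a
  by_cases h : T a
  · refine ⟨_, by simpa [h] using Runs.ite_true ht (hv.2 h) hr, ?_⟩
    simp only [Polynomial.eval_add, Polynomial.eval_one, h, if_true]; omega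
  · have hv' : v = .nil := by by_contra hn; exact h (hv.1 hn)
    refine ⟨_, by simpa [h] using Runs.ite_false (hv' ▸ ht) hs, ?_⟩
    simp only [Polynomial.eval_add, Polynomial.eval_one, h, if_false]; omega

/-! ### Lists -/

theorem PolyTime.cons {f : Γ → α} {g : Γ → List α} (hf : PolyTime f) (hg : PolyTime g) :
    PolyTime (fun x => f x :: g x) :=
  (hf.mk hg).recode fun _ => rfl

theorem PolyTime.tail {f : Γ → List α} (hf : PolyTime f) : PolyTime (fun x => (f x).tail) :=
  PolyTime.comp (g := fun l : List α => l.tail) (.of_op .tl 0 (fun l => by cases l <;> rfl)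
    fun l => by cases l <;> simp; omega) hf

/-- The loop that runs through a list, updating a state by `p`. -/
def Prog.foldLoop (p : Prog) : Prog :=
  .loop (.seq (.op .tl) (.op .tl))
    (.pair (.op .hd) (.pair (.seq (.pair (.op .hd) (.pair (.seq (.op .tl) (.op .hd))
      (.seq (.op .tl) (.seq (.op .tl) (.op .hd))))) p)
      (.seq (.op .tl) (.seq (.op .tl) (.op .tl)))))

/-- Correctness of the loop through a list. The datum is a context, the current state and the rest of the
list. -/
theorem runs_fold_loop {step : Γ → σ → α → σ} {p : Prog} {x : Γ} (C : ℕ) (Inv : σ → Prop)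
    (q M : ℕ)
    (hInv : ∀ s a, Inv s → Inv (step x s a))
    (l : List α)
    (hgrow : ∀ s, ∀ a ∈ l, Inv s → esize (step x s a) ≤ esize s + q)
    (hp : ∀ s, ∀ a ∈ l, esize s ≤ M →
      ∃ t ≤ C, Runs p (enc (x, s, a)) (enc (step x s a)) t) :
    ∀ s, Inv s → esize s + l.length * q ≤ M →
    ∃ t, Runs (.foldLoop p)
      (enc (x, s, l)) (enc (x, l.foldl (step x) s, ([] : List α))) t ∧
      t ≤ l.length * (C + 30) + 4 ∧ esize (l.foldl (step x) s) ≤ esize s + l.length * q := by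
  induction l with
  | nil =>
    intro s _ _
    exact ⟨_, Runs.loop_exit (Runs.seq (Runs.op .tl _) (Runs.op .tl _)), by simp, by simp⟩
  | cons a l ih =>
    intro s hs hM
    obtain ⟨r, hr, hr'⟩ := hp s a (by simp) (le_trans (Nat.le_add_right _ _) hM)
    have hg := hgrow s a (by simp) hs
    simp only [List.length_cons, add_mul, one_mul] at hM ⊢
    obtain ⟨t, ht, ht', ht''⟩ := ih (fun s a ha => hgrow s a (by simp [ha]))
      (fun s a ha => hp s a (by simp [ha])) (step x s a) (hInv s a hs) (by omega)
    refine ⟨_, Runs.loop_step (y := enc (x, step x s a, l))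
      (v := enc (a :: l)) (Runs.seq (Runs.op .tl _) (Runs.op .tl _))
      (by simp [enc, Val.list])
      (Runs.pair (Runs.op .hd _) (Runs.pair (Runs.seq (Runs.pair (Runs.op .hd _)
        (Runs.pair (Runs.seq (Runs.op .tl _) (Runs.op .hd _))
          (Runs.seq (Runs.op .tl _) (Runs.seq (Runs.op .tl _) (Runs.op .hd _))))) hr')
        (Runs.seq (Runs.op .tl _) (Runs.seq (Runs.op .tl _) (Runs.op .tl _))))) ht, ?_, ?_⟩
    · omega
    · simp only [List.foldl_cons]; omega

/-- The increment of the state in one round is bounded in terms of the context and the list element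
only, so the increments add up to a polynomial; growth by a factor could double the state in every
round. The invariant serves folds whose increment depends on the state in a controlled way. -/
theorem PolyTime.foldl_of_inv {init : Γ → σ} {l : Γ → List α} {step : Γ → σ → α → σ}
    (hi : PolyTime init) (hl : PolyTime l)
    (hs : PolyTime (fun y : Γ × σ × α => step y.1 y.2.1 y.2.2))
    (Inv : Γ → σ → Prop) (hInit : ∀ x, Inv x (init x))
    (hInv : ∀ x s a, Inv x s → Inv x (step x s a)) (G : Polynomial ℕ)
    (hG : ∀ x s a, Inv x s → esize (step x s a) ≤ esize s + G.eval (esize x + esize a)) :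
    PolyTime (fun x => (l x).foldl (step x) (init x)) := by
  obtain ⟨pi, I, hi⟩ := hi
  obtain ⟨pl, L, hl⟩ := hl
  obtain ⟨ps, S, hs⟩ := hs
  -- `L` bounds the length of the list and the size of each element. `G'` bounds the growth in one
  -- round, `M` the state in all rounds, and `C` the time of one application of the step.
  let G' : Polynomial ℕ := G.comp (.X + L)
  let M : Polynomial ℕ := I + L * G'
  let C : Polynomial ℕ := S.comp (.X + M + L + 2)
  refine ⟨.seq (.pair (.op .id) (.pair pi pl)) (.seq (.foldLoop ps)
    (.seq (.op .tl) (.op .hd))), I + L + L * (C + 30) + M + 20, fun x => ?_⟩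
  obtain ⟨ti, hti, hti'⟩ := hi x
  obtain ⟨tl, htl, htl'⟩ := hl x
  have hlen : (l x).length ≤ L.eval (esize x) := (length_le_esize _).trans (by omega)
  have hmem : ∀ a ∈ l x, esize a ≤ L.eval (esize x) := fun a ha =>
    (esize_le_of_mem ha).trans (by omega)
  have hlen' : (l x).length * G'.eval (esize x) ≤ L.eval (esize x) * G'.eval (esize x) :=
    Nat.mul_le_mul_right _ hlen
  have hM : M.eval (esize x) = I.eval (esize x) + L.eval (esize x) * G'.eval (esize x) := by
    simp [M]
  have hC : C.eval (esize x) = S.eval (esize x + M.eval (esize x) + L.eval (esize x) + 2) := by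
    simp [C]
  have hG' : G'.eval (esize x) = G.eval (esize x + L.eval (esize x)) := by simp [G']
  obtain ⟨t, ht, ht', ht''⟩ := runs_fold_loop (step := step) (p := ps) (x := x)
    (C.eval (esize x)) (Inv x) (G'.eval (esize x)) (M.eval (esize x)) (hInv x) (l x)
    (fun s a ha h => (hG x s a h).trans (by
      rw [hG']; have := G.eval_mono_nat (Nat.add_le_add_left (hmem a ha) (esize x)); omega))
    (fun s a ha h => by
      obtain ⟨r, hr, hr'⟩ := hs (x, s, a)
      refine ⟨r, ?_, hr⟩
      have h1 := hmem a ha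
      have h2 : S.eval (esize (x, s, a)) ≤
          S.eval (esize x + M.eval (esize x) + L.eval (esize x) + 2) :=
        S.eval_mono_nat (by simp only [esize_pair]; omega)
      rw [hC]; omega)
    (init x) (hInit x) (by rw [hM]; omega)
  refine ⟨_, Runs.seq (Runs.pair (Runs.op .id _) (Runs.pair hti htl))
    (Runs.seq ht (Runs.seq (Runs.op .tl _) (Runs.op .hd _))), ?_⟩
  have h3 : (l x).length * (C.eval (esize x) + 30) ≤
      L.eval (esize x) * (C.eval (esize x) + 30) := Nat.mul_le_mul_right _ hlen
  simp only [Polynomial.eval_add, Polynomial.eval_mul, Polynomial.eval_ofNat]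
  omega

theorem PolyTime.foldl {init : Γ → σ} {l : Γ → List α} {step : Γ → σ → α → σ}
    (hi : PolyTime init) (hl : PolyTime l)
    (hs : PolyTime (fun y : Γ × σ × α => step y.1 y.2.1 y.2.2)) (G : Polynomial ℕ)
    (hG : ∀ x s a, esize (step x s a) ≤ esize s + G.eval (esize x + esize a)) :
    PolyTime (fun x => (l x).foldl (step x) (init x)) :=
  .foldl_of_inv hi hl hs (fun _ _ => True) (fun _ => trivial) (fun _ _ _ _ => trivial) G
    fun x s a _ => hG x s a

/-- A fold over a state of bounded size. -/
theorem PolyTime.foldl_small {init : Γ → σ} {l : Γ → List α} {step : Γ → σ → α → σ} (c : ℕ)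
    (hc : ∀ s : σ, esize s ≤ c) (hi : PolyTime init) (hl : PolyTime l)
    (hs : PolyTime (fun y : Γ × σ × α => step y.1 y.2.1 y.2.2)) :
    PolyTime (fun x => (l x).foldl (step x) (init x)) :=
  .foldl hi hl hs (.C c) fun x s a => by have := hc (step x s a); simp; omega

theorem PolyTime.exists_esize_le {f : α → β} (hf : PolyTime f) :
    ∃ Q : Polynomial ℕ, ∀ a, esize (f a) ≤ Q.eval (esize a) := by
  obtain ⟨p, P, hp⟩ := hf
  refine ⟨P, fun a => ?_⟩
  obtain ⟨t, -, ht⟩ := hp a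
  omega

theorem PolyTime.reverse {f : Γ → List α} (hf : PolyTime f) :
    PolyTime (fun x => (f x).reverse) := by
  refine PolyTime.congr (f := fun x => (f x).foldl (fun s a => a :: s) []) ?_ fun x => by simp
  exact .foldl .nil hf (.cons PolyTime.id.snd.snd PolyTime.id.snd.fst) (.X + 1)
    fun x s a => by simp; omega

theorem PolyTime.append {f g : Γ → List α} (hf : PolyTime f) (hg : PolyTime g) :
    PolyTime (fun x => f x ++ g x) := by
  refine PolyTime.congr (f := fun x => (f x).reverse.foldl (fun s a => a :: s) (g x)) ?_
    fun x => by simp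
  exact .foldl hg hf.reverse (.cons PolyTime.id.snd.snd PolyTime.id.snd.fst) (.X + 1)
    fun x s a => by simp; omega

theorem PolyTime.flatMap {l : Γ → List α} {f : Γ → α → List β} (hl : PolyTime l)
    (hf : PolyTime (fun y : Γ × α => f y.1 y.2)) :
    PolyTime (fun x => (l x).flatMap (f x)) := by
  have key : ∀ (x : Γ) (l : List α) (s : List β),
      l.foldl (fun s a => s ++ f x a) s = s ++ l.flatMap (f x) := by
    intro x l
    induction l with
    | nil => simp
    | cons a l ih => intro s; simp [ih]
  obtain ⟨Q, hQ⟩ := hf.exists_esize_le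
  refine PolyTime.congr (f := fun x => (l x).foldl (fun s a => s ++ f x a) []) ?_
    fun x => by simp [key]
  refine .foldl .nil hl (.append PolyTime.id.snd.fst
    (hf.comp (PolyTime.id.fst.mk PolyTime.id.snd.snd))) (Q.comp (.X + 1)) fun x s a => ?_
  have h1 := esize_append s (f x a)
  have h2 := hQ (x, a)
  simp only [esize_pair] at h2
  simp only [Polynomial.eval_comp, Polynomial.eval_add, Polynomial.eval_X, Polynomial.eval_one]
  omega

theorem PolyTime.map {l : Γ → List α} {f : Γ → α → β} (hl : PolyTime l)
    (hf : PolyTime (fun y : Γ × α => f y.1 y.2)) : PolyTime (fun x => (l x).map (f x)) :=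
  (PolyTime.flatMap hl (f := fun x a => [f x a]) (hf.cons .nil)).congr fun x => by
    induction l x <;> simp_all

theorem PolyTime.flatten {l : Γ → List (List α)} (hl : PolyTime l) :
    PolyTime (fun x => (l x).flatten) :=
  (PolyTime.flatMap hl (f := fun _ a => a) PolyTime.id.snd).congr fun x => by
    simp [List.flatMap_id']

theorem PolyTime.filter {l : Γ → List α} {T : Γ → α → Prop} [∀ x a, Decidable (T x a)]
    (hl : PolyTime l) (hT : PolyTest (fun y : Γ × α => T y.1 y.2)) :
    PolyTime (fun x => (l x).filter (fun a => decide (T x a))) := by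
  refine (PolyTime.flatMap hl (f := fun x a => if T x a then [a] else [])
    (.ite hT (PolyTime.id.snd.cons .nil) .nil)).congr fun x => ?_
  induction l x with
  | nil => rfl
  | cons a l ih => by_cases h : T x a <;> simp [h, ih]

theorem PolyTime.length {l : Γ → List α} (hl : PolyTime l) :
    PolyTime (fun x => (l x).length) := by
  have key : ∀ (l : List α) (s : ℕ), l.foldl (fun s _ => s + 1) s = s + l.length := by
    intro l
    induction l with
    | nil => simp
    | cons a l ih => intro s; simp [ih]; omega
  refine PolyTime.congr (f := fun x => (l x).foldl (fun s _ => s + 1) 0) ?_ fun x => by simp [key]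
  exact .foldl_small 1 (fun s => by simp) .natZero hl PolyTime.id.snd.fst.succ

end combinators

/-! ### Further polynomial time functions -/

section combinators

variable {Γ α β : Type} [Enc Γ] [Enc α] [Enc β]

theorem PolyTime.min {f g : Γ → ℝ} (hf : PolyTime f) (hg : PolyTime g) :
    PolyTime (fun x => min (f x) (g x)) :=
  (PolyTime.ite (.le hf hg) hf hg).congr fun x => by rw [min_def]

theorem PolyTime.two : PolyTime (fun _ : Γ => (2 : ℝ)) :=
  (PolyTime.one.add .one).congr fun _ => by norm_num

theorem PolyTime.eight : PolyTime (fun _ : Γ => (8 : ℝ)) :=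
  (PolyTime.two.mul (.mul .two .two)).congr fun _ => by norm_num

theorem PolyTime.getD {l : Γ → List α} {i : Γ → ℕ} {d : Γ → α} (hl : PolyTime l)
    (hi : PolyTime i) (hd : PolyTime d) : PolyTime (fun x => (l x).getD (i x) (d x)) := by
  -- The fold counts positions and records the element at the wanted one. The initial count `c` is
  -- arbitrary for the sake of the induction; `aux` says that after the wanted position the record
  -- no longer changes.
  have key : ∀ (l : List α) (i c : ℕ) (d : α),
      (l.foldl (fun (s : ℕ × α) a => (s.1 + 1, if s.1 = c + i then a else s.2)) (c, d)).2 =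
        l.getD i d := by
    intro l i
    induction l generalizing i with
    | nil => simp
    | cons a l ih =>
      intro c d
      cases i with
      | zero =>
        have aux : ∀ (l : List α) (s : ℕ × α), c < s.1 →
            (l.foldl (fun (s : ℕ × α) a => (s.1 + 1, if s.1 = c then a else s.2)) s).2 = s.2 := by
          intro l
          induction l with
          | nil => intro s _; rfl
          | cons b l ih =>
            intro s h
            rw [List.foldl_cons, ih _ (by simp; omega)]
            simp [h.ne']
        simp [aux]
      | succ i =>
        have := ih i (c + 1) d
        simpa [show c + 1 + i = c + (i + 1) by omega] using this
  refine PolyTime.congr (f := fun x => ((l x).foldl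
    (fun (s : ℕ × α) a => (s.1 + 1, if s.1 = i x then a else s.2)) (0, d x)).2) (.snd ?_)
    fun x => by simpa using key (l x) (i x) 0 (d x)
  refine .foldl (.mk .natZero hd) hl (.mk PolyTime.id.snd.fst.fst.succ
    (.ite (.natEq PolyTime.id.snd.fst.fst (hi.comp PolyTime.id.fst)) PolyTime.id.snd.snd
      PolyTime.id.snd.fst.snd)) .X fun x s a => ?_
  split_ifs <;> simp
  omega

theorem PolyTime.zipIdx {l : Γ → List α} (hl : PolyTime l) :
    PolyTime (fun x => (l x).zipIdx) := by
  have key : ∀ (l : List α) (c : ℕ) (s : List (α × ℕ)),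
      (l.foldl (fun (s : ℕ × List (α × ℕ)) a => (s.1 + 1, s.2 ++ [(a, s.1)])) (c, s)).2 =
        s ++ l.zipIdx c := by
    intro l
    induction l with
    | nil => simp
    | cons a l ih => intro c s; simp [ih]
  refine PolyTime.congr (f := fun x => ((l x).foldl
    (fun (s : ℕ × List (α × ℕ)) a => (s.1 + 1, s.2 ++ [(a, s.1)])) (0, [])).2) (.snd ?_)
    fun x => by simp [key]
  refine .foldl (.mk .natZero .nil) hl (.mk PolyTime.id.snd.fst.fst.succ
    (.append PolyTime.id.snd.fst.snd (.cons (.mk PolyTime.id.snd.snd PolyTime.id.snd.fst.fst)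
      .nil))) (.X + 3) fun x s a => ?_
  have := esize_append s.2 [(a, s.1)]
  simp at this ⊢; omega

end combinators

/-! ## The algorithm -/

/-- Uniform motion from `src` to `dst` during the time from `t₀` to `t₁`. -/
structure Seg where
  t₀ : ℝ
  src : Plane
  t₁ : ℝ
  dst : Plane

/-- The position at time `t`. -/
def Seg.pos (s : Seg) (t : ℝ) : Plane :=
  AffineMap.lineMap s.src s.dst ((t - s.t₀) / (s.t₁ - s.t₀))

/-- The intended motion of an agenda: it starts at `home`, and visits goals at the given times. -/
structure Token where
  idx : ℕ
  home : Plane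
  segs : List Seg
  visits : List ℝ

open Classical in
/-- The intended position of an agenda at time `t`. -/
def Token.pos (x : Token) (t : ℝ) : Plane :=
  x.segs.foldl (fun z s => if s.t₀ < t then (if t < s.t₁ then s.pos t else s.dst) else z) x.home

open Classical in
/-- Number of visits up to time `t`. -/
def Token.count (x : Token) (t : ℝ) : ℕ := (x.visits.filter fun v => decide (v ≤ t)).length

instance : Enc Seg := ⟨fun s => enc (s.t₀, s.src, s.t₁, s.dst)⟩
instance : Enc Token := ⟨fun x => enc (x.idx, x.home, x.segs, x.visits)⟩

section records

variable {Γ : Type} [Enc Γ]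

theorem PolyTime.seg {a c : Γ → ℝ} {b d : Γ → Plane} (ha : PolyTime a) (hb : PolyTime b)
    (hc : PolyTime c) (hd : PolyTime d) : PolyTime (fun x => Seg.mk (a x) (b x) (c x) (d x)) :=
  (ha.mk (hb.mk (hc.mk hd))).recode fun _ => rfl

theorem PolyTime.segFields {f : Γ → Seg} (hf : PolyTime f) :
    PolyTime (fun x => ((f x).t₀, (f x).src, (f x).t₁, (f x).dst)) := hf.recode fun _ => rfl

theorem PolyTime.segPos {f : Γ → Seg} {t : Γ → ℝ} (hf : PolyTime f) (ht : PolyTime t) :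
    PolyTime (fun x => (f x).pos (t x)) :=
  .lineMap hf.segFields.snd.fst hf.segFields.snd.snd.snd
    (.div (.sub ht hf.segFields.fst) (.sub hf.segFields.snd.snd.fst hf.segFields.fst))

theorem PolyTime.token {a : Γ → ℕ} {b : Γ → Plane} {c : Γ → List Seg} {d : Γ → List ℝ}
    (ha : PolyTime a) (hb : PolyTime b) (hc : PolyTime c) (hd : PolyTime d) :
    PolyTime (fun x => Token.mk (a x) (b x) (c x) (d x)) :=
  (ha.mk (hb.mk (hc.mk hd))).recode fun _ => rfl

theorem PolyTime.tokenFields {f : Γ → Token} (hf : PolyTime f) :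
    PolyTime (fun x => ((f x).idx, (f x).home, (f x).segs, (f x).visits)) :=
  hf.recode fun _ => rfl

theorem PolyTime.tokenPos {f : Γ → Token} {t : Γ → ℝ} (hf : PolyTime f) (ht : PolyTime t) :
    PolyTime (fun x => (f x).pos (t x)) := by
  refine .foldl_small 3 (fun s => by simp) hf.tokenFields.snd.fst hf.tokenFields.snd.snd.fst ?_
  have ht' := ht.comp (PolyTime.id.fst : PolyTime fun y : Γ × Plane × Seg => y.1)
  have hs : PolyTime fun y : Γ × Plane × Seg => y.2.2 := PolyTime.id.snd.snd
  exact .ite (.lt hs.segFields.fst ht')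
    (.ite (.lt ht' hs.segFields.snd.snd.fst) (hs.segPos ht') hs.segFields.snd.snd.snd)
    PolyTime.id.snd.fst

theorem PolyTime.tokenCount {f : Γ → Token} {t : Γ → ℝ} (hf : PolyTime f) (ht : PolyTime t) :
    PolyTime (fun x => (f x).count (t x)) :=
  .length (.filter hf.tokenFields.snd.snd.snd (.le PolyTime.id.snd (ht.comp PolyTime.id.fst)))

end records

/-- Moving on to `Q` at unit speed. -/
def advance (s : ℝ × Plane) (Q : Plane) : ℝ × Plane := (s.1 + dist s.2 Q, Q)

/-- Unit speed motion along a polygonal path, starting at `s.2` at time `s.1`. -/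
def segsFrom : ℝ × Plane → List Plane → List Seg
  | _, [] => []
  | s, Q :: l => ⟨s.1, s.2, (advance s Q).1, Q⟩ :: segsFrom (advance s Q) l

/-- The times at which a unit speed motion along a concatenation of paths ends each of them. -/
def visitsFrom : ℝ × Plane → List (List Plane) → List ℝ
  | _, [] => []
  | s, l :: ls => (l.foldl advance s).1 :: visitsFrom (l.foldl advance s) ls

open Classical in
/-- The least positive element of a list (`1` if there is none below `1`). -/
def posMin (l : List ℝ) : ℝ := l.foldl (fun m x => if 0 < x ∧ x < m then x else m) 1

/-- The least positive difference of elements of a list (`1` if there is none below `1`). -/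
def minGap (l : List ℝ) : ℝ := posMin (l.flatMap fun x => l.map fun y => x - y)

open Classical in
/-- Insertion into a sorted list without repetitions. -/
def insertSorted (l : List ℝ) (x : ℝ) : List ℝ :=
  (l.filter fun y => decide (y < x)) ++ x :: l.filter fun y => decide (x < y)

/-- Sorting without repetitions. -/
def sortDedup (l : List ℝ) : List ℝ := l.foldl insertSorted []

/-! ### Polynomial time for paths, least gaps and sorting -/

section auxiliary

variable {Γ : Type} [Enc Γ]

theorem PolyTime.advance {f : Γ → ℝ × Plane} {g : Γ → Plane} (hf : PolyTime f)
    (hg : PolyTime g) : PolyTime (fun x => advance (f x) (g x)) :=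
  .mk (.add hf.fst (.dist hf.snd hg)) hg

theorem PolyTime.foldl_advance {f : Γ → ℝ × Plane} {g : Γ → List Plane} (hf : PolyTime f)
    (hg : PolyTime g) : PolyTime (fun x => (g x).foldl _root_.advance (f x)) :=
  .foldl_small (step := fun _ => _root_.advance) 5 (fun s => by simp) hf hg
    (.advance PolyTime.id.snd.fst PolyTime.id.snd.snd)

theorem PolyTime.segsFrom {f : Γ → ℝ × Plane} {g : Γ → List Plane} (hf : PolyTime f)
    (hg : PolyTime g) : PolyTime (fun x => segsFrom (f x) (g x)) := by
  have key : ∀ (l : List Plane) (s : ℝ × Plane) (r : List Seg),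
      (l.foldl (fun (s : (ℝ × Plane) × List Seg) Q =>
        (_root_.advance s.1 Q, s.2 ++ [⟨s.1.1, s.1.2, (_root_.advance s.1 Q).1, Q⟩])) (s, r)).2 =
        r ++ _root_.segsFrom s l := by
    intro l
    induction l with
    | nil => simp [_root_.segsFrom]
    | cons Q l ih => intro s r; simp [ih, _root_.segsFrom]
  refine PolyTime.congr (f := fun x => ((g x).foldl (fun (s : (ℝ × Plane) × List Seg) Q =>
    (_root_.advance s.1 Q, s.2 ++ [⟨s.1.1, s.1.2, (_root_.advance s.1 Q).1, Q⟩])) (f x, [])).2)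
    (.snd ?_) fun x => by simp [key]
  have hs : PolyTime fun y : Γ × ((ℝ × Plane) × List Seg) × Plane => y.2.1 := PolyTime.id.snd.fst
  have hQ : PolyTime fun y : Γ × ((ℝ × Plane) × List Seg) × Plane => y.2.2 := PolyTime.id.snd.snd
  refine .foldl (.mk hf .nil) hg (.mk (.advance hs.fst hQ) (.append hs.snd
    (.cons (.seg hs.fst.fst hs.fst.snd (PolyTime.advance hs.fst hQ).fst hQ) .nil))) 20
    fun x s Q => ?_
  have h1 := esize_append s.2 [⟨s.1.1, s.1.2, (_root_.advance s.1 Q).1, Q⟩]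
  have h2 : ∀ s : Seg, esize s = 11 := fun s => rfl
  simp [h2] at h1 ⊢; omega

theorem PolyTime.visitsFrom {f : Γ → ℝ × Plane} {g : Γ → List (List Plane)} (hf : PolyTime f)
    (hg : PolyTime g) : PolyTime (fun x => visitsFrom (f x) (g x)) := by
  have key : ∀ (l : List (List Plane)) (s : ℝ × Plane) (r : List ℝ),
      (l.foldl (fun (s : (ℝ × Plane) × List ℝ) l =>
        (l.foldl _root_.advance s.1, s.2 ++ [(l.foldl _root_.advance s.1).1])) (s, r)).2 =
        r ++ _root_.visitsFrom s l := by
    intro l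
    induction l with
    | nil => simp [_root_.visitsFrom]
    | cons Q l ih => intro s r; simp [ih, _root_.visitsFrom]
  refine PolyTime.congr (f := fun x => ((g x).foldl (fun (s : (ℝ × Plane) × List ℝ) l =>
    (l.foldl _root_.advance s.1, s.2 ++ [(l.foldl _root_.advance s.1).1])) (f x, [])).2)
    (.snd ?_) fun x => by simp [key]
  have hs : PolyTime fun y : Γ × ((ℝ × Plane) × List ℝ) × List Plane => y.2.1 :=
    PolyTime.id.snd.fst
  have hQ : PolyTime fun y : Γ × ((ℝ × Plane) × List ℝ) × List Plane => y.2.2 :=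
    PolyTime.id.snd.snd
  refine .foldl (.mk hf .nil) hg (.mk (.foldl_advance hs.fst hQ) (.append hs.snd
    (.cons (PolyTime.foldl_advance hs.fst hQ).fst .nil))) 20 fun x s Q => ?_
  have h1 := esize_append s.2 [(Q.foldl _root_.advance s.1).1]
  simp at h1 ⊢; omega

theorem PolyTime.posMin {l : Γ → List ℝ} (hl : PolyTime l) : PolyTime (fun x => posMin (l x)) :=
  .foldl_small 1 (fun s => by simp) .one hl (.ite (.and (.lt .zero PolyTime.id.snd.snd)
    (.lt PolyTime.id.snd.snd PolyTime.id.snd.fst)) PolyTime.id.snd.snd PolyTime.id.snd.fst)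

theorem PolyTime.minGap {l : Γ → List ℝ} (hl : PolyTime l) : PolyTime (fun x => minGap (l x)) :=
  .posMin (.flatMap hl (.map (hl.comp PolyTime.id.fst) (.sub PolyTime.id.fst.snd PolyTime.id.snd)))

/-- The two filtered lists are disjoint parts of `l`, so only the new element can add to the size.
-/
theorem esize_insertSorted_le (l : List ℝ) (x : ℝ) : esize (insertSorted l x) ≤ esize l + 2 := by
  classical
  have h : ∀ l : List ℝ, esize (l.filter fun y => decide (y < x)) +
      esize (l.filter fun y => decide (x < y)) ≤ esize l + 1 := by
    intro l
    induction l with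
    | nil => simp
    | cons y l ih =>
      by_cases h1 : y < x
      · simp [h1, not_lt.2 h1.le]; omega
      · by_cases h2 : x < y <;> simp [h1, h2] <;> omega
  have h1 := esize_append (l.filter fun y => decide (y < x)) (x :: l.filter fun y => decide (x < y))
  have h2 := h l
  unfold insertSorted
  simp at h1; omega

theorem PolyTime.sortDedup {l : Γ → List ℝ} (hl : PolyTime l) :
    PolyTime (fun x => sortDedup (l x)) := by
  have hs : PolyTime fun y : Γ × List ℝ × ℝ => y.2.1 := PolyTime.id.snd.fst
  have ha : PolyTime fun y : (Γ × List ℝ × ℝ) × ℝ => y.1.2.2 := PolyTime.id.fst.snd.snd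
  exact .foldl (step := fun _ => insertSorted) .nil hl (.append (.filter hs (.lt PolyTime.id.snd ha))
    (.cons PolyTime.id.snd.snd (.filter hs (.lt ha PolyTime.id.snd)))) 2
    fun x s a => by simpa using esize_insertSorted_le s a

end auxiliary

/-- A tour: the start, and for every leg the points that it visits after its first point. -/
abbrev Tour := Plane × List (List Plane)

/-- A snapshot in the format of the output. -/
abbrev RawSnapshot := ℝ × List Plane × List ℕ × List ℕ × Unit

def toursOf (pos : List Plane) (routes : List (ℕ × List (List ℕ))) : List Tour :=
  routes.map fun r => (pos.getD r.1 0, r.2.map fun leg => leg.tail.map fun v => pos.getD v 0)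

/-- All times at which a unit speed motion along a polygonal path is at a corner. -/
def pathTimes (s : ℝ × Plane) (l : List Plane) : List ℝ := s.1 :: (segsFrom s l).map Seg.t₁

/-- Unit of the delays by which the motions are made generic. -/
def delayOf (ε : ℝ) (tours : List Tour) : ℝ :=
  min (minGap (tours.flatMap fun r => pathTimes (0, r.1) r.2.flatten)) ε /
    (8 * (((tours.length + 1 : ℕ) : ℝ) * ((tours.length + 1 : ℕ) : ℝ)))

/-- The factor is the index plus one: the first agenda is delayed too, which leaves time for parking
before any agenda starts. -/
def delayedStart (δ : ℝ) (r : Tour × ℕ) : ℝ × Plane := (δ * ((r.2 + 1 : ℕ) : ℝ), r.1.1)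

/-- The delayed motion along a tour. -/
def delayedToken (δ : ℝ) (r : Tour × ℕ) : Token :=
  ⟨r.2, r.1.1, segsFrom (delayedStart δ r) r.1.2.flatten, visitsFrom (delayedStart δ r) r.1.2⟩

def delayedTokens (δ : ℝ) (tours : List Tour) : List Token :=
  tours.zipIdx.map (delayedToken δ)

/-- All times at which some motion starts or is at a vertex. -/
def cornerTimes (δ : ℝ) (tours : List Tour) : List ℝ :=
  tours.zipIdx.flatMap fun r => pathTimes (delayedStart δ r) r.1.2.flatten

/-- Candidates for the times at which two motions meet. -/
def meetTimes (l : List ℝ) : List ℝ := l.flatMap fun a => l.map fun b => (a + b) / 2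

/-- Distance at which agents without agenda are parked. -/
def parkDist (δ : ℝ) (tours : List Tour) (meets : List ℝ) : ℝ :=
  min (min δ (minGap meets)) (posMin (tours.flatMap fun r => tours.map fun r' => dist r.1 r'.1)) /
    (8 * ((tours.length + 1 : ℕ) : ℝ))

/-- All candidates for exchange times. -/
def eventTimes (ρ : ℝ) (meets : List ℝ) : List ℝ :=
  sortDedup (meets.flatMap fun e => [e - ρ, e, e + ρ])

open Classical in
/-- A point near `z` on one of the given segments that end at `z`. -/
def park (ρ : ℝ) (segs : List Seg) (z : Plane) : Plane :=
  segs.foldl (fun w s => if s.dst = z then AffineMap.lineMap z s.src (ρ / dist z s.src) else w) z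

open Classical in
/-- The agents with empty agenda are parked. -/
def parkToken (ρ : ℝ) (segs : List Seg) (x : Token) : Token :=
  ⟨x.idx, if x.visits = [] then park ρ segs x.home else x.home, x.segs, x.visits⟩

/-- The segments of all agendas are offered, because an agenda without goals has none of its own and
has to be parked on an edge used by another one. -/
def parkTokens (ρ : ℝ) (l : List Token) : List Token :=
  l.map (parkToken ρ (l.flatMap Token.segs))

/-- Half the length of the time windows around the events. -/
def windowOf (ρ : ℝ) (toks : List Token) (events : List ℝ) : ℝ :=
  min (min ρ (minGap events)) (posMin (events.flatMap fun t => toks.flatMap fun x =>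
    toks.map fun y => dist (x.pos t) (y.pos t))) /
    (8 * (((toks.length + 1 : ℕ) : ℝ) * ((events.length + 1 : ℕ) : ℝ)))

def getToken (toks : List Token) (j : ℕ) : Token := toks.getD j ⟨0, 0, [], []⟩

/-- Every agent is where its agenda is intended to be. -/
def idealSnapshot (toks : List Token) (t : ℝ) (J : List ℕ) : RawSnapshot :=
  (t, J.map fun j => (getToken toks j).pos t, J, toks.map fun x => x.count t, ())

open Classical in
/-- The agenda met by `x` at time `t` (`x` itself if there is none). -/
def partner (toks : List Token) (t : ℝ) (x : Token) : ℕ :=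
  toks.foldl (fun j y => if y.idx ≠ x.idx ∧ y.pos t = x.pos t then y.idx else j) x.idx

open Classical in
/-- The situation at the time of an event: agents with meeting agendas have stopped and have
exchanged their agendas. -/
def eventSnapshot (toks : List Token) (h t : ℝ) (J : List ℕ) : RawSnapshot :=
  (t, J.map fun j => if partner toks t (getToken toks j) = (getToken toks j).idx
      then (getToken toks j).pos t else (getToken toks j).pos (t - h),
    J.map fun j => partner toks t (getToken toks j), toks.map fun x => x.count t, ())

/-- The agenda `x` is back at time `t + h` where it was at time `t - h`. -/
def Token.Returns (x : Token) (h t : ℝ) : Prop := x.pos (t - h) = x.pos (t + h)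

open Classical in
/-- The agendas after an event. They are exchanged back if both return. -/
def nextJobs (toks : List Token) (h t : ℝ) (J : List ℕ) : List ℕ :=
  J.map fun j => if (getToken toks j).Returns h t ∧
      (getToken toks (partner toks t (getToken toks j))).Returns h t
    then j else partner toks t (getToken toks j)

/-- In the two outer snapshots every agent is where its agenda is intended to be, so the groups of
consecutive events fit together; deviations occur only inside a window. -/
def eventGroup (toks : List Token) (h t : ℝ) (J : List ℕ) : List RawSnapshot :=
  [idealSnapshot toks (t - h) J, eventSnapshot toks h t J,
    idealSnapshot toks (t + h) (nextJobs toks h t J)]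

def eventSnapshots (toks : List Token) (h : ℝ) : List ℕ → List ℝ → List RawSnapshot
  | _, [] => []
  | J, t :: l => eventGroup toks h t J ++ eventSnapshots toks h (nextJobs toks h t J) l

/-- The time from `0` to `ρ` is used for parking. The second snapshot is already an ideal one. -/
def outputOf (tours : List Tour) (ρ : ℝ) (events : List ℝ) (toks : List Token) :
    List RawSnapshot :=
  (0, tours.map Prod.fst, toks.map Token.idx, toks.map fun _ => 0, ()) ::
    idealSnapshot toks ρ (toks.map Token.idx) ::
      eventSnapshots toks (windowOf ρ toks events) (toks.map Token.idx) events

/-- The solution for given tours and a given delay. -/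
def solveDelayed (δ : ℝ) (tours : List Tour) : List RawSnapshot :=
  outputOf tours (parkDist δ tours (meetTimes (cornerTimes δ tours)))
    (eventTimes (parkDist δ tours (meetTimes (cornerTimes δ tours)))
      (meetTimes (cornerTimes δ tours)))
    (parkTokens (parkDist δ tours (meetTimes (cornerTimes δ tours))) (delayedTokens δ tours))

/-- The format of the input. -/
abbrev RawMission := ℝ × List Plane × List (List ℕ) × List (ℕ × List (List ℕ)) × Unit

/-- The collision resolution. -/
def solve (x : RawMission) : List RawSnapshot :=
  solveDelayed (delayOf x.1 (toursOf x.2.1 x.2.2.2.1)) (toursOf x.2.1 x.2.2.2.1)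

/-! ### Polynomial time for the algorithm -/

section polytime

variable {Γ : Type} [Enc Γ]

theorem PolyTime.toursOf {f : Γ → List Plane} {g : Γ → List (ℕ × List (List ℕ))}
    (hf : PolyTime f) (hg : PolyTime g) : PolyTime (fun x => toursOf (f x) (g x)) :=
  .map hg (.mk (.getD (hf.comp PolyTime.id.fst) PolyTime.id.snd.fst .origin)
    (.map PolyTime.id.snd.snd (.map PolyTime.id.snd.tail
      (.getD (hf.comp PolyTime.id.fst.fst.fst) PolyTime.id.snd .origin))))

theorem PolyTime.pathTimes {f : Γ → ℝ × Plane} {g : Γ → List Plane} (hf : PolyTime f)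
    (hg : PolyTime g) : PolyTime (fun x => pathTimes (f x) (g x)) :=
  .cons hf.fst (.map (.segsFrom hf hg) (PolyTime.segFields PolyTime.id.snd).snd.snd.fst)

theorem PolyTime.delayOf {f : Γ → ℝ} {g : Γ → List Tour} (hf : PolyTime f) (hg : PolyTime g) :
    PolyTime (fun x => delayOf (f x) (g x)) :=
  .div (.min (.minGap (.flatMap hg (.pathTimes (.mk .zero PolyTime.id.snd.fst)
      (.flatten PolyTime.id.snd.snd)))) hf)
    (.mul .eight (.mul hg.length.succ.natCast hg.length.succ.natCast))

theorem PolyTime.delayedStart {f : Γ → ℝ} {g : Γ → Tour × ℕ} (hf : PolyTime f)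
    (hg : PolyTime g) : PolyTime (fun x => delayedStart (f x) (g x)) :=
  .mk (.mul hf hg.snd.succ.natCast) hg.fst.fst

theorem PolyTime.delayedTokens {f : Γ → ℝ} {g : Γ → List Tour} (hf : PolyTime f)
    (hg : PolyTime g) : PolyTime (fun x => delayedTokens (f x) (g x)) :=
  have h := PolyTime.delayedStart (hf.comp PolyTime.id.fst) (PolyTime.id.snd (α := Γ))
  .map hg.zipIdx (.token PolyTime.id.snd.snd PolyTime.id.snd.fst.fst
    (.segsFrom h PolyTime.id.snd.fst.snd.flatten) (.visitsFrom h PolyTime.id.snd.fst.snd))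

theorem PolyTime.cornerTimes {f : Γ → ℝ} {g : Γ → List Tour} (hf : PolyTime f)
    (hg : PolyTime g) : PolyTime (fun x => cornerTimes (f x) (g x)) :=
  .flatMap hg.zipIdx (.pathTimes (.delayedStart (hf.comp PolyTime.id.fst) PolyTime.id.snd)
    PolyTime.id.snd.fst.snd.flatten)

theorem PolyTime.meetTimes {f : Γ → List ℝ} (hf : PolyTime f) :
    PolyTime (fun x => meetTimes (f x)) :=
  .flatMap hf (.map (hf.comp PolyTime.id.fst)
    (.div (.add PolyTime.id.fst.snd PolyTime.id.snd) .two))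

theorem PolyTime.parkDist {f : Γ → ℝ} {g : Γ → List Tour} {m : Γ → List ℝ} (hf : PolyTime f)
    (hg : PolyTime g) (hm : PolyTime m) : PolyTime (fun x => parkDist (f x) (g x) (m x)) :=
  .div (.min (.min hf (.minGap hm)) (.posMin (.flatMap hg (.map (hg.comp PolyTime.id.fst)
    (.dist PolyTime.id.fst.snd.fst PolyTime.id.snd.fst)))))
    (.mul .eight hg.length.succ.natCast)

theorem PolyTime.eventTimes {f : Γ → ℝ} {m : Γ → List ℝ} (hf : PolyTime f) (hm : PolyTime m) :
    PolyTime (fun x => eventTimes (f x) (m x)) :=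
  have h := hf.comp (PolyTime.id.fst (α := Γ) (β := ℝ))
  .sortDedup (.flatMap hm (.cons (.sub PolyTime.id.snd h) (.cons PolyTime.id.snd
    (.cons (.add PolyTime.id.snd h) .nil))))

theorem PolyTime.park {f : Γ → ℝ} {g : Γ → List Seg} {z : Γ → Plane} (hf : PolyTime f)
    (hg : PolyTime g) (hz : PolyTime z) : PolyTime (fun x => park (f x) (g x) (z x)) :=
  have hs := PolyTime.segFields (PolyTime.id.snd.snd (α := Plane) : PolyTime
    fun y : Γ × Plane × Seg => y.2.2)
  have hz' := hz.comp PolyTime.id.fst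
  .foldl_small 3 (fun s => by simp) hz hg (.ite (.planeEq hs.snd.snd.snd hz')
    (.lineMap hz' hs.snd.fst (.div (hf.comp PolyTime.id.fst) (.dist hz' hs.snd.fst)))
    PolyTime.id.snd.fst)

theorem PolyTime.parkTokens {f : Γ → ℝ} {g : Γ → List Token} (hf : PolyTime f)
    (hg : PolyTime g) : PolyTime (fun x => parkTokens (f x) (g x)) :=
  have hx := PolyTime.tokenFields (PolyTime.id.snd : PolyTime fun y : Γ × Token => y.2)
  .map hg (.token hx.fst (.ite (.isNil hx.snd.snd.snd) (.park (hf.comp PolyTime.id.fst)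
    (.flatMap (hg.comp PolyTime.id.fst) (PolyTime.tokenFields PolyTime.id.snd).snd.snd.fst)
      hx.snd.fst) hx.snd.fst) hx.snd.snd.fst hx.snd.snd.snd)

theorem PolyTime.windowOf {f : Γ → ℝ} {g : Γ → List Token} {m : Γ → List ℝ} (hf : PolyTime f)
    (hg : PolyTime g) (hm : PolyTime m) : PolyTime (fun x => windowOf (f x) (g x) (m x)) :=
  .div (.min (.min hf (.minGap hm)) (.posMin (.flatMap hm (.flatMap (hg.comp PolyTime.id.fst)
    (.map (hg.comp PolyTime.id.fst.fst) (.dist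
      (.tokenPos PolyTime.id.fst.snd PolyTime.id.fst.fst.snd)
      (.tokenPos PolyTime.id.snd PolyTime.id.fst.fst.snd)))))))
    (.mul .eight (.mul hg.length.succ.natCast hm.length.succ.natCast))

theorem PolyTime.getToken {g : Γ → List Token} {j : Γ → ℕ} (hg : PolyTime g)
    (hj : PolyTime j) : PolyTime (fun x => getToken (g x) (j x)) :=
  .getD hg hj (.token .natZero .origin .nil .nil)

theorem PolyTime.idealSnapshot {g : Γ → List Token} {t : Γ → ℝ} {J : Γ → List ℕ}
    (hg : PolyTime g) (ht : PolyTime t) (hJ : PolyTime J) :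
    PolyTime (fun x => idealSnapshot (g x) (t x) (J x)) :=
  .mk ht (.mk (.map hJ (.tokenPos (.getToken (hg.comp PolyTime.id.fst) PolyTime.id.snd)
    (ht.comp PolyTime.id.fst))) (.mk hJ (.mk (.map hg (.tokenCount PolyTime.id.snd
      (ht.comp PolyTime.id.fst))) .unit)))

theorem PolyTime.partner {g : Γ → List Token} {t : Γ → ℝ} {f : Γ → Token}
    (hg : PolyTime g) (ht : PolyTime t) (hf : PolyTime f) :
    PolyTime (fun x => partner (g x) (t x) (f x)) :=
  have hx := PolyTime.tokenFields (PolyTime.id.snd.snd : PolyTime fun y : Γ × ℕ × Token => y.2.2)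
  have hf' := hf.comp PolyTime.id.fst
  have ht' := ht.comp PolyTime.id.fst
  .foldl_small 1 (fun s => by simp) hf.tokenFields.fst hg
    (.ite (.and (.not (.natEq hx.fst hf'.tokenFields.fst))
      (.planeEq (.tokenPos PolyTime.id.snd.snd ht') (.tokenPos hf' ht'))) hx.fst
      PolyTime.id.snd.fst)

theorem PolyTime.eventSnapshot {g : Γ → List Token} {h t : Γ → ℝ} {J : Γ → List ℕ}
    (hg : PolyTime g) (hh : PolyTime h) (ht : PolyTime t) (hJ : PolyTime J) :
    PolyTime (fun x => eventSnapshot (g x) (h x) (t x) (J x)) :=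
  have hx := PolyTime.getToken (hg.comp PolyTime.id.fst) (PolyTime.id.snd (α := Γ))
  have ht' := ht.comp PolyTime.id.fst
  have hp := PolyTime.partner (hg.comp PolyTime.id.fst) ht' hx
  .mk ht (.mk (.map hJ (.ite (.natEq hp hx.tokenFields.fst) (.tokenPos hx ht')
    (.tokenPos hx (.sub ht' (hh.comp PolyTime.id.fst))))) (.mk (.map hJ hp)
      (.mk (.map hg (.tokenCount PolyTime.id.snd (ht.comp PolyTime.id.fst))) .unit)))

theorem PolyTest.returns {f : Γ → Token} {h t : Γ → ℝ} (hf : PolyTime f) (hh : PolyTime h)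
    (ht : PolyTime t) : PolyTest (fun x => (f x).Returns (h x) (t x)) :=
  .planeEq (.tokenPos hf (.sub ht hh)) (.tokenPos hf (.add ht hh))

open Classical in
theorem PolyTime.nextJobs {g : Γ → List Token} {h t : Γ → ℝ} {J : Γ → List ℕ}
    (hg : PolyTime g) (hh : PolyTime h) (ht : PolyTime t) (hJ : PolyTime J) :
    PolyTime (fun x => nextJobs (g x) (h x) (t x) (J x)) :=
  have hg' := hg.comp PolyTime.id.fst
  have hh' := hh.comp PolyTime.id.fst
  have ht' := ht.comp PolyTime.id.fst
  have hx := PolyTime.getToken hg' (PolyTime.id.snd (α := Γ))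
  have hp := PolyTime.partner hg' ht' hx
  .map hJ (.ite (.and (.returns hx hh' ht') (.returns (.getToken hg' hp) hh' ht'))
    PolyTime.id.snd hp)

theorem PolyTime.eventGroup {g : Γ → List Token} {h t : Γ → ℝ} {J : Γ → List ℕ}
    (hg : PolyTime g) (hh : PolyTime h) (ht : PolyTime t) (hJ : PolyTime J) :
    PolyTime (fun x => eventGroup (g x) (h x) (t x) (J x)) :=
  .cons (.idealSnapshot hg (.sub ht hh) hJ) (.cons (.eventSnapshot hg hh ht hJ)
    (.cons (.idealSnapshot hg (.add ht hh) (.nextJobs hg hh ht hJ)) .nil))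

theorem esize_list_nat (l : List ℕ) : esize l = 2 * l.length + 1 := by
  induction l with
  | nil => rfl
  | cons a l ih => simp [ih]; omega

/-- The snapshots of one event contain the current list of jobs, which belongs to the state of the
fold. The invariant that this list is as long as the list of tokens bounds the increment in terms of
the context. -/
theorem PolyTime.eventSnapshots {g : Γ → List Token} {h : Γ → ℝ} {E : Γ → List ℝ}
    (hg : PolyTime g) (hh : PolyTime h) (hE : PolyTime E) :
    PolyTime (fun x => eventSnapshots (g x) (h x) ((g x).map Token.idx) (E x)) := by
  have key : ∀ (g : List Token) (h : ℝ) (l : List ℝ) (J : List ℕ) (r : List RawSnapshot),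
      (l.foldl (fun (s : List ℕ × List RawSnapshot) t =>
        (_root_.nextJobs g h t s.1, s.2 ++ _root_.eventGroup g h t s.1)) (J, r)).2 =
        r ++ _root_.eventSnapshots g h J l := by
    intro g h l
    induction l with
    | nil => simp [_root_.eventSnapshots]
    | cons t l ih => intro J r; simp [ih, _root_.eventSnapshots]
  refine PolyTime.comp (g := fun z : List Token × ℝ × List ℝ =>
    _root_.eventSnapshots z.1 z.2.1 (z.1.map Token.idx) z.2.2) ?_ (hg.mk (hh.mk hE))
  refine PolyTime.congr (f := fun z : List Token × ℝ × List ℝ =>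
    (z.2.2.foldl (fun (s : List ℕ × List RawSnapshot) t => (_root_.nextJobs z.1 z.2.1 t s.1,
      s.2 ++ _root_.eventGroup z.1 z.2.1 t s.1)) (z.1.map Token.idx, [])).2)
    (.snd ?_) fun x => by simp [key]
  obtain ⟨Q, hQ⟩ := (PolyTime.eventGroup (Γ := List Token × ℝ × ℝ × List ℕ) PolyTime.id.fst
    PolyTime.id.snd.fst PolyTime.id.snd.snd.fst PolyTime.id.snd.snd.snd).exists_esize_le
  have hs : PolyTime fun y : (List Token × ℝ × List ℝ) × (List ℕ × List RawSnapshot) × ℝ => y.2.1 :=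
    PolyTime.id.snd.fst
  refine .foldl_of_inv (.mk (.map PolyTime.id.fst (PolyTime.tokenFields PolyTime.id.snd).fst) .nil)
    PolyTime.id.snd.snd (.mk (.nextJobs PolyTime.id.fst.fst PolyTime.id.fst.snd.fst
      PolyTime.id.snd.snd hs.fst) (.append hs.snd (.eventGroup PolyTime.id.fst.fst
        PolyTime.id.fst.snd.fst PolyTime.id.snd.snd hs.fst)))
    (fun x s => s.1.length = x.1.length) (fun x => by simp)
    (fun x s t hx => by simpa [_root_.nextJobs] using hx) (Q.comp (3 * .X + 20)) fun x s t hx => ?_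
  have h1 := esize_append s.2 (_root_.eventGroup x.1 x.2.1 t s.1)
  have h2 := hQ (x.1, x.2.1, t, s.1)
  have h3 := length_le_esize x.1
  have h4 : esize (_root_.nextJobs x.1 x.2.1 t s.1) = esize s.1 := by
    simp [esize_list_nat, _root_.nextJobs]
  have h5 : Q.eval (esize (x.1, x.2.1, t, s.1)) ≤ Q.eval (3 * (esize x + esize t) + 20) := by
    apply Q.eval_mono_nat
    simp only [esize_pair, esize_list_nat, hx, esize_real]; omega
  simp only [Polynomial.eval_comp, Polynomial.eval_add, Polynomial.eval_mul, Polynomial.eval_X,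
    Polynomial.eval_ofNat, esize_pair (α := List ℕ), h4] at h5 ⊢
  simp only [esize_pair] at h2 h5 ⊢
  omega

theorem PolyTime.outputOf {f : Γ → List Tour} {ρ : Γ → ℝ} {E : Γ → List ℝ} {g : Γ → List Token}
    (hf : PolyTime f) (hρ : PolyTime ρ) (hE : PolyTime E) (hg : PolyTime g) :
    PolyTime (fun x => outputOf (f x) (ρ x) (E x) (g x)) :=
  have hJ := hg.map (PolyTime.tokenFields PolyTime.id.snd).fst
  .cons (.mk .zero (.mk (.map hf PolyTime.id.snd.fst) (.mk hJ (.mk (.map hg .natZero) .unit))))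
    (.cons (.idealSnapshot hg hρ hJ) (.eventSnapshots hg (.windowOf hρ hg hE) hE))

theorem PolyTime.solveDelayed {f : Γ → ℝ} {g : Γ → List Tour} (hf : PolyTime f)
    (hg : PolyTime g) : PolyTime (fun x => solveDelayed (f x) (g x)) :=
  have hm := PolyTime.meetTimes (.cornerTimes hf hg)
  have hρ := PolyTime.parkDist hf hg hm
  .outputOf hg hρ (.eventTimes hρ hm) (.parkTokens hρ (.delayedTokens hf hg))

theorem polyTime_solve : PolyTime solve :=
  have hg := PolyTime.toursOf PolyTime.id.snd.fst PolyTime.id.snd.snd.snd.fst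
  .solveDelayed (.delayOf PolyTime.id.fst hg) hg

end polytime

/-! ## Motion along a polygonal path -/

open Classical in
/-- The position at time `t` on a path that starts at `z` and consists of the given segments. -/
def tracePos (z : Plane) (l : List Seg) (t : ℝ) : Plane :=
  l.foldl (fun z s => if s.t₀ < t then (if t < s.t₁ then s.pos t else s.dst) else z) z

/-- The corners of a path with the times at which they are reached. -/
def corners : ℝ × Plane → List Plane → List (ℝ × Plane)
  | s, [] => [s]
  | s, Q :: l => s :: corners (advance s Q) l

theorem self_mem_corners (s : ℝ × Plane) (l : List Plane) : s ∈ corners s l := by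
  cases l <;> simp [corners]

theorem map_fst_corners (s : ℝ × Plane) (l : List Plane) :
    (corners s l).map Prod.fst = pathTimes s l := by
  induction l generalizing s with
  | nil => simp [corners, pathTimes, segsFrom]
  | cons Q l ih => simp [corners, ih, pathTimes, segsFrom]

theorem fst_mem_pathTimes {s w : ℝ × Plane} {l : List Plane} (h : w ∈ corners s l) :
    w.1 ∈ pathTimes s l := by
  rw [← map_fst_corners]; exact List.mem_map_of_mem h

theorem exists_corner_of_mem {s : ℝ × Plane} {l : List Plane} {t : ℝ} (h : t ∈ pathTimes s l) :
    ∃ z, (t, z) ∈ corners s l := by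
  rw [← map_fst_corners] at h
  obtain ⟨w, hw, rfl⟩ := List.mem_map.1 h
  exact ⟨w.2, hw⟩

theorem corners_append_right {s w : ℝ × Plane} {l l' : List Plane}
    (h : w ∈ corners (l.foldl advance s) l') : w ∈ corners s (l ++ l') := by
  induction l generalizing s with
  | nil => exact h
  | cons Q l ih => exact List.mem_cons_of_mem _ (ih h)

theorem end_mem_corners (s : ℝ × Plane) (l : List Plane) : l.foldl advance s ∈ corners s l := by
  simpa using corners_append_right (self_mem_corners (l.foldl advance s) [])

theorem end_mem_corners_append (s : ℝ × Plane) (l l' : List Plane) :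
    l.foldl advance s ∈ corners s (l ++ l') :=
  corners_append_right (self_mem_corners _ _)

theorem fst_le_advance (s : ℝ × Plane) (Q : Plane) : s.1 ≤ (advance s Q).1 :=
  le_add_of_nonneg_right dist_nonneg

theorem le_of_mem_corners {s w : ℝ × Plane} {l : List Plane} (h : w ∈ corners s l) :
    s.1 ≤ w.1 := by
  induction l generalizing s with
  | nil => simp only [corners, List.mem_singleton] at h; rw [h]
  | cons Q l ih =>
    rcases List.mem_cons.1 h with rfl | h
    · exact le_rfl
    · exact (fst_le_advance s Q).trans (ih h)

theorem le_end_of_mem_corners {s w : ℝ × Plane} {l : List Plane} (h : w ∈ corners s l) :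
    w.1 ≤ (l.foldl advance s).1 := by
  induction l generalizing s with
  | nil => simp only [corners, List.mem_singleton] at h; rw [h]; rfl
  | cons Q l ih =>
    rcases List.mem_cons.1 h with rfl | h
    · exact le_of_mem_corners (end_mem_corners w (Q :: l))
    · exact ih h

theorem seg_mem_corners {s : ℝ × Plane} {l : List Plane} {g : Seg} (h : g ∈ segsFrom s l) :
    (g.t₀, g.src) ∈ corners s l ∧ (g.t₁, g.dst) ∈ corners s l := by
  induction l generalizing s with
  | nil => simp [segsFrom] at h
  | cons Q l ih =>
    rcases List.mem_cons.1 h with rfl | h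
    · exact ⟨List.mem_cons_self, List.mem_cons_of_mem _ (self_mem_corners (advance s Q) l)⟩
    · exact ⟨List.mem_cons_of_mem _ (ih h).1, List.mem_cons_of_mem _ (ih h).2⟩

theorem seg_t₁_eq {s : ℝ × Plane} {l : List Plane} {g : Seg} (h : g ∈ segsFrom s l) :
    g.t₁ = g.t₀ + dist g.src g.dst := by
  induction l generalizing s with
  | nil => simp [segsFrom] at h
  | cons Q l ih =>
    rcases List.mem_cons.1 h with rfl | h
    · rfl
    · exact ih h

theorem rel_of_mem_segsFrom {R : Plane → Plane → Prop} {s : ℝ × Plane} {l : List Plane}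
    (hR : (s.2 :: l).IsChain R) {g : Seg} (h : g ∈ segsFrom s l) : R g.src g.dst := by
  induction l generalizing s with
  | nil => simp [segsFrom] at h
  | cons Q l ih =>
    rw [List.isChain_cons_cons] at hR
    rcases List.mem_cons.1 h with rfl | h
    · exact hR.1
    · exact ih hR.2 h

theorem eq_or_exists_seg_of_mem_corners {s w : ℝ × Plane} {l : List Plane}
    (h : w ∈ corners s l) : w = s ∨ ∃ g ∈ segsFrom s l, g.t₁ = w.1 ∧ g.dst = w.2 := by
  induction l generalizing s with
  | nil => exact Or.inl (by simpa [corners] using h)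
  | cons Q l ih =>
    rcases List.mem_cons.1 h with rfl | h
    · exact Or.inl rfl
    · rcases ih h with rfl | ⟨g, hg, h1⟩
      · exact Or.inr ⟨_, List.mem_cons_self, rfl, rfl⟩
      · exact Or.inr ⟨g, List.mem_cons_of_mem _ hg, h1⟩

theorem tracePos_of_le {s : ℝ × Plane} {l : List Plane} {t : ℝ} (h : t ≤ s.1) (z : Plane) :
    tracePos z (segsFrom s l) t = z := by
  induction l generalizing s with
  | nil => rfl
  | cons Q l ih =>
    have := ih (h.trans (fst_le_advance s Q))
    simpa [tracePos, segsFrom, not_lt.2 h] using this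

theorem Seg.pos_t₀ (g : Seg) : g.pos g.t₀ = g.src := by simp [Seg.pos]

theorem Seg.pos_t₁ {g : Seg} (h : g.t₀ < g.t₁) : g.pos g.t₁ = g.dst := by
  simp [Seg.pos, div_self (sub_pos.2 h).ne']

theorem tracePos_cons (z : Plane) (g : Seg) (l : List Seg) (t : ℝ) :
    tracePos z (g :: l) t =
      tracePos (if g.t₀ < t then (if t < g.t₁ then g.pos t else g.dst) else z) l t := by
  simp only [tracePos, List.foldl_cons]

/-- On a time interval without corners in its interior the motion is uniform. -/
theorem tracePos_piece {s : ℝ × Plane} {l : List Plane} (hl : (s.2 :: l).IsChain (· ≠ ·))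
    {a b : ℝ} (h : ∀ w ∈ corners s l, w.1 ∉ Set.Ioo a b) :
    (b ≤ s.1 ∧ ∀ t ∈ Set.Icc a b, tracePos s.2 (segsFrom s l) t = s.2) ∨
    (∃ g ∈ segsFrom s l, g.t₀ ≤ a ∧ b ≤ g.t₁ ∧
      ∀ t ∈ Set.Icc a b, tracePos s.2 (segsFrom s l) t = g.pos t) ∨
    ((l.foldl advance s).1 ≤ a ∧
      ∀ t ∈ Set.Icc a b, tracePos s.2 (segsFrom s l) t = (l.foldl advance s).2) := by
  rcases le_or_gt b s.1 with hb | hb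
  · exact Or.inl ⟨hb, fun t ht => tracePos_of_le (ht.2.trans hb) _⟩
  have ha : s.1 ≤ a := not_lt.1 fun ha => h s (self_mem_corners s l) ⟨ha, hb⟩
  induction l generalizing s with
  | nil => exact Or.inr (Or.inr ⟨ha, fun t _ => rfl⟩)
  | cons Q l ih =>
    rw [List.isChain_cons_cons] at hl
    have hlt : s.1 < (advance s Q).1 := lt_add_of_pos_right _ (dist_pos.2 hl.1)
    set g : Seg := ⟨s.1, s.2, (advance s Q).1, Q⟩ with hg
    rcases le_or_gt b (advance s Q).1 with hb' | hb'
    · refine Or.inr (Or.inl ⟨g, List.mem_cons_self, ha, hb', fun t ht => ?_⟩)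
      rw [segsFrom, tracePos_cons, tracePos_of_le (ht.2.trans hb')]
      -- The fold evaluates `g.pos` only strictly inside the time span of `g`; at its ends the
      -- values `s.2` and `Q` agree with it.
      split_ifs with h1 h2
      · rfl
      · rw [show t = g.t₁ from le_antisymm (ht.2.trans hb') (not_lt.1 h2), Seg.pos_t₁ hlt]
      · rw [show t = g.t₀ from le_antisymm (not_lt.1 h1) (ha.trans ht.1), Seg.pos_t₀]
    · have ha' : (advance s Q).1 ≤ a := not_lt.1 fun ha =>
        h _ (List.mem_cons_of_mem _ (self_mem_corners (advance s Q) l)) ⟨ha, hb'⟩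
      have key : ∀ t ∈ Set.Icc a b, tracePos s.2 (segsFrom s (Q :: l)) t =
          tracePos Q (segsFrom (advance s Q) l) t := by
        intro t ht
        rw [segsFrom, tracePos_cons, if_pos (hlt.trans_le (ha'.trans ht.1)),
          if_neg (not_lt.2 (ha'.trans ht.1))]
      rcases ih (s := advance s Q) hl.2 (fun w hw => h w (List.mem_cons_of_mem _ hw)) hb' ha' with
        h1 | ⟨g', hg', h1, h2, h3⟩ | ⟨h1, h2⟩
      · exact absurd h1.1 (not_le.2 hb')
      · exact Or.inr (Or.inl ⟨g', List.mem_cons_of_mem _ hg', h1, h2,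
          fun t ht => (key t ht).trans (h3 t ht)⟩)
      · exact Or.inr (Or.inr ⟨h1, fun t ht => (key t ht).trans (h2 t ht)⟩)

theorem tracePos_corner {s w : ℝ × Plane} {l : List Plane} (hl : (s.2 :: l).IsChain (· ≠ ·))
    (hw : w ∈ corners s l) : tracePos s.2 (segsFrom s l) w.1 = w.2 := by
  induction l generalizing s with
  | nil => simp only [corners, List.mem_singleton] at hw; rw [hw]; rfl
  | cons Q l ih =>
    rcases List.mem_cons.1 hw with rfl | hw
    · exact tracePos_of_le le_rfl _
    · rw [List.isChain_cons_cons] at hl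
      have hlt : s.1 < (advance s Q).1 := lt_add_of_pos_right _ (dist_pos.2 hl.1)
      have h1 := le_of_mem_corners hw
      rw [segsFrom, tracePos_cons, if_pos (hlt.trans_le h1), if_neg (not_lt.2 h1)]
      exact ih hl.2 hw

theorem advance_shift (s : ℝ × Plane) (Q : Plane) (d : ℝ) :
    advance (s.1 + d, s.2) Q = ((advance s Q).1 + d, (advance s Q).2) := by
  simp [advance]; ring

/-- A delay moves all corner times of a route by the same amount. Coincidences between delayed
routes can thus be excluded by comparing delays with gaps between undelayed times. -/
theorem pathTimes_shift (s : ℝ × Plane) (l : List Plane) (d : ℝ) :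
    pathTimes (s.1 + d, s.2) l = (pathTimes s l).map (· + d) := by
  rw [← map_fst_corners, ← map_fst_corners]
  induction l generalizing s with
  | nil => simp [corners]
  | cons Q l ih => simp [corners, advance_shift, ih]

/-! ## Visits -/

theorem length_visitsFrom (s : ℝ × Plane) (ls : List (List Plane)) :
    (visitsFrom s ls).length = ls.length := by
  induction ls generalizing s with
  | nil => rfl
  | cons l ls ih => simp [visitsFrom, ih]

theorem visits_mem {s : ℝ × Plane} {ls : List (List Plane)} {v : ℝ} (h : v ∈ visitsFrom s ls) :
    v ∈ pathTimes s ls.flatten := by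
  induction ls generalizing s with
  | nil => simp [visitsFrom] at h
  | cons l ls ih =>
    rw [List.flatten_cons]
    rcases List.mem_cons.1 h with rfl | h
    · exact fst_mem_pathTimes (end_mem_corners_append s l _)
    · obtain ⟨z, hz⟩ := exists_corner_of_mem (ih h)
      exact fst_mem_pathTimes (corners_append_right hz)

theorem visitsFrom_pairwise (s : ℝ × Plane) (ls : List (List Plane)) :
    (visitsFrom s ls).Pairwise (· ≤ ·) := by
  induction ls generalizing s with
  | nil => simp [visitsFrom]
  | cons l ls ih =>
    refine List.pairwise_cons.2 ⟨fun v hv => ?_, ih _⟩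
    obtain ⟨z, hz⟩ := exists_corner_of_mem (visits_mem hv)
    exact le_of_mem_corners hz

/-- In a sorted list the entries up to `t` form an initial part, so their number determines which
visits have been made. -/
theorem lt_length_filter_le_iff {l : List ℝ} (hl : l.Pairwise (· ≤ ·)) (t : ℝ) (m : ℕ) :
    m < (l.filter fun v => decide (v ≤ t)).length ↔ ∃ v, l[m]? = some v ∧ v ≤ t := by
  induction l generalizing m with
  | nil => simp
  | cons a l ih =>
    rw [List.pairwise_cons] at hl
    by_cases h : a ≤ t
    · cases m with
      | zero => simp [h]
      | succ m => simp [h, ih hl.2]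
    · have : ∀ v ∈ l, ¬ v ≤ t := fun v hv hvt => h ((hl.1 v hv).trans hvt)
      have h0 : (List.filter (fun v => decide (v ≤ t)) (a :: l)) = [] := by
        simp only [List.filter_eq_nil_iff, decide_eq_true_eq, List.mem_cons]
        rintro v (rfl | hv)
        exacts [h, this v hv]
      simp only [h0, List.length_nil, not_lt_zero, false_iff, not_exists, not_and]
      intro v hv
      rcases List.mem_cons.1 (List.mem_of_getElem? hv) with rfl | hv
      exacts [h, this v hv]

/-! ## Routes as polygonal paths -/

namespace Route

variable {n : ℕ} {G : SimpleGraph (Fin n)} (pos : Fin n → Plane)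

/-- The points that a route visits, leg by leg, without the first point of each leg. -/
def legPoints : {u : Fin n} → {gs : List (Fin n)} → Route G u gs → List (List Plane)
  | _, _, .done _ => []
  | _, _, .leg p rest => p.support.tail.map pos :: rest.legPoints

/-- The end of a route. -/
def finish : {u : Fin n} → {gs : List (Fin n)} → Route G u gs → Fin n
  | u, _, .done _ => u
  | _, _, .leg _ rest => rest.finish

theorem length_legPoints {u : Fin n} {gs : List (Fin n)} (r : Route G u gs) :
    (r.legPoints pos).length = gs.length := by
  induction r with
  | done u => rfl
  | leg p rest ih => simp [legPoints, ih]

theorem getLast?_eq {u : Fin n} {gs : List (Fin n)} (r : Route G u gs) (h : gs ≠ []) :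
    gs.getLast? = some r.finish := by
  induction r with
  | done u => exact absurd rfl h
  | @leg u g gs p rest ih =>
    rcases gs with _ | ⟨g', gs⟩
    · cases rest; rfl
    · rw [List.getLast?_cons_cons, ih (by simp)]; rfl

theorem foldl_advance_walk {u v : Fin n} (p : G.Walk u v) (T : ℝ) :
    (p.support.tail.map pos).foldl advance (T, pos u) = (T + walkTime pos p, pos v) := by
  induction p generalizing T with
  | nil => simp [walkTime]
  | @cons u v w h p ih =>
    rw [SimpleGraph.Walk.support_cons, List.tail_cons, ← p.cons_tail_support,
      List.map_cons, List.foldl_cons]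
    simp only [advance]
    rw [ih]
    simp [walkTime, add_assoc]

theorem foldl_advance {u : Fin n} {gs : List (Fin n)} (r : Route G u gs) (T : ℝ) :
    (r.legPoints pos).flatten.foldl advance (T, pos u) = (T + r.time pos, pos r.finish) := by
  induction r generalizing T with
  | done u => simp [legPoints, time, finish]
  | leg p rest ih =>
    rw [legPoints, List.flatten_cons, List.foldl_append, foldl_advance_walk, ih, time, finish,
      add_assoc]

/-- The first point of a leg is dropped because it is the last point of the preceding one; so the
concatenated legs neither repeat nor miss a corner. -/
theorem isChain_walk {u v : Fin n} (p : G.Walk u v) {R : Plane → Plane → Prop} {l : List Plane}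
    (hR : ∀ d ∈ p.darts, R (pos d.fst) (pos d.snd)) (hl : (pos v :: l).IsChain R) :
    (pos u :: (p.support.tail.map pos ++ l)).IsChain R := by
  induction p with
  | nil => simpa using hl
  | @cons u v w h p ih =>
    rw [SimpleGraph.Walk.support_cons, List.tail_cons, ← p.cons_tail_support,
      List.map_cons, List.cons_append, List.isChain_cons_cons]
    exact ⟨hR ⟨(u, v), h⟩ (by simp), ih (fun d hd => hR d (by simp [hd])) hl⟩

theorem isChain {u : Fin n} {gs : List (Fin n)} (r : Route G u gs) {R : Plane → Plane → Prop}
    (hR : ∀ d ∈ r.darts, R (pos d.fst) (pos d.snd)) :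
    (pos u :: (r.legPoints pos).flatten).IsChain R := by
  induction r with
  | done u => simp [legPoints]
  | leg p rest ih =>
    simp only [darts, List.mem_append] at hR
    rw [legPoints, List.flatten_cons]
    exact isChain_walk pos p (fun d hd => hR d (Or.inl hd)) (ih fun d hd => hR d (Or.inr hd))

theorem visit_corner {u : Fin n} {gs : List (Fin n)} (r : Route G u gs) (T : ℝ) (m : ℕ) {v : ℝ}
    (h : (visitsFrom (T, pos u) (r.legPoints pos))[m]? = some v) :
    ∃ g, gs[m]? = some g ∧ (v, pos g) ∈ corners (T, pos u) (r.legPoints pos).flatten := by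
  induction r generalizing T m with
  | done u => simp [legPoints, visitsFrom] at h
  | @leg u g gs p rest ih =>
    rw [legPoints, visitsFrom, foldl_advance_walk] at h
    rw [legPoints, List.flatten_cons]
    cases m with
    | zero =>
      refine ⟨g, rfl, ?_⟩
      have h1 := end_mem_corners_append (T, pos u) (p.support.tail.map pos)
        (rest.legPoints pos).flatten
      rw [foldl_advance_walk] at h1
      simp only [List.getElem?_cons_zero, Option.some.injEq] at h
      rwa [← h]
    | succ m =>
      rw [List.getElem?_cons_succ] at h
      obtain ⟨g', h1, h2⟩ := ih _ m h
      exact ⟨g', by simpa using h1, corners_append_right (by rwa [foldl_advance_walk])⟩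

end Route

theorem Seg.dist_pos {g : Seg} (h : g.t₀ < g.t₁) (hg : g.t₁ = g.t₀ + dist g.src g.dst) (a b : ℝ) :
    dist (g.pos a) (g.pos b) = |a - b| := by
  have hL : dist g.src g.dst = g.t₁ - g.t₀ := by linarith
  have h0 : 0 < g.t₁ - g.t₀ := sub_pos.2 h
  rw [Seg.pos, Seg.pos, dist_lineMap_lineMap, hL, Real.dist_eq, ← sub_div, abs_div, abs_of_pos h0,
    div_mul_cancel₀ _ h0.ne']
  congr 1; ring

/-- Later segments override earlier ones, so the last segment ending at `z` decides. Only this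
alternative is used: either nothing arrives at `z`, or parking takes place on an edge of some route.
-/
theorem tracePos_park (ρ : ℝ) (segs : List Seg) (z : Plane) :
    (park ρ segs z = z ∧ ∀ s ∈ segs, s.dst ≠ z) ∨
      ∃ s ∈ segs, s.dst = z ∧ park ρ segs z = AffineMap.lineMap z s.src (ρ / dist z s.src) := by
  induction segs using List.reverseRecOn with
  | nil => exact Or.inl ⟨rfl, by simp⟩
  | append_singleton l s ih =>
    have key : park ρ (l ++ [s]) z =
        if s.dst = z then AffineMap.lineMap z s.src (ρ / dist z s.src) else park ρ l z := by
      simp [park]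
    by_cases h : s.dst = z
    · exact Or.inr ⟨s, by simp, h, by rw [key, if_pos h]⟩
    · rw [if_neg h] at key
      rcases ih with ⟨h1, h2⟩ | ⟨s', hs', h1, h2⟩
      · refine Or.inl ⟨key.trans h1, fun s' hs' => ?_⟩
        rcases List.mem_append.1 hs' with hs' | hs'
        · exact h2 s' hs'
        · rw [List.mem_singleton.1 hs']; exact h
      · exact Or.inr ⟨s', by simp [hs'], h1, key.trans h2⟩

/-! ### The delayed motions of a mission -/

namespace Mission

variable {n k : ℕ} (M : Mission n k) (δ ρ : ℝ)

/-- The tour of agent `i` as a list of points. -/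
def tour (i : Fin k) : Tour := (M.pos (M.start i), (M.route i).legPoints M.pos)

/-- The delayed start of tour `i`. -/
def startOf (i : Fin k) : ℝ × Plane := delayedStart δ (M.tour i, i.val)

/-- The delayed motion along route `i`. -/
def segs (i : Fin k) : List Seg := segsFrom (M.startOf δ i) (M.tour i).2.flatten

/-- The times at which the delayed motion along route `i` is at a vertex. -/
def times (i : Fin k) : List ℝ := pathTimes (M.startOf δ i) (M.tour i).2.flatten

/-- The time at which the delayed motion along route `i` ends. -/
def finishTime (i : Fin k) : ℝ := ((M.tour i).2.flatten.foldl advance (M.startOf δ i)).1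

def allSegs : List Seg := (List.ofFn fun i => M.segs δ i).flatten

def token (i : Fin k) : Token :=
  parkToken ρ (M.allSegs δ) (delayedToken δ (M.tour i, i.val))

/-- The intended position of agenda `i`. -/
def place (i : Fin k) (t : ℝ) : Plane := (M.token δ ρ i).pos t

variable {M δ ρ}

theorem startOf_fst (i : Fin k) : (M.startOf δ i).1 = δ * ((i.val + 1 : ℕ) : ℝ) := rfl

theorem startOf_eq (i : Fin k) : M.startOf δ i = ((M.startOf δ i).1, M.pos (M.start i)) := rfl

theorem finish_eq (i : Fin k) : (M.tour i).2.flatten.foldl advance (M.startOf δ i) =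
    (M.finishTime δ i, M.pos (M.route i).finish) := by
  rw [finishTime, startOf_eq, tour, Route.foldl_advance]

theorem finishTime_eq (i : Fin k) :
    M.finishTime δ i = (M.startOf δ i).1 + (M.route i).time M.pos := by
  rw [finishTime, startOf_eq, tour, Route.foldl_advance]

theorem start_mem_times (i : Fin k) : (M.startOf δ i).1 ∈ M.times δ i :=
  fst_mem_pathTimes (self_mem_corners _ _)

theorem finishTime_mem_times (i : Fin k) : M.finishTime δ i ∈ M.times δ i :=
  fst_mem_pathTimes (end_mem_corners _ _)

theorem le_of_mem_times {i : Fin k} {t : ℝ} (h : t ∈ M.times δ i) :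
    (M.startOf δ i).1 ≤ t ∧ t ≤ M.finishTime δ i := by
  obtain ⟨z, hz⟩ := exists_corner_of_mem h
  exact ⟨le_of_mem_corners hz, le_end_of_mem_corners hz⟩

theorem t₀_mem_times {i : Fin k} {s : Seg} (h : s ∈ M.segs δ i) : s.t₀ ∈ M.times δ i :=
  fst_mem_pathTimes (seg_mem_corners h).1

theorem t₁_mem_times {i : Fin k} {s : Seg} (h : s ∈ M.segs δ i) : s.t₁ ∈ M.times δ i :=
  fst_mem_pathTimes (seg_mem_corners h).2

theorem mem_allSegs {s : Seg} : s ∈ M.allSegs δ ↔ ∃ i, s ∈ M.segs δ i := by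
  simp [allSegs]

theorem legPoints_eq_nil_iff (i : Fin k) : (M.tour i).2 = [] ↔ M.goals i = [] := by
  rw [← List.length_eq_zero_iff, ← List.length_eq_zero_iff, tour, Route.length_legPoints]

theorem visits_eq_nil_iff (i : Fin k) : (M.token δ ρ i).visits = [] ↔ M.goals i = [] := by
  rw [← legPoints_eq_nil_iff, ← List.length_eq_zero_iff, ← List.length_eq_zero_iff]
  simp [token, parkToken, delayedToken, length_visitsFrom]

theorem segs_eq_nil {i : Fin k} (h : M.goals i = []) : M.segs δ i = [] := by
  rw [segs, (legPoints_eq_nil_iff i).2 h]; rfl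

theorem place_eq (i : Fin k) (t : ℝ) :
    M.place δ ρ i t = tracePos (M.token δ ρ i).home (M.segs δ i) t := rfl

theorem home_of_ne_nil {i : Fin k} (h : M.goals i ≠ []) :
    (M.token δ ρ i).home = M.pos (M.start i) :=
  if_neg (mt (visits_eq_nil_iff (δ := δ) (ρ := ρ) i).1 h)

theorem home_of_eq_nil {i : Fin k} (h : M.goals i = []) :
    (M.token δ ρ i).home = park ρ (M.allSegs δ) (M.pos (M.start i)) :=
  if_pos ((visits_eq_nil_iff (δ := δ) (ρ := ρ) i).2 h)

theorem place_of_eq_nil {i : Fin k} (h : M.goals i = []) (t : ℝ) :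
    M.place δ ρ i t = (M.token δ ρ i).home := by
  rw [place_eq, segs_eq_nil h]; rfl

theorem place_of_ne_nil {i : Fin k} (h : M.goals i ≠ []) (t : ℝ) :
    M.place δ ρ i t = tracePos (M.startOf δ i).2 (M.segs δ i) t := by
  rw [place_eq, home_of_ne_nil h]; rfl

theorem isChain_dart (i : Fin k) : ((M.startOf δ i).2 :: (M.tour i).2.flatten).IsChain
    fun x y => ∃ d ∈ (M.route i).darts, x = M.pos d.fst ∧ y = M.pos d.snd :=
  Route.isChain _ _ fun d hd => ⟨d, hd, rfl, rfl⟩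

theorem exists_dart {i : Fin k} {s : Seg} (hs : s ∈ M.segs δ i) :
    ∃ d ∈ (M.route i).darts, s.src = M.pos d.fst ∧ s.dst = M.pos d.snd :=
  rel_of_mem_segsFrom (isChain_dart i) hs

namespace IsTourAssignment

variable (hM : M.IsTourAssignment)

include hM

theorem pos_ne {u v : Fin n} (h : M.graph.Adj u v) : M.pos u ≠ M.pos v :=
  fun h' => h.ne (hM.embedded.injective h')

theorem isChain_ne (i : Fin k) : ((M.startOf δ i).2 :: (M.tour i).2.flatten).IsChain (· ≠ ·) :=
  (Route.isChain _ _ fun d _ => hM.pos_ne d.adj : _)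

theorem seg_lt {i : Fin k} {s : Seg} (hs : s ∈ M.segs δ i) : s.t₀ < s.t₁ := by
  rw [seg_t₁_eq hs]
  exact lt_add_of_pos_right _ (dist_pos.2 (rel_of_mem_segsFrom (hM.isChain_ne i) hs))

/-- Where a motion is at the corners. -/
theorem place_corner {i : Fin k} (hi : M.goals i ≠ []) {w : ℝ × Plane}
    (hw : w ∈ corners (M.startOf δ i) (M.tour i).2.flatten) : M.place δ ρ i w.1 = w.2 := by
  rw [place_of_ne_nil hi]; exact tracePos_corner (hM.isChain_ne i) hw

/-- The second alternative makes the lateness condition of `Generic` applicable to the end of a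
route. The first covers routes that never leave their start, with no goal or with the start as the
only goal. -/
theorem finish_cases (i : Fin k) :
    (M.finishTime δ i = (M.startOf δ i).1 ∧ (M.route i).finish = M.start i) ∨
      ∃ s ∈ M.segs δ i, s.t₁ = M.finishTime δ i ∧ s.dst = M.pos (M.route i).finish := by
  rcases eq_or_exists_seg_of_mem_corners (end_mem_corners (M.startOf δ i) (M.tour i).2.flatten)
    with h | ⟨s, hs, h⟩
  · have h := (finish_eq i).symm.trans h
    exact Or.inl ⟨(Prod.ext_iff.1 h).1, hM.embedded.injective (Prod.ext_iff.1 h).2⟩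
  · rw [finish_eq] at h
    exact Or.inr ⟨s, hs, h⟩

/-- A nonempty tour ends at one of its goals, and no goal belongs to two tours; hence finished
agendas do not block each other. -/
theorem finish_ne {i j : Fin k} (hij : i ≠ j) (hi : M.goals i ≠ []) (hj : M.goals j ≠ []) :
    (M.route i).finish ≠ (M.route j).finish := fun h => by
  have h1 := (M.route i).getLast?_eq hi
  have h2 := (M.route j).getLast?_eq hj
  rw [h] at h1
  exact hM.goals_disjoint i j hij (List.mem_of_getLast? h1) (List.mem_of_getLast? h2)

/-- Interior points of edges are not vertices. -/
theorem lineMap_ne_pos {u v : Fin n} (h : M.graph.Adj u v) {θ : ℝ} (h0 : 0 < θ) (h1 : θ < 1)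
    (w : Fin n) : AffineMap.lineMap (M.pos u) (M.pos v) θ ≠ M.pos w := by
  intro hw
  have hne := hM.pos_ne h
  have hmem : M.pos w ∈ segment ℝ (M.pos u) (M.pos v) := by
    rw [segment_eq_image_lineMap, ← hw]; exact ⟨θ, ⟨h0.le, h1.le⟩, rfl⟩
  have hinj := AffineMap.lineMap_injective ℝ hne
  rcases hM.embedded.vertex u v w h hmem with rfl | rfl
  · exact h0.ne' (hinj (by rw [hw, AffineMap.lineMap_apply_zero]))
  · exact h1.ne (hinj (by rw [hw, AffineMap.lineMap_apply_one]))

/-- Edges do not meet in interior points. -/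
theorem eq_of_lineMap_eq {u v w x : Fin n} (h : M.graph.Adj u v) (h' : M.graph.Adj w x)
    {a b : ℝ} (ha : 0 < a) (ha' : a < dist (M.pos u) (M.pos v)) (hb : 0 < b)
    (hb' : b < dist (M.pos w) (M.pos x))
    (heq : AffineMap.lineMap (M.pos u) (M.pos v) (a / dist (M.pos u) (M.pos v)) =
      AffineMap.lineMap (M.pos w) (M.pos x) (b / dist (M.pos w) (M.pos x))) :
    (w = u ∧ x = v ∧ a = b) ∨ (w = v ∧ x = u ∧ a + b = dist (M.pos u) (M.pos v)) := by
  have hL := ha.trans ha'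
  have hL' := hb.trans hb'
  have a0 := div_pos ha hL
  have a1 := (div_lt_one hL).2 ha'
  have b0 := div_pos hb hL'
  have b1 := (div_lt_one hL').2 hb'
  by_cases hs : s(u, v) = s(w, x)
  · have hinj := AffineMap.lineMap_injective ℝ (hM.pos_ne h)
    rcases Sym2.eq_iff.1 hs with ⟨rfl, rfl⟩ | ⟨rfl, rfl⟩
    · refine Or.inl ⟨rfl, rfl, ?_⟩
      have := hinj heq
      rwa [div_left_inj' hL.ne'] at this
    · refine Or.inr ⟨rfl, rfl, ?_⟩
      rw [← AffineMap.lineMap_apply_one_sub (M.pos u), dist_comm (M.pos v)] at heq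
      have := hinj heq
      field_simp at this
      linarith
  · obtain ⟨y, -, -, hy⟩ := hM.embedded.edge u v w x h h' hs _
      (by rw [segment_eq_image_lineMap]; exact ⟨_, ⟨a0.le, a1.le⟩, rfl⟩)
      (by rw [heq, segment_eq_image_lineMap]; exact ⟨_, ⟨b0.le, b1.le⟩, rfl⟩)
    exact absurd hy (hM.lineMap_ne_pos h a0 a1 y)

end IsTourAssignment

end Mission

/-! ### General position and the possible states of an agenda -/

namespace Mission

variable {n k : ℕ} {M : Mission n k} {δ ρ : ℝ}

/-- `t` is the mean of two times at which agendas are at vertices. -/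
def IsMeetTime (M : Mission n k) (δ t : ℝ) : Prop :=
  ∃ i j, ∃ a ∈ M.times δ i, ∃ b ∈ M.times δ j, t = (a + b) / 2

theorem isMeetTime_of_mem {i : Fin k} {t : ℝ} (h : t ∈ M.times δ i) : M.IsMeetTime δ t :=
  ⟨i, i, t, h, t, h, by ring⟩

/-- The delays and the parking distance are so small that the motions are in general position. -/
structure Generic (M : Mission n k) (δ ρ : ℝ) : Prop where
  park_pos : 0 < ρ
  disjoint : ∀ i j t, t ∈ M.times δ i → t ∈ M.times δ j → i = j
  late : ∀ i j, ∀ s ∈ M.segs δ i, (M.startOf δ j).1 < s.t₁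
  long : ∀ i, ∀ s ∈ M.segs δ i, 2 * ρ < s.t₁ - s.t₀
  park_ne : ∀ s t, M.IsMeetTime δ s → M.IsMeetTime δ t → s ≠ t + ρ

/-- Agenda `i` rests at the vertex `v` around time `t`. -/
structure RestsAt (M : Mission n k) (δ ρ t h : ℝ) (i : Fin k) (v : Fin n) : Prop where
  place : ∀ u ∈ Set.Icc (t - h) (t + h), M.place δ ρ i u = M.pos v
  notMem : t ∉ (M.token δ ρ i).visits
  reason : (t < (M.startOf δ i).1 ∧ v = M.start i) ∨
    (M.goals i ≠ [] ∧ M.finishTime δ i < t ∧ v = (M.route i).finish) ∨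
    (v = M.start i ∧ ∀ j, ∀ s ∈ M.segs δ j, s.dst ≠ M.pos v)

/-- Agenda `i` is empty and parked on the edge from `u` to `v`. -/
structure ParkedAt (M : Mission n k) (δ ρ : ℝ) (i : Fin k) (u v : Fin n) : Prop where
  adj : M.graph.Adj u v
  start : M.start i = u
  goals : M.goals i = []
  long : 2 * ρ < dist (M.pos u) (M.pos v)
  place : ∀ t, M.place δ ρ i t =
    AffineMap.lineMap (M.pos u) (M.pos v) (ρ / dist (M.pos u) (M.pos v))

/-- Agenda `i` is at the vertex `v` exactly at time `t`. -/
structure PassesAt (M : Mission n k) (δ ρ t : ℝ) (i : Fin k) (v : Fin n) : Prop where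
  goals : M.goals i ≠ []
  mem : t ∈ M.times δ i
  place : M.place δ ρ i t = M.pos v
  reason : (t = (M.startOf δ i).1 ∧ v = M.start i) ∨
    ∃ s ∈ M.segs δ i, s.t₁ = t ∧ s.dst = M.pos v

/-- Agenda `i`, which left `u` at time `t₀`, moves from `u` to `v` around time `t`. -/
structure MovesOn (M : Mission n k) (δ ρ t h : ℝ) (i : Fin k) (u v : Fin n) (t₀ : ℝ) : Prop where
  adj : M.graph.Adj u v
  notMem : t ∉ M.times δ i
  mem₀ : t₀ ∈ M.times δ i
  mem₁ : t₀ + dist (M.pos u) (M.pos v) ∈ M.times δ i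
  le₀ : t₀ ≤ t - h
  le₁ : t + h ≤ t₀ + dist (M.pos u) (M.pos v)
  place : ∀ x ∈ Set.Icc (t - h) (t + h), M.place δ ρ i x =
    AffineMap.lineMap (M.pos u) (M.pos v) ((x - t₀) / dist (M.pos u) (M.pos v))

theorem visit_mem_times {i : Fin k} {t : ℝ} (h : t ∈ (M.token δ ρ i).visits) :
    t ∈ M.times δ i := visits_mem h

theorem notMem_visits_of_eq_nil {i : Fin k} (h : M.goals i = []) (t : ℝ) :
    t ∉ (M.token δ ρ i).visits := by
  rw [(visits_eq_nil_iff i).2 h]; simp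

theorem dist_eq_of_seg {i : Fin k} {s : Seg} (hs : s ∈ M.segs δ i) :
    dist s.src s.dst = s.t₁ - s.t₀ := by rw [seg_t₁_eq hs]; ring

theorem PassesAt.eq (hg : Generic M δ ρ) {i j : Fin k} {t : ℝ} {v w : Fin n} (hi : PassesAt M δ ρ t i v)
    (hj : PassesAt M δ ρ t j w) : i = j := hg.disjoint i j t hi.mem hj.mem

variable (hM : M.IsTourAssignment) (hg : Generic M δ ρ)

include hM

theorem MovesOn.ne_pos {i : Fin k} {t h t₀ : ℝ} {u v : Fin n} (hh : 0 < h)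
    (hi : MovesOn M δ ρ t h i u v t₀) (w : Fin n) : M.place δ ρ i t ≠ M.pos w := by
  have h1 := hi.le₀
  have h2 := hi.le₁
  rw [hi.place t ⟨by linarith, by linarith⟩]
  exact hM.lineMap_ne_pos hi.adj (div_pos (by linarith) (by linarith))
    ((div_lt_one (by linarith)).2 (by linarith)) w

include hg

/-- No corner time other than `t` lies in the window. An agenda with goals is therefore at a corner
at time `t` or moves uniformly throughout the window; one without goals is parked unless no segment
ends at its start. -/
theorem state_cases (i : Fin k) {t h : ℝ} (hh : 0 < h)
    (hw : ∀ w ∈ M.times δ i, w ∈ Set.Ioo (t - h) (t + h) → w = t) :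
    (∃ v, RestsAt M δ ρ t h i v) ∨ (∃ v, PassesAt M δ ρ t i v) ∨
      (∃ u v, ParkedAt M δ ρ i u v) ∨ ∃ u v t₀, MovesOn M δ ρ t h i u v t₀ := by
  by_cases hi : M.goals i = []
  · have hp := place_of_eq_nil (δ := δ) (ρ := ρ) hi
    rw [home_of_eq_nil hi] at hp
    rcases tracePos_park ρ (M.allSegs δ) (M.pos (M.start i)) with ⟨h1, h2⟩ | ⟨s, hs, h1, h2⟩
    · exact Or.inl ⟨M.start i, fun u _ => (hp u).trans h1, notMem_visits_of_eq_nil hi t,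
        Or.inr (Or.inr ⟨rfl, fun j s hs => h2 s (mem_allSegs.2 ⟨j, hs⟩)⟩)⟩
    · obtain ⟨j, hj⟩ := mem_allSegs.1 hs
      obtain ⟨d, hd, hd1, hd2⟩ := exists_dart hj
      -- The segment arrives at the start of agenda `i`; the parking edge is the same edge in the
      -- opposite direction.
      have hd3 : d.snd = M.start i := hM.embedded.injective (hd2.symm.trans h1)
      refine Or.inr (Or.inr (Or.inl ⟨M.start i, d.fst, hd3 ▸ d.adj.symm, rfl, hi, ?_, fun t => ?_⟩))
      · rw [dist_comm, ← h1, ← hd1, dist_eq_of_seg hj]; exact hg.long j s hj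
      · rw [hp, h2, hd1]
  by_cases ht : t ∈ M.times δ i
  · obtain ⟨z, hz⟩ := exists_corner_of_mem ht
    have hz' := hM.place_corner (ρ := ρ) hi hz
    rcases eq_or_exists_seg_of_mem_corners hz with h1 | ⟨s, hs, h1, h2⟩
    · have h3 := Prod.ext_iff.1 h1
      exact Or.inr (Or.inl ⟨M.start i, hi, ht, hz'.trans h3.2, Or.inl ⟨h3.1, rfl⟩⟩)
    · obtain ⟨d, hd, hd1, hd2⟩ := exists_dart hs
      exact Or.inr (Or.inl ⟨d.snd, hi, ht, hz'.trans (h2.symm.trans hd2),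
        Or.inr ⟨s, hs, h1, hd2⟩⟩)
  have hpl := place_of_ne_nil (δ := δ) (ρ := ρ) hi
  rcases tracePos_piece (hM.isChain_ne (δ := δ) i) (a := t - h) (b := t + h)
    (fun w hw1 hw2 => ht (hw w.1 (fst_mem_pathTimes hw1) hw2 ▸ fst_mem_pathTimes hw1)) with
    ⟨h1, h2⟩ | ⟨s, hs, h1, h2, h3⟩ | ⟨h1, h2⟩
  · exact Or.inl ⟨M.start i, fun u hu => (hpl u).trans (h2 u hu), fun hv => ht (visit_mem_times hv),
      Or.inl ⟨by linarith, rfl⟩⟩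
  · obtain ⟨d, hd, hd1, hd2⟩ := exists_dart hs
    have hL := dist_eq_of_seg hs
    rw [hd1, hd2] at hL
    refine Or.inr (Or.inr (Or.inr ⟨d.fst, d.snd, s.t₀, d.adj, ht, t₀_mem_times hs, ?_, h1, ?_,
      fun x hx => ?_⟩))
    · rw [hL, add_sub_cancel]; exact t₁_mem_times hs
    · rw [hL, add_sub_cancel]; exact h2
    · rw [hpl, segs, h3 x hx, Seg.pos, hd1, hd2, hL]
  · have h4 := finish_eq (M := M) (δ := δ) i
    rw [h4] at h1 h2
    exact Or.inl ⟨(M.route i).finish, fun u hu => (hpl u).trans (h2 u hu),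
      fun hv => ht (visit_mem_times hv), Or.inr (Or.inl ⟨hi, by dsimp only at h1; linarith, rfl⟩)⟩

/-! ### Which motions may meet -/

/-- Starts are distinct, and so are final goals. An agenda finished at the start of another one
would have arrived there by a segment: this is too late if the other has not started, and impossible
if no segment ends there. -/
theorem RestsAt.eq {i j : Fin k} {t h : ℝ} {v : Fin n} (hi : RestsAt M δ ρ t h i v)
    (hj : RestsAt M δ ρ t h j v) : i = j := by
  by_contra hij
  -- The mixed case: agenda `i` has finished at the start vertex of agenda `j`, which still rests
  -- there.
  have key : ∀ i j : Fin k, i ≠ j → v = M.start j →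
      (t < (M.startOf δ j).1 ∨ ∀ l, ∀ s ∈ M.segs δ l, s.dst ≠ M.pos v) →
      M.finishTime δ i < t → v ≠ (M.route i).finish := by
    rintro i j hij hv hj hi hv'
    rcases hM.finish_cases (δ := δ) i with ⟨h1, h2⟩ | ⟨s, hs, h1, h2⟩
    · exact hij (hM.start_injective (by rw [← h2, ← hv', hv]))
    · rcases hj with hj | hj
      · have := hg.late i j s hs; linarith
      · exact hj i s hs (by rw [h2, hv'])
  rcases hi.reason with ⟨h1, h2⟩ | ⟨h1, h2, h3⟩ | ⟨h1, h2⟩ <;>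
  rcases hj.reason with ⟨h4, h5⟩ | ⟨h4, h5, h6⟩ | ⟨h4, h5⟩
  · exact hij (hM.start_injective (h2 ▸ h5))
  · exact key j i (Ne.symm hij) h2 (Or.inl h1) h5 h6
  · exact hij (hM.start_injective (h2 ▸ h4))
  · exact key i j hij h5 (Or.inl h4) h2 h3
  · exact hM.finish_ne hij h1 h4 (h3 ▸ h6)
  · exact key i j hij h4 (Or.inr h5) h2 h3
  · exact hij (hM.start_injective (h1 ▸ h5))
  · exact key j i (Ne.symm hij) h1 (Or.inr h2) h5 h6
  · exact hij (hM.start_injective (h1 ▸ h4))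

/-- Parking places are interior points of edges. If two coincide, the edges are the same; from
opposite ends this would require an edge of length `2 * ρ`, and edges used for parking are longer.
-/
theorem ParkedAt.eq {i j : Fin k} {t : ℝ} {u v w x : Fin n} (hi : ParkedAt M δ ρ i u v)
    (hj : ParkedAt M δ ρ j w x) (h : M.place δ ρ i t = M.place δ ρ j t) : i = j := by
  have h1 := hg.park_pos
  have h2 := hi.long
  have h3 := hj.long
  rw [hi.place, hj.place] at h
  rcases hM.eq_of_lineMap_eq hi.adj hj.adj h1 (by linarith) h1 (by linarith) h with
    ⟨h4, -, -⟩ | ⟨-, -, h4⟩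
  · exact hM.start_injective (by rw [hi.start, hj.start, h4])
  · linarith

theorem ParkedAt.ne_pos {i : Fin k} {t : ℝ} {u v : Fin n} (hi : ParkedAt M δ ρ i u v) (w : Fin n) :
    M.place δ ρ i t ≠ M.pos w := by
  have h1 := hg.park_pos
  have h2 := hi.long
  rw [hi.place]
  exact hM.lineMap_ne_pos hi.adj (div_pos h1 (by linarith)) ((div_lt_one (by linarith)).2
    (by linarith)) w

/-- Two motions along edges meet only if they go in opposite directions. -/
theorem MovesOn.opposite {i j : Fin k} {t h t₀ t₁ : ℝ} {u v w x : Fin n} (hh : 0 < h)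
    (hij : i ≠ j) (hi : MovesOn M δ ρ t h i u v t₀) (hj : MovesOn M δ ρ t h j w x t₁)
    (heq : M.place δ ρ i t = M.place δ ρ j t) :
    w = v ∧ x = u ∧ (t - t₀) + (t - t₁) = dist (M.pos u) (M.pos v) := by
  have h1 := hi.le₀
  have h2 := hi.le₁
  have h3 := hj.le₀
  have h4 := hj.le₁
  rw [hi.place t ⟨by linarith, by linarith⟩, hj.place t ⟨by linarith, by linarith⟩] at heq
  rcases hM.eq_of_lineMap_eq hi.adj hj.adj (by linarith) (by linarith) (by linarith) (by linarith)
    heq with ⟨-, -, h5⟩ | h5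
  -- Motion in the same direction would mean departure from the same vertex at the same time,
  -- contrary to the disjointness of corner times.
  · have h6 : t₀ = t₁ := by linarith
    exact absurd (hg.disjoint i j t₀ hi.mem₀ (h6 ▸ hj.mem₀)) hij
  · exact h5

theorem MovesOn.isMeetTime {i j : Fin k} {t h t₀ t₁ : ℝ} {u v w x : Fin n} (hh : 0 < h)
    (hij : i ≠ j) (hi : MovesOn M δ ρ t h i u v t₀) (hj : MovesOn M δ ρ t h j w x t₁)
    (heq : M.place δ ρ i t = M.place δ ρ j t) : M.IsMeetTime δ t := by
  obtain ⟨-, -, h1⟩ := hi.opposite hM hg hh hij hj heq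
  -- The meeting time is the mean of the arrival time of one agenda and the departure time of the
  -- other.
  exact ⟨i, j, _, hi.mem₁, _, hj.mem₀, by linarith⟩

/-- The times at which a motion passes a parking position. -/
theorem MovesOn.parked {i j : Fin k} {t h t₀ : ℝ} {u v w x : Fin n} (hh : 0 < h)
    (hi : MovesOn M δ ρ t h i u v t₀) (hj : ParkedAt M δ ρ j w x)
    (heq : M.place δ ρ i t = M.place δ ρ j t) :
    ∃ s, M.IsMeetTime δ s ∧ (t = s + ρ ∨ s = t + ρ) := by
  have h1 := hi.le₀
  have h2 := hi.le₁
  have h3 := hg.park_pos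
  have h4 := hj.long
  rw [hi.place t ⟨by linarith, by linarith⟩, hj.place] at heq
  rcases hM.eq_of_lineMap_eq hi.adj hj.adj (by linarith) (by linarith) (by linarith) (by linarith)
    heq with ⟨-, -, h5⟩ | ⟨-, -, h5⟩
  · exact ⟨t₀, isMeetTime_of_mem hi.mem₀, Or.inl (by linarith)⟩
  · exact ⟨_, isMeetTime_of_mem hi.mem₁, Or.inr (by linarith)⟩

/-- No three agendas meet. -/
theorem eq_of_place_eq {i j l : Fin k} {t h : ℝ} (hh : 0 < h)
    (hw : ∀ i, ∀ w ∈ M.times δ i, w ∈ Set.Ioo (t - h) (t + h) → w = t)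
    (hij : i ≠ j) (hil : i ≠ l) (h1 : M.place δ ρ i t = M.place δ ρ j t)
    (h2 : M.place δ ρ i t = M.place δ ρ l t) : j = l := by
  by_contra hjl
  have h3 := h1.symm.trans h2
  have ht : t ∈ Set.Icc (t - h) (t + h) := ⟨by linarith, by linarith⟩
  -- Two moving agendas meet at a mean of corner times, while a parked one is passed `ρ` before or
  -- after a corner time. The parking distance is chosen so that these times never agree.
  have mixed : ∀ {i j l : Fin k} {u v w x y z : Fin n} {t₀ t₁ : ℝ}, i ≠ j →
      MovesOn M δ ρ t h i u v t₀ → MovesOn M δ ρ t h j w x t₁ → ParkedAt M δ ρ l y z →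
      M.place δ ρ i t = M.place δ ρ j t → M.place δ ρ i t = M.place δ ρ l t → False := by
    intro i j l u v w x y z t₀ t₁ hij hi hj hl h1 h2
    obtain ⟨s, hs, h3⟩ := hi.parked hM hg hh hl h2
    have h4 := hi.isMeetTime hM hg hh hij hj h1
    rcases h3 with h3 | h3
    · exact hg.park_ne _ _ h4 hs h3
    · exact hg.park_ne _ _ hs h4 h3
  have rest : ∀ {i j : Fin k} {v w : Fin n}, RestsAt M δ ρ t h i v → RestsAt M δ ρ t h j w →
      M.place δ ρ i t = M.place δ ρ j t → i = j := by
    intro i j v w hi hj h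
    rw [hi.place t ht, hj.place t ht] at h
    exact hi.eq hM hg (hM.embedded.injective h ▸ hj)
  have vertex : ∀ {i j : Fin k} {v : Fin n}, M.place δ ρ i t = M.place δ ρ j t →
      M.place δ ρ i t = M.pos v → ((∃ v, RestsAt M δ ρ t h j v) ∨ ∃ v, PassesAt M δ ρ t j v) := by
    intro i j v h1 h2
    rcases state_cases hM hg j hh (hw j) with h | h | ⟨u, w, h⟩ | ⟨u, w, t₀, h⟩
    · exact Or.inl h
    · exact Or.inr h
    · exact absurd (h1.symm.trans h2) (h.ne_pos hM hg v)
    · exact absurd (h1.symm.trans h2) (h.ne_pos hM hh v)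
  have inner : ∀ {i j : Fin k}, M.place δ ρ i t = M.place δ ρ j t →
      (∀ v, M.place δ ρ i t ≠ M.pos v) → ((∃ u v, ParkedAt M δ ρ j u v) ∨
        ∃ u v t₀, MovesOn M δ ρ t h j u v t₀) := by
    intro i j h1 h2
    rcases state_cases hM hg j hh (hw j) with ⟨v, h⟩ | ⟨v, h⟩ | h | h
    · exact absurd (h1.trans (h.place t ht)) (h2 v)
    · exact absurd (h1.trans h.place) (h2 v)
    · exact Or.inl h
    · exact Or.inr h
  -- At a vertex there is at most one resting and one passing agenda. In the interior of an edge
  -- there is at most one parked agenda, and moving agendas that meet have opposite directions.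
  by_cases hv : ∃ v, M.place δ ρ i t = M.pos v
  · obtain ⟨v, hv⟩ := hv
    rcases vertex rfl hv with ⟨vi, hi⟩ | ⟨vi, hi⟩ <;>
    rcases vertex h1 hv with ⟨vj, hj⟩ | ⟨vj, hj⟩ <;>
    rcases vertex h2 hv with ⟨vl, hl⟩ | ⟨vl, hl⟩
    all_goals first
      | exact hij (rest hi hj h1)
      | exact hil (rest hi hl h2)
      | exact hjl (rest hj hl h3)
      | exact hij (hi.eq hg hj)
      | exact hil (hi.eq hg hl)
      | exact hjl (hj.eq hg hl)
  · push Not at hv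
    rcases inner rfl hv with ⟨ui, vi, hi⟩ | ⟨ui, vi, ti, hi⟩ <;>
    rcases inner h1 hv with ⟨uj, vj, hj⟩ | ⟨uj, vj, tj, hj⟩ <;>
    rcases inner h2 hv with ⟨ul, vl, hl⟩ | ⟨ul, vl, tl, hl⟩
    all_goals first
      | exact hij (hi.eq hM hg hj h1)
      | exact hil (hi.eq hM hg hl h2)
      | exact hjl (hj.eq hM hg hl h3)
      | exact mixed hij hi hj hl h1 h2
      | exact mixed hil hi hl hj h2 h1
      | exact mixed hjl hj hl hi h3 h1.symm
      | skip
    -- What remains are three moving agendas, and these cannot be pairwise opposite.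
    obtain ⟨a1, a2, -⟩ := hi.opposite hM hg hh hij hj h1
    obtain ⟨b1, b2, -⟩ := hi.opposite hM hg hh hil hl h2
    obtain ⟨c1, c2, -⟩ := hj.opposite hM hg hh hjl hl h3
    subst a1 b1
    exact hM.pos_ne hj.adj (by rw [← c1])

end Mission

namespace Mission

variable {n k : ℕ} {M : Mission n k} {δ ρ : ℝ}

/-! ### Uniform motion between corners -/

/-- Agenda `i` moves uniformly during the time interval from `a` to `b`. -/
structure UniformOn (M : Mission n k) (δ ρ : ℝ) (i : Fin k) (a b : ℝ) : Prop where
  affine : ∀ θ ∈ Set.Icc (0 : ℝ) 1, M.place δ ρ i (AffineMap.lineMap a b θ) =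
    AffineMap.lineMap (M.place δ ρ i a) (M.place δ ρ i b) θ
  dist_le : dist (M.place δ ρ i a) (M.place δ ρ i b) ≤ b - a
  onRoutes : Snapshot.OnRoutes M (M.place δ ρ i a) (M.place δ ρ i b)
  le_finish : M.place δ ρ i a ≠ M.place δ ρ i b → M.goals i ≠ [] ∧ b ≤ M.finishTime δ i

theorem uniformOn_of_const {i : Fin k} {a b : ℝ} {z : Plane} (hab : a ≤ b)
    (h : ∀ t ∈ Set.Icc a b, M.place δ ρ i t = z) : UniformOn M δ ρ i a b := by
  have ha := h a ⟨le_rfl, hab⟩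
  have hb := h b ⟨hab, le_rfl⟩
  refine ⟨fun θ hθ => ?_, by rw [ha, hb, dist_self]; linarith, Or.inl (ha.trans hb.symm),
    fun h => absurd (ha.trans hb.symm) h⟩
  rw [ha, hb, AffineMap.lineMap_same_apply]
  apply h
  rw [← segment_eq_Icc hab, segment_eq_image_lineMap]
  exact ⟨θ, hθ, rfl⟩

theorem uniformOn_of_seg {i : Fin k} {a b : ℝ} {s : Seg} (hi : M.goals i ≠ [])
    (hab : a ≤ b) (hs : s ∈ M.segs δ i) (hlt : s.t₀ < s.t₁) (h0 : s.t₀ ≤ a) (h1 : b ≤ s.t₁)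
    (h : ∀ t ∈ Set.Icc a b, M.place δ ρ i t = s.pos t) : UniformOn M δ ρ i a b := by
  have ha := h a ⟨le_rfl, hab⟩
  have hb := h b ⟨hab, le_rfl⟩
  refine ⟨fun θ hθ => ?_, ?_, ?_, fun _ => ⟨hi, h1.trans (le_of_mem_times (t₁_mem_times hs)).2⟩⟩
  · rw [ha, hb, h _ (by
      rw [← segment_eq_Icc hab, segment_eq_image_lineMap]; exact ⟨θ, hθ, rfl⟩)]
    simp only [Seg.pos]
    rw [← AffineMap.apply_lineMap]
    congr 1
    simp only [AffineMap.lineMap_apply, vsub_eq_sub, smul_eq_mul, vadd_eq_add]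
    ring
  · rw [ha, hb, Seg.dist_pos hlt (seg_t₁_eq hs), abs_sub_comm, abs_of_nonneg (by linarith)]
  · obtain ⟨d, hd, hd1, hd2⟩ := exists_dart hs
    have key : ∀ t ∈ Set.Icc a b, s.pos t ∈ segment ℝ (M.pos d.fst) (M.pos d.snd) := by
      intro t ht
      rw [← hd1, ← hd2, segment_eq_image_lineMap]
      have := sub_pos.2 hlt
      exact ⟨_, ⟨div_nonneg (by linarith [ht.1]) this.le,
        (div_le_one this).2 (by linarith [ht.2])⟩, rfl⟩
    exact Or.inr ⟨i, d, hd, ha ▸ key a ⟨le_rfl, hab⟩, hb ▸ key b ⟨hab, le_rfl⟩⟩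

variable (hM : M.IsTourAssignment)

include hM

theorem place_piece {i : Fin k} (hi : M.goals i ≠ []) {a b : ℝ}
    (h : ∀ w ∈ M.times δ i, w ∉ Set.Ioo a b) :
    (b ≤ (M.startOf δ i).1 ∧ ∀ t ∈ Set.Icc a b, M.place δ ρ i t = M.pos (M.start i)) ∨
    (∃ s ∈ M.segs δ i, s.t₀ ≤ a ∧ b ≤ s.t₁ ∧ ∀ t ∈ Set.Icc a b, M.place δ ρ i t = s.pos t) ∨
    (M.finishTime δ i ≤ a ∧
      ∀ t ∈ Set.Icc a b, M.place δ ρ i t = M.pos (M.route i).finish) := by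
  have h1 := tracePos_piece (hM.isChain_ne (δ := δ) i)
    (fun w hw => h w.1 (fst_mem_pathTimes hw))
  have h2 := finish_eq (M := M) (δ := δ) i
  rw [h2] at h1
  simp only [place_of_ne_nil hi]
  exact h1

theorem uniformOn {i : Fin k} {a b : ℝ} (hab : a ≤ b)
    (h : ∀ w ∈ M.times δ i, w ∉ Set.Ioo a b) : UniformOn M δ ρ i a b := by
  by_cases hi : M.goals i = []
  · exact uniformOn_of_const hab fun t _ => place_of_eq_nil hi t
  rcases place_piece hM (ρ := ρ) hi h with ⟨-, h2⟩ | ⟨s, hs, h1, h2, h3⟩ | ⟨-, h2⟩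
  · exact uniformOn_of_const hab h2
  · exact uniformOn_of_seg hi hab hs (hM.seg_lt hs) h1 h2 h3
  · exact uniformOn_of_const hab h2

/-! ### Visits and counts -/

omit hM in
theorem lt_count_iff (i : Fin k) (t : ℝ) (m : ℕ) :
    m < (M.token δ ρ i).count t ↔ ∃ v, (M.token δ ρ i).visits[m]? = some v ∧ v ≤ t := by
  have h := lt_length_filter_le_iff (l := (M.token δ ρ i).visits)
    (visitsFrom_pairwise (M.startOf δ i) (M.tour i).2) t m
  rw [← h, Token.count]

omit hM in
theorem count_mono (i : Fin k) {t t' : ℝ} (h : t ≤ t') :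
    (M.token δ ρ i).count t ≤ (M.token δ ρ i).count t' := by
  by_contra hlt
  obtain ⟨v, hv, hvt⟩ := (lt_count_iff i t _).1 (not_le.1 hlt)
  exact lt_irrefl _ ((lt_count_iff i t' _).2 ⟨v, hv, hvt.trans h⟩)

omit hM in
theorem length_visits (i : Fin k) : (M.token δ ρ i).visits.length = (M.goals i).length := by
  simp [token, parkToken, delayedToken, length_visitsFrom, tour, Route.length_legPoints]

omit hM in
theorem count_of_finishTime_le (i : Fin k) {t : ℝ} (h : M.finishTime δ i ≤ t) :
    (M.token δ ρ i).count t = (M.goals i).length := by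
  rw [← length_visits (δ := δ) (ρ := ρ), Token.count, List.filter_eq_self.2]
  intro v hv
  simpa using (le_of_mem_times (visit_mem_times hv)).2.trans h

theorem exists_goal {i : Fin k} {m : ℕ} {v : ℝ}
    (h : (M.token δ ρ i).visits[m]? = some v) :
    ∃ g, (M.goals i)[m]? = some g ∧ M.place δ ρ i v = M.pos g := by
  obtain ⟨g, hg, hv⟩ := (M.route i).visit_corner M.pos (M.startOf δ i).1 m (v := v) h
  refine ⟨g, hg, hM.place_corner (fun hi => ?_) hv⟩
  rw [hi] at hg; simp at hg

theorem place_finish {i : Fin k} (hi : M.goals i ≠ []) {t : ℝ} (ht : M.finishTime δ i ≤ t) :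
    M.place δ ρ i t = M.pos (M.route i).finish := by
  rcases place_piece hM (ρ := ρ) (δ := δ) (a := t) (b := t) hi (by simp) with
    ⟨h1, h2⟩ | ⟨s, hs, h1, h2, h3⟩ | ⟨h1, h2⟩
  · rw [h2 t ⟨le_rfl, le_rfl⟩]
    have h3 := (le_of_mem_times (start_mem_times (M := M) (δ := δ) i)).2
    rcases hM.finish_cases (δ := δ) i with ⟨-, h4⟩ | ⟨s, hs, h4, h5⟩
    · rw [h4]
    · have h6 := hM.seg_lt hs
      have h7 := (le_of_mem_times (t₀_mem_times hs)).1
      linarith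
  · have h4 := (le_of_mem_times (t₁_mem_times hs)).2
    have h5 : t = M.finishTime δ i := le_antisymm (by linarith) ht
    have h6 := hM.place_corner (ρ := ρ) hi (end_mem_corners (M.startOf δ i) _)
    have h7 := finish_eq (M := M) (δ := δ) i
    rw [h7] at h6
    rw [h5]; exact h6
  · exact h2 t ⟨le_rfl, le_rfl⟩

/-! ### Meetings -/

/-- The times at which agendas may meet. -/
def IsEventTime (M : Mission n k) (δ ρ t : ℝ) : Prop :=
  ∃ s, M.IsMeetTime δ s ∧ (t = s - ρ ∨ t = s ∨ t = s + ρ)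

/-- Agenda `i` moves through the position of the resting agenda `j`. -/
structure Passes (M : Mission n k) (δ ρ t h : ℝ) (i j : Fin k) : Prop where
  rest : ∀ u ∈ Set.Icc (t - h) (t + h), M.place δ ρ j u = M.place δ ρ i t
  left : dist (M.place δ ρ i (t - h)) (M.place δ ρ i t) = h
  right : dist (M.place δ ρ i t) (M.place δ ρ i (t + h)) = h
  notMem : t ∉ (M.token δ ρ j).visits

/-- The agendas `i` and `j` move in opposite directions and meet. -/
structure HeadOn (M : Mission n k) (δ ρ t h : ℝ) (i j : Fin k) : Prop where
  left : M.place δ ρ i (t - h) = M.place δ ρ j (t + h)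
  right : M.place δ ρ i (t + h) = M.place δ ρ j (t - h)
  ne : M.place δ ρ i (t - h) ≠ M.place δ ρ i (t + h)
  notMem_left : t ∉ (M.token δ ρ i).visits
  notMem_right : t ∉ (M.token δ ρ j).visits

omit hM in
theorem MovesOn.dist_eq {i : Fin k} {t h t₀ : ℝ} {u v : Fin n} (hh : 0 < h)
    (hi : MovesOn M δ ρ t h i u v t₀) {a b : ℝ} (ha : a ∈ Set.Icc (t - h) (t + h))
    (hb : b ∈ Set.Icc (t - h) (t + h)) :
    dist (M.place δ ρ i a) (M.place δ ρ i b) = |a - b| := by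
  have h1 := hi.le₀
  have h2 := hi.le₁
  have hL : 0 < dist (M.pos u) (M.pos v) := by linarith
  rw [hi.place a ha, hi.place b hb, dist_lineMap_lineMap, Real.dist_eq, ← sub_div, abs_div,
    abs_of_pos hL, div_mul_cancel₀ _ hL.ne']
  congr 1; ring

variable (hg : Generic M δ ρ)

include hg

/-- The vertex cannot be the first or the last corner of the passing agenda. So this agenda moves at
unit speed on both sides of `t`, which gives the distances `h`. -/
theorem RestsAt.passes {i j : Fin k} {t h : ℝ} {v : Fin n} (hh : 0 < h) (hij : i ≠ j)
    (hw : ∀ w ∈ M.times δ j, w ∈ Set.Ioo (t - h) (t + h) → w = t)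
    (hi : RestsAt M δ ρ t h i v) (hj : PassesAt M δ ρ t j v) : Passes M δ ρ t h j i := by
  -- If `j` were just starting at `v`, then `i` could rest there only after having arrived; but
  -- every arrival is later than all starts.
  have hstart : t ≠ (M.startOf δ j).1 := by
    intro ht
    have hv : v = M.start j := by
      rcases hj.reason with ⟨-, h1⟩ | ⟨s, hs, h1, -⟩
      · exact h1
      · exact absurd (hg.late j j s hs) (by rw [h1, ht]; exact lt_irrefl _)
    rcases hi.reason with ⟨-, h2⟩ | ⟨-, h1, h2⟩ | ⟨h2, -⟩
    · exact hij (hM.start_injective (h2 ▸ hv))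
    · rcases hM.finish_cases (δ := δ) i with ⟨-, h4⟩ | ⟨s, hs, h4, h5⟩
      · exact hij (hM.start_injective (by rw [← hv, h2, h4]))
      · have := hg.late i j s hs; linarith
    · exact hij (hM.start_injective (h2 ▸ hv))
  -- If `j` ended at `v`, then `i` would be waiting there for its start, although arrivals are later
  -- than starts, or share its final goal, or occupy a start vertex at which no segment ends.
  have hend : t ≠ M.finishTime δ j := by
    intro ht
    have hv : v = (M.route j).finish :=
      hM.embedded.injective (hj.place.symm.trans (place_finish hM hj.goals ht.ge))
    rcases hi.reason with ⟨h1, h2⟩ | ⟨h1, -, h2⟩ | ⟨h1, h2⟩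
    · rcases hM.finish_cases (δ := δ) j with ⟨-, h4⟩ | ⟨s, hs, h4, h5⟩
      · exact hij (hM.start_injective (by rw [← h2, hv, h4]))
      · have := hg.late j i s hs; linarith
    · exact hM.finish_ne hij h1 hj.goals (h2.symm.trans hv)
    · rcases hM.finish_cases (δ := δ) j with ⟨-, h4⟩ | ⟨s, hs, h4, h5⟩
      · exact hij (hM.start_injective (by rw [← h1, hv, h4]))
      · exact h2 j s hs (by rw [h5, hv])
  have hle := le_of_mem_times hj.mem
  refine ⟨fun u hu => (hi.place u hu).trans hj.place.symm, ?_, ?_, hi.notMem⟩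
  · rcases place_piece hM (ρ := ρ) (δ := δ) (a := t - h) (b := t) hj.goals
      (fun w hw1 hw2 => absurd (hw w hw1 ⟨hw2.1, by linarith [hw2.2]⟩) hw2.2.ne) with
      ⟨h1, -⟩ | ⟨s, hs, h1, h2, h3⟩ | ⟨h1, -⟩
    · exact absurd (le_antisymm h1 hle.1) hstart
    · rw [h3 _ ⟨le_rfl, by linarith⟩, h3 t ⟨by linarith, le_rfl⟩,
        Seg.dist_pos (hM.seg_lt hs) (seg_t₁_eq hs)]
      rw [show t - h - t = -h by ring, abs_neg, abs_of_pos hh]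
    · linarith
  · rcases place_piece hM (ρ := ρ) (δ := δ) (a := t) (b := t + h) hj.goals
      (fun w hw1 hw2 => absurd (hw w hw1 ⟨by linarith [hw2.1], hw2.2⟩) hw2.1.ne') with
      ⟨h1, -⟩ | ⟨s, hs, h1, h2, h3⟩ | ⟨h1, -⟩
    · linarith
    · rw [h3 t ⟨le_rfl, by linarith⟩, h3 _ ⟨by linarith, le_rfl⟩,
        Seg.dist_pos (hM.seg_lt hs) (seg_t₁_eq hs)]
      rw [show t - (t + h) = -h by ring, abs_neg, abs_of_pos hh]
    · exact absurd (le_antisymm hle.2 h1) hend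

omit hM hg in
theorem MovesOn.passes {i j : Fin k} {t h t₀ : ℝ} {u v w x : Fin n} (hh : 0 < h)
    (hi : MovesOn M δ ρ t h i u v t₀) (hj : ParkedAt M δ ρ j w x)
    (heq : M.place δ ρ i t = M.place δ ρ j t) : Passes M δ ρ t h i j := by
  refine ⟨fun y _ => by rw [heq, hj.place, hj.place], ?_, ?_, notMem_visits_of_eq_nil hj.goals t⟩
  · rw [hi.dist_eq hh ⟨le_rfl, by linarith⟩ ⟨by linarith, by linarith⟩,
      show t - h - t = -h by ring, abs_neg, abs_of_pos hh]
  · rw [hi.dist_eq hh ⟨by linarith, by linarith⟩ ⟨by linarith, le_rfl⟩,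
      show t - (t + h) = -h by ring, abs_neg, abs_of_pos hh]

theorem MovesOn.headOn {i j : Fin k} {t h t₀ t₁ : ℝ} {u v w x : Fin n} (hh : 0 < h)
    (hij : i ≠ j) (hi : MovesOn M δ ρ t h i u v t₀) (hj : MovesOn M δ ρ t h j w x t₁)
    (heq : M.place δ ρ i t = M.place δ ρ j t) : HeadOn M δ ρ t h i j := by
  obtain ⟨rfl, rfl, h1⟩ := hi.opposite hM hg hh hij hj heq
  have hL : 0 < dist (M.pos x) (M.pos w) := by have := hi.le₀; have := hi.le₁; linarith
  -- Two opposite unit speed motions are mirror images of each other in time about their meeting.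
  have key : ∀ y ∈ Set.Icc (-h) h, M.place δ ρ i (t + y) = M.place δ ρ j (t - y) := by
    intro y hy
    rw [hi.place _ ⟨by linarith [hy.1], by linarith [hy.2]⟩,
      hj.place _ ⟨by linarith [hy.2], by linarith [hy.1]⟩,
      ← AffineMap.lineMap_apply_one_sub (M.pos w), dist_comm (M.pos w)]
    congr 1
    field_simp
    linarith
  refine ⟨?_, key h ⟨by linarith, le_rfl⟩, fun h2 => ?_, fun h2 => hi.notMem (visit_mem_times h2),
    fun h2 => hj.notMem (visit_mem_times h2)⟩
  · have := key (-h) ⟨le_rfl, by linarith⟩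
    rwa [sub_neg_eq_add, ← sub_eq_add_neg] at this
  · have h3 := hi.dist_eq hh (a := t - h) (b := t + h) ⟨le_rfl, by linarith⟩ ⟨by linarith, le_rfl⟩
    rw [h2, dist_self, show t - h - (t + h) = -(2 * h) by ring, abs_neg, abs_of_pos (by linarith)]
      at h3
    linarith

/-- An agenda that rests or passes is at a vertex, one that is parked or moves is inside an edge;
half of the sixteen combinations vanish for this reason. Two agendas in the same state can meet only
if both are moving. -/
theorem meeting {i j : Fin k} {t h : ℝ} (hh : 0 < h)
    (hw : ∀ i, ∀ w ∈ M.times δ i, w ∈ Set.Ioo (t - h) (t + h) → w = t)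
    (hij : i ≠ j) (heq : M.place δ ρ i t = M.place δ ρ j t) :
    M.IsEventTime δ ρ t ∧
      (Passes M δ ρ t h i j ∨ Passes M δ ρ t h j i ∨ HeadOn M δ ρ t h i j) := by
  have ht : t ∈ Set.Icc (t - h) (t + h) := ⟨by linarith, by linarith⟩
  have corner : ∀ {i : Fin k}, t ∈ M.times δ i → M.IsEventTime δ ρ t := fun h1 =>
    ⟨t, isMeetTime_of_mem h1, Or.inr (Or.inl rfl)⟩
  have park : ∀ {s : ℝ}, M.IsMeetTime δ s → (t = s + ρ ∨ s = t + ρ) → M.IsEventTime δ ρ t := by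
    rintro s hs (h1 | h1)
    · exact ⟨s, hs, Or.inr (Or.inr h1)⟩
    · exact ⟨s, hs, Or.inl (by linarith)⟩
  rcases state_cases hM hg i hh (hw i) with ⟨vi, hi⟩ | ⟨vi, hi⟩ | ⟨ui, vi, hi⟩ | ⟨ui, vi, ti, hi⟩ <;>
  rcases state_cases hM hg j hh (hw j) with ⟨vj, hj⟩ | ⟨vj, hj⟩ | ⟨uj, vj, hj⟩ | ⟨uj, vj, tj, hj⟩
  · have h1 := heq
    rw [hi.place t ht, hj.place t ht] at h1
    obtain rfl := hM.embedded.injective h1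
    exact absurd (hi.eq hM hg hj) hij
  · have h1 := heq
    rw [hi.place t ht, hj.place] at h1
    obtain rfl := hM.embedded.injective h1
    exact ⟨corner hj.mem, Or.inr (Or.inl (hi.passes hM hg hh hij (hw j) hj))⟩
  · exact absurd (heq.symm.trans (hi.place t ht)) (hj.ne_pos hM hg vi)
  · exact absurd (heq.symm.trans (hi.place t ht)) (hj.ne_pos hM hh vi)
  · have h1 := heq
    rw [hj.place t ht, hi.place] at h1
    obtain rfl := hM.embedded.injective h1
    exact ⟨corner hi.mem, Or.inl (hj.passes hM hg hh hij.symm (hw i) hi)⟩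
  · exact absurd (hi.eq hg hj) hij
  · exact absurd (heq.symm.trans hi.place) (hj.ne_pos hM hg vi)
  · exact absurd (heq.symm.trans hi.place) (hj.ne_pos hM hh vi)
  · exact absurd (heq.trans (hj.place t ht)) (hi.ne_pos hM hg vj)
  · exact absurd (heq.trans hj.place) (hi.ne_pos hM hg vj)
  · exact absurd (hi.eq hM hg hj heq) hij
  · obtain ⟨s, hs, h1⟩ := hj.parked hM hg hh hi heq.symm
    exact ⟨park hs h1, Or.inr (Or.inl (hj.passes hh hi heq.symm))⟩
  · exact absurd (heq.trans (hj.place t ht)) (hi.ne_pos hM hh vj)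
  · exact absurd (heq.trans hj.place) (hi.ne_pos hM hh vj)
  · obtain ⟨s, hs, h1⟩ := hi.parked hM hg hh hj heq
    exact ⟨park hs h1, Or.inl (hi.passes hh hj heq)⟩
  · exact ⟨⟨t, hi.isMeetTime hM hg hh hij hj heq, Or.inr (Or.inl rfl)⟩,
      Or.inr (Or.inr (hi.headOn hM hg hh hij hj heq))⟩

omit hM hg in
-- There are only finitely many corner times. This small window allows `meeting` to be applied at a
-- time that is not yet known to be an event.
theorem exists_window (M : Mission n k) (δ t : ℝ) :
    ∃ h > 0, ∀ i, ∀ w ∈ M.times δ i, w ∈ Set.Ioo (t - h) (t + h) → w = t := by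
  have key : ∀ l : List ℝ, ∃ h > 0, ∀ w ∈ l, w ∈ Set.Ioo (t - h) (t + h) → w = t := by
    intro l
    induction l with
    | nil => exact ⟨1, one_pos, by simp⟩
    | cons a l ih =>
      obtain ⟨h, hh, hl⟩ := ih
      by_cases hat : a = t
      · refine ⟨h, hh, fun w hw hwt => ?_⟩
        rcases List.mem_cons.1 hw with rfl | hw
        · exact hat
        · exact hl w hw hwt
      · refine ⟨min h |a - t|, lt_min hh (abs_pos.2 (sub_ne_zero.2 hat)), fun w hw hwt => ?_⟩
        have h1 := min_le_left h |a - t|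
        have h2 := min_le_right h |a - t|
        rcases List.mem_cons.1 hw with rfl | hw
        · exact absurd (abs_lt.2 ⟨by linarith [hwt.1], by linarith [hwt.2]⟩ :
            |w - t| < min h |w - t|) (not_lt.2 h2)
        · exact hl w hw ⟨by linarith [hwt.1], by linarith [hwt.2]⟩
  obtain ⟨h, hh, hl⟩ := key ((List.finRange k).flatMap (M.times δ))
  exact ⟨h, hh, fun i w hw => hl w (List.mem_flatMap.2 ⟨i, List.mem_finRange i, hw⟩)⟩

/-- Between the events the agendas are at different places. -/
theorem place_ne {i j : Fin k} {t : ℝ} (ht : ¬ M.IsEventTime δ ρ t) (hij : i ≠ j) :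
    M.place δ ρ i t ≠ M.place δ ρ j t := fun h => by
  obtain ⟨r, hr, hw⟩ := exists_window M δ t
  exact ht (meeting hM hg hr hw hij h).1

end Mission

/-! ### Pairs of linear motions without collision -/

theorem dist_lineMap_le {x y c : Plane} {r θ : ℝ} (hx : dist x c ≤ r) (hy : dist y c ≤ r)
    (hθ : θ ∈ Set.Icc (0 : ℝ) 1) : dist (AffineMap.lineMap x y θ) c ≤ r := by
  have h := (convex_closedBall c r).segment_subset (x := x) (y := y) hx hy
  apply h
  rw [segment_eq_image_lineMap]
  exact ⟨θ, hθ, rfl⟩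

/-- By convexity each motion stays in its ball, and the two balls are disjoint. This separates all
agents whose agendas do not meet in the current window. -/
theorem lineMap_ne_lineMap_of_balls {x y x' y' c c' : Plane} {r θ : ℝ} (hx : dist x c ≤ r)
    (hy : dist y c ≤ r) (hx' : dist x' c' ≤ r) (hy' : dist y' c' ≤ r) (hc : 2 * r < dist c c')
    (hθ : θ ∈ Set.Icc (0 : ℝ) 1) : AffineMap.lineMap x y θ ≠ AffineMap.lineMap x' y' θ := by
  intro h
  have h1 := dist_lineMap_le hx hy hθ
  have h2 := dist_lineMap_le hx' hy' hθ
  rw [h, dist_comm] at h1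
  have := dist_triangle c (AffineMap.lineMap x' y' θ) c'
  linarith

/-- Two agents that follow each other around a corner at the same speed do not collide. -/
theorem lineMap_ne_lineMap_of_follow {x y v : Plane} {r θ : ℝ} (hr : 0 < r) (hx : dist x v = r)
    (hy : dist v y = r) (hxy : x ≠ y) (hθ : θ ∈ Set.Icc (0 : ℝ) 1) :
    AffineMap.lineMap x v θ ≠ AffineMap.lineMap v y θ := by
  intro h
  have h1 := congrArg (dist · v) h
  simp only [dist_lineMap_right, dist_lineMap_left, hx, hy, Real.norm_eq_abs,
    abs_of_nonneg hθ.1, abs_of_nonneg (sub_nonneg.2 hθ.2)] at h1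
  -- At parameter `θ` the distances from `v` are `(1 - θ) * r` and `θ * r`, so a collision could
  -- only happen halfway; there it would force `x = y`.
  have h2 : θ = 1 / 2 := by
    have := mul_right_cancel₀ hr.ne' h1
    linarith
  rw [h2, ← AffineMap.lineMap_apply_one_sub, show (1 : ℝ) - 1 / 2 = 1 / 2 by norm_num] at h
  have := (AffineMap.lineMap_injective (k := ℝ) (p₀ := v) (p₁ := x)
    (by rintro rfl; simp at hx; linarith))
  apply hxy
  have h3 := AffineMap.lineMap_apply v x (1 / 2 : ℝ)
  have h4 := AffineMap.lineMap_apply v y (1 / 2 : ℝ)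
  rw [h, h4] at h3
  simpa using h3.symm

/-! ### Exchanges of agendas and the schedule -/

namespace Mission

variable {n k : ℕ} (M : Mission n k) (δ ρ : ℝ)

open Classical in
/-- The agenda that meets agenda `i` at time `t` (`i` itself if there is none). -/
def mateFun (t : ℝ) (i : Fin k) : Fin k :=
  if h : ∃ j, j ≠ i ∧ M.place δ ρ j t = M.place δ ρ i t then h.choose else i

open Classical in
/-- The exchange of agendas at time `t`. -/
def mate (t : ℝ) : Equiv.Perm (Fin k) :=
  if h : Function.Involutive (M.mateFun δ ρ t) then h.toPerm else 1

/-- Agenda `i` is back at time `t + h` where it was at time `t - h`. -/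
def Returns (h t : ℝ) (i : Fin k) : Prop := M.place δ ρ i (t - h) = M.place δ ρ i (t + h)

open Classical in
/-- The agenda that is held after time `t` by the agent that held agenda `i` before. -/
def nextFun (h t : ℝ) (i : Fin k) : Fin k :=
  if M.Returns δ ρ h t i ∧ M.Returns δ ρ h t (M.mate δ ρ t i) then i else M.mate δ ρ t i

open Classical in
/-- The lasting exchange of agendas around time `t`. -/
def nextPerm (h t : ℝ) : Equiv.Perm (Fin k) :=
  if h' : Function.Involutive (M.nextFun δ ρ h t) then h'.toPerm else 1

/-- The situation in which every agent is where its agenda is intended to be. -/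
def ideal (t : ℝ) (π : Equiv.Perm (Fin k)) : Snapshot k :=
  ⟨t, fun a => M.place δ ρ (π a) t, π, fun i => (M.token δ ρ i).count t⟩

open Classical in
/-- The situation at the time of an event. -/
def meetingSnapshot (h t : ℝ) (π : Equiv.Perm (Fin k)) : Snapshot k :=
  ⟨t, fun a => if M.mate δ ρ t (π a) = π a then M.place δ ρ (π a) t
    else M.place δ ρ (π a) (t - h), π.trans (M.mate δ ρ t), fun i => (M.token δ ρ i).count t⟩

def eventList (h : ℝ) : Equiv.Perm (Fin k) → List ℝ → List (Snapshot k)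
  | _, [] => []
  | π, t :: l => M.ideal δ ρ (t - h) π :: M.meetingSnapshot δ ρ h t π ::
      M.ideal δ ρ (t + h) (π.trans (M.nextPerm δ ρ h t)) ::
        eventList h (π.trans (M.nextPerm δ ρ h t)) l

/-- The situation at the beginning. -/
def initial : Snapshot k := ⟨0, fun a => M.pos (M.start a), 1, fun _ => 0⟩

/-- The schedule with events `E` and windows of length `2 * h` around the events. -/
def schedule (h : ℝ) (E : List ℝ) : Schedule k :=
  ⟨M.initial, M.ideal δ ρ ρ 1 :: M.eventList δ ρ h 1 E⟩

variable {M δ ρ}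

/-- Events and windows around them are suitable for the construction of a schedule. -/
structure Windows (M : Mission n k) (δ ρ ε h : ℝ) (E : List ℝ) : Prop where
  pos : 0 < h
  le : 2 * h ≤ ε
  sorted : E.Pairwise (· < ·)
  gap : ∀ a ∈ E, ∀ b ∈ E, a < b → a + 2 * h < b
  complete : ∀ t, M.IsEventTime δ ρ t → t ∈ E
  sep : ∀ t ∈ E, ∀ i j, M.place δ ρ i t ≠ M.place δ ρ j t →
    2 * h < dist (M.place δ ρ i t) (M.place δ ρ j t)
  early : ∀ t ∈ E, ρ < t - h

variable {ε h : ℝ} {E : List ℝ} (hM : M.IsTourAssignment) (hg : Generic M δ ρ)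
  (hE : Windows M δ ρ ε h E)

theorem Windows.mem_of_times (hE : Windows M δ ρ ε h E) {i : Fin k} {w : ℝ}
    (hw : w ∈ M.times δ i) : w ∈ E :=
  hE.complete w ⟨w, isMeetTime_of_mem hw, Or.inr (Or.inl rfl)⟩

theorem Windows.eq_of_mem (hE : Windows M δ ρ ε h E) {t w : ℝ} (ht : t ∈ E) (hw : w ∈ E)
    (hwt : w ∈ Set.Icc (t - 2 * h) (t + 2 * h)) : w = t := by
  rcases lt_trichotomy w t with h1 | h1 | h1
  · have := hE.gap w hw t ht h1; linarith [hwt.1]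
  · exact h1
  · have := hE.gap t ht w hw h1; linarith [hwt.2]

theorem Windows.window (hE : Windows M δ ρ ε h E) {t : ℝ} (ht : t ∈ E) (i : Fin k) (w : ℝ)
    (hw : w ∈ M.times δ i) (hwt : w ∈ Set.Ioo (t - h) (t + h)) : w = t :=
  hE.eq_of_mem ht (hE.mem_of_times hw)
    ⟨by linarith [hwt.1, hE.pos], by linarith [hwt.2, hE.pos]⟩

theorem Windows.not_event (hE : Windows M δ ρ ε h E) {t w : ℝ} (ht : t ∈ E) (hwt : w ≠ t)
    (hw : w ∈ Set.Icc (t - h) (t + h)) : ¬ M.IsEventTime δ ρ w := fun hw' =>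
  hwt (hE.eq_of_mem ht (hE.complete w hw')
    ⟨by linarith [hw.1, hE.pos], by linarith [hw.2, hE.pos]⟩)

include hM in
theorem Windows.uniform_left (hE : Windows M δ ρ ε h E) {t : ℝ} (ht : t ∈ E) (i : Fin k) :
    UniformOn M δ ρ i (t - h) t :=
  uniformOn hM (by linarith [hE.pos]) fun w hw hwt =>
    hwt.2.ne (hE.window ht i w hw ⟨hwt.1, by linarith [hwt.2, hE.pos]⟩)

include hM in
theorem Windows.uniform_right (hE : Windows M δ ρ ε h E) {t : ℝ} (ht : t ∈ E) (i : Fin k) :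
    UniformOn M δ ρ i t (t + h) :=
  uniformOn hM (by linarith [hE.pos]) fun w hw hwt =>
    hwt.1.ne' (hE.window ht i w hw ⟨by linarith [hwt.1, hE.pos], hwt.2⟩)

include hM in
theorem Windows.dist_left (hE : Windows M δ ρ ε h E) {t : ℝ} (ht : t ∈ E) (i : Fin k) :
    dist (M.place δ ρ i (t - h)) (M.place δ ρ i t) ≤ h := by
  simpa using (hE.uniform_left hM ht i).dist_le

include hM in
theorem Windows.dist_right (hE : Windows M δ ρ ε h E) {t : ℝ} (ht : t ∈ E) (i : Fin k) :
    dist (M.place δ ρ i t) (M.place δ ρ i (t + h)) ≤ h := by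
  simpa using (hE.uniform_right hM ht i).dist_le

/-! ### Exchanges -/

theorem mateFun_spec (t : ℝ) (i : Fin k) :
    M.place δ ρ (M.mateFun δ ρ t i) t = M.place δ ρ i t := by
  unfold mateFun
  split_ifs with h'
  · exact h'.choose_spec.2
  · rfl

include hM hg hE

theorem mateFun_eq {t : ℝ} (ht : t ∈ E) {i j : Fin k} (hij : i ≠ j)
    (heq : M.place δ ρ i t = M.place δ ρ j t) : M.mateFun δ ρ t i = j := by
  have h' : ∃ j, j ≠ i ∧ M.place δ ρ j t = M.place δ ρ i t := ⟨j, hij.symm, heq.symm⟩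
  rw [mateFun, dif_pos h']
  exact eq_of_place_eq hM hg hE.pos (fun i w => hE.window ht i w) h'.choose_spec.1.symm hij
    h'.choose_spec.2.symm heq

/-- Since no three agendas meet, meeting partners are unique and taking the partner is an
involution; the default in `mate` is not reached at events. -/
theorem mate_apply {t : ℝ} (ht : t ∈ E) (i : Fin k) : M.mate δ ρ t i = M.mateFun δ ρ t i := by
  have hinv : Function.Involutive (M.mateFun δ ρ t) := by
    intro i
    by_cases h' : M.mateFun δ ρ t i = i
    · rw [h', h']
    · exact mateFun_eq hM hg hE ht h' (mateFun_spec t i)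
  rw [mate, dif_pos hinv]; rfl

theorem mate_mate {t : ℝ} (ht : t ∈ E) (i : Fin k) : M.mate δ ρ t (M.mate δ ρ t i) = i := by
  rw [mate_apply hM hg hE ht, mate_apply hM hg hE ht]
  by_cases h' : M.mateFun δ ρ t i = i
  · rw [h', h']
  · exact mateFun_eq hM hg hE ht h' (mateFun_spec t i)

theorem place_mate {t : ℝ} (ht : t ∈ E) (i : Fin k) :
    M.place δ ρ (M.mate δ ρ t i) t = M.place δ ρ i t := by
  rw [mate_apply hM hg hE ht, mateFun_spec]

theorem mate_eq {t : ℝ} (ht : t ∈ E) {i j : Fin k} (hij : i ≠ j)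
    (heq : M.place δ ρ i t = M.place δ ρ j t) : M.mate δ ρ t i = j := by
  rw [mate_apply hM hg hE ht, mateFun_eq hM hg hE ht hij heq]

/-- The condition for swapping back is symmetric in an agenda and its partner, so the lasting
exchange is again an involution. -/
theorem nextPerm_apply {t : ℝ} (ht : t ∈ E) (i : Fin k) :
    M.nextPerm δ ρ h t i = M.nextFun δ ρ h t i := by
  have hinv : Function.Involutive (M.nextFun δ ρ h t) := by
    intro i
    have hm := mate_mate hM hg hE ht i
    by_cases h' : M.Returns δ ρ h t i ∧ M.Returns δ ρ h t (M.mate δ ρ t i)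
    · simp [nextFun, h']
    · have h'' : ¬ (M.Returns δ ρ h t (M.mate δ ρ t i) ∧ M.Returns δ ρ h t i) :=
        fun h1 => h' h1.symm
      simp [nextFun, h', h'', hm]
  rw [nextPerm, dif_pos hinv]; rfl

theorem place_nextPerm {t : ℝ} (ht : t ∈ E) (i : Fin k) :
    M.place δ ρ (M.nextPerm δ ρ h t i) t = M.place δ ρ i t := by
  rw [nextPerm_apply hM hg hE ht, nextFun]
  split_ifs
  · rfl
  · exact place_mate hM hg hE ht i

/-! ### Admissible transitions -/

/-- The transition between two events. -/
theorem step_ideal (hε : 0 ≤ ε) {a b : ℝ} (hab : a < b) (hab' : ∀ e ∈ E, e ∉ Set.Icc a b)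
    (π : Equiv.Perm (Fin k)) :
    Snapshot.Step M ε (M.ideal δ ρ a π) (M.ideal δ ρ b π) := by
  have hu : ∀ i, UniformOn M δ ρ i a b := fun i => uniformOn hM hab.le fun w hw hwt =>
    hab' w (hE.mem_of_times hw) ⟨hwt.1.le, hwt.2.le⟩
  refine ⟨hab, fun c => (hu _).dist_le, fun c => (hu _).onRoutes, fun c d hcd θ hθ => ?_,
    fun i => (dist_self _).trans_le hε, fun i => ⟨count_mono i hab.le, fun m h1 h2 => ?_⟩⟩
  · change AffineMap.lineMap (M.place δ ρ (π c) a) (M.place δ ρ (π c) b) θ ≠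
      AffineMap.lineMap (M.place δ ρ (π d) a) (M.place δ ρ (π d) b) θ
    -- As the motions are uniform, the interpolated places are the intended places at an
    -- intermediate time, and this time is not an event.
    rw [← (hu (π c)).affine θ hθ, ← (hu (π d)).affine θ hθ]
    refine place_ne hM hg (fun hev => hab' _ (hE.complete _ hev) ?_) (π.injective.ne hcd)
    rw [← segment_eq_Icc hab.le, segment_eq_image_lineMap]
    exact ⟨θ, hθ, rfl⟩
  · obtain ⟨v, hv, hvb⟩ := (lt_count_iff i b m).1 h2
    have hva : a < v := not_le.1 fun hva =>
      absurd ((lt_count_iff i a m).2 ⟨v, hv, hva⟩) (not_lt.2 h1)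
    exact absurd ⟨hva.le, hvb⟩
      (hab' v (hE.mem_of_times (visit_mem_times (List.mem_of_getElem? hv))))

omit hM hg hE in
open Classical in
theorem meetingSnapshot_place (t : ℝ) (π : Equiv.Perm (Fin k)) (a : Fin k) :
    (M.meetingSnapshot δ ρ h t π).place a = if M.mate δ ρ t (π a) = π a
      then M.place δ ρ (π a) t else M.place δ ρ (π a) (t - h) := rfl

omit hg in
theorem dist_meetingSnapshot_place {t : ℝ} (ht : t ∈ E) (π : Equiv.Perm (Fin k)) (a : Fin k) :
    dist ((M.meetingSnapshot δ ρ h t π).place a) (M.place δ ρ (π a) t) ≤ h := by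
  rw [meetingSnapshot_place]
  split_ifs
  · rw [dist_self]; exact hE.pos.le
  · exact hE.dist_left hM ht _

omit hg in
theorem dist_ideal_left {t : ℝ} (ht : t ∈ E) (π : Equiv.Perm (Fin k)) (a : Fin k) :
    dist ((M.ideal δ ρ (t - h) π).place a) (M.place δ ρ (π a) t) ≤ h :=
  hE.dist_left hM ht _

theorem dist_ideal_right {t : ℝ} (ht : t ∈ E) (π : Equiv.Perm (Fin k)) (a : Fin k) :
    dist ((M.ideal δ ρ (t + h) (π.trans (M.nextPerm δ ρ h t))).place a)
      (M.place δ ρ (π a) t) ≤ h := by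
  rw [dist_comm, ← place_nextPerm hM hg hE ht]
  exact hE.dist_right hM ht _

/-- The transition to an event. -/
theorem step_before {t : ℝ} (ht : t ∈ E) (π : Equiv.Perm (Fin k)) :
    Snapshot.Step M ε (M.ideal δ ρ (t - h) π) (M.meetingSnapshot δ ρ h t π) := by
  have hh := hE.pos
  have hw := fun i w => hE.window ht i w
  refine ⟨sub_lt_self t hh, fun c => ?_, fun c => ?_, fun c d hcd θ hθ => ?_, fun i => ?_,
    fun i => ⟨count_mono i (sub_lt_self t hh).le, fun m h1 h2 => ?_⟩⟩
  · rw [meetingSnapshot_place]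
    split_ifs
    · exact (hE.uniform_left hM ht _).dist_le
    · exact (dist_self _).trans_le (by simpa [ideal, meetingSnapshot] using hh.le)
  · rw [meetingSnapshot_place]
    split_ifs
    · exact (hE.uniform_left hM ht _).onRoutes
    · exact Or.inl rfl
  · have hne := π.injective.ne hcd
    -- Carriers of meeting agendas stand still, at places that differ because `t - h` is not an
    -- event. All other pairs stay in disjoint balls.
    by_cases heq : M.place δ ρ (π c) t = M.place δ ρ (π d) t
    · rw [meetingSnapshot_place, meetingSnapshot_place, mate_eq hM hg hE ht hne heq,
        mate_eq hM hg hE ht hne.symm heq.symm, if_neg hne, if_neg hne.symm]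
      simp only [ideal, AffineMap.lineMap_same_apply]
      exact place_ne hM hg (hE.not_event ht (by linarith) ⟨le_rfl, by linarith⟩) hne
    · exact lineMap_ne_lineMap_of_balls (dist_ideal_left hM hE ht π c)
        (dist_meetingSnapshot_place hM hE ht π c) (dist_ideal_left hM hE ht π d)
        (dist_meetingSnapshot_place hM hE ht π d) (hE.sep t ht _ _ heq) hθ
  -- At time `t` the old and the new holder are both within `h` of the common point of the two
  -- agendas.
  · have h1 := dist_meetingSnapshot_place hM hE ht π ((M.ideal δ ρ (t - h) π).holder i)
    have h2 := dist_meetingSnapshot_place hM hE ht π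
      ((M.meetingSnapshot δ ρ h t π).holder i)
    have h3 : π ((M.ideal δ ρ (t - h) π).holder i) = i := π.apply_symm_apply i
    have h4 : M.mate δ ρ t (π ((M.meetingSnapshot δ ρ h t π).holder i)) = i :=
      (π.trans (M.mate δ ρ t)).apply_symm_apply i
    rw [← place_mate hM hg hE ht, h4] at h2
    rw [h3] at h1
    have := hE.le
    exact (dist_triangle_right _ _ _).trans (by linarith)
  · obtain ⟨v, hv, hvt⟩ := (lt_count_iff i t m).1 h2
    have hva : t - h < v := not_le.1 fun hva =>
      absurd ((lt_count_iff i (t - h) m).2 ⟨v, hv, hva⟩) (not_lt.2 h1)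
    have hmem := List.mem_of_getElem? hv
    -- A visit is a corner time, and `t` is the only one in the window.
    obtain rfl := hw i v (visit_mem_times hmem) ⟨hva, by linarith⟩
    obtain ⟨g, hg1, hg2⟩ := exists_goal hM hv
    refine ⟨g, hg1, ?_⟩
    rw [← hg2, meetingSnapshot_place]
    set b := (M.meetingSnapshot δ ρ h v π).holder i with hb
    have h4 : M.mate δ ρ v (π b) = i := (π.trans (M.mate δ ρ v)).apply_symm_apply i
    split_ifs with h5
    · rw [← h4, h5]
    · rw [h4] at h5
      have h6 : M.place δ ρ i v = M.place δ ρ (π b) v := by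
        rw [← place_mate hM hg hE ht (π b), h4]
      -- An agenda that is due at a goal must be the passing one: resting and head-on agendas have
      -- no visit at this time. Its new holder rests at the meeting point, that is, on the goal.
      rcases (meeting hM hg hh hw h5 h6).2 with h7 | h7 | h7
      · exact h7.rest _ ⟨le_rfl, by linarith⟩
      · exact absurd hmem h7.notMem
      · exact absurd hmem h7.notMem_left

/-- The motion of an agent after an event at which it takes over another agenda. -/
theorem motion_after {t : ℝ} (ht : t ∈ E) {i j : Fin k} (hij : i ≠ j)
    (heq : M.place δ ρ i t = M.place δ ρ j t) :
    dist (M.place δ ρ i (t - h)) (M.place δ ρ j (t + h)) ≤ h ∧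
      Snapshot.OnRoutes M (M.place δ ρ i (t - h)) (M.place δ ρ j (t + h)) := by
  have hh := hE.pos
  rcases (meeting hM hg hh (fun i w => hE.window ht i w) hij heq).2 with h1 | h1 | h1
  · rw [h1.rest _ ⟨by linarith, le_rfl⟩]
    exact ⟨hE.dist_left hM ht i, (hE.uniform_left hM ht i).onRoutes⟩
  · rw [h1.rest _ ⟨le_rfl, by linarith⟩]
    exact ⟨hE.dist_right hM ht j, (hE.uniform_right hM ht j).onRoutes⟩
  · rw [h1.left, dist_self]
    exact ⟨hh.le, Or.inl rfl⟩

/-- Agents that exchange their agendas for good do not collide. -/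
theorem no_collision_after {t : ℝ} (ht : t ∈ E) {i j : Fin k} (hij : i ≠ j)
    (heq : M.place δ ρ i t = M.place δ ρ j t)
    (hret : ¬ (M.Returns δ ρ h t i ∧ M.Returns δ ρ h t j)) {θ : ℝ}
    (hθ : θ ∈ Set.Icc (0 : ℝ) 1) :
    AffineMap.lineMap (M.place δ ρ i (t - h)) (M.place δ ρ j (t + h)) θ ≠
      AffineMap.lineMap (M.place δ ρ j (t - h)) (M.place δ ρ i (t + h)) θ := by
  have hh := hE.pos
  have key : ∀ {i j : Fin k}, Passes M δ ρ t h i j →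
      ¬ (M.Returns δ ρ h t i ∧ M.Returns δ ρ h t j) →
      AffineMap.lineMap (M.place δ ρ i (t - h)) (M.place δ ρ j (t + h)) θ ≠
      AffineMap.lineMap (M.place δ ρ j (t - h)) (M.place δ ρ i (t + h)) θ := by
    intro i j h1 hret
    have h2 := h1.rest (t + h) ⟨by linarith, le_rfl⟩
    have h3 := h1.rest (t - h) ⟨le_rfl, by linarith⟩
    -- The resting agenda always returns; so the passing one does not, and its places before and
    -- after the meeting differ.
    have h4 : ¬ M.Returns δ ρ h t i := fun h4 => hret ⟨h4, h3.trans h2.symm⟩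
    rw [h2, h3]
    exact lineMap_ne_lineMap_of_follow hh h1.left h1.right h4 hθ
  rcases (meeting hM hg hh (fun i w => hE.window ht i w) hij heq).2 with h1 | h1 | h1
  · exact key h1 hret
  · exact (key h1 fun h2 => hret h2.symm).symm
  · rw [← h1.left, h1.right, AffineMap.lineMap_same_apply, AffineMap.lineMap_same_apply]
    exact place_ne hM hg (hE.not_event ht (by linarith) ⟨le_rfl, by linarith⟩) hij

/-- The transition from an event. -/
theorem step_after {t : ℝ} (ht : t ∈ E) (π : Equiv.Perm (Fin k)) :
    Snapshot.Step M ε (M.meetingSnapshot δ ρ h t π)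
      (M.ideal δ ρ (t + h) (π.trans (M.nextPerm δ ρ h t))) := by
  have hh := hE.pos
  set π' := π.trans (M.nextPerm δ ρ h t) with hπ'
  -- An agent follows its agenda if there is no meeting, waits if the exchange is undone, and
  -- otherwise goes to the place where the new agenda is due.
  have motion : ∀ c, (M.mate δ ρ t (π c) = π c ∧
      (M.meetingSnapshot δ ρ h t π).place c = M.place δ ρ (π c) t ∧
      (M.ideal δ ρ (t + h) π').place c = M.place δ ρ (π c) (t + h)) ∨
    (π c ≠ M.mate δ ρ t (π c) ∧
      (M.meetingSnapshot δ ρ h t π).place c = M.place δ ρ (π c) (t - h) ∧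
      ((M.Returns δ ρ h t (π c) ∧ M.Returns δ ρ h t (M.mate δ ρ t (π c)) ∧
        (M.ideal δ ρ (t + h) π').place c = M.place δ ρ (π c) (t - h)) ∨
      (¬ (M.Returns δ ρ h t (π c) ∧ M.Returns δ ρ h t (M.mate δ ρ t (π c))) ∧
        (M.ideal δ ρ (t + h) π').place c = M.place δ ρ (M.mate δ ρ t (π c)) (t + h)))) := by
    intro c
    have h1 : (M.ideal δ ρ (t + h) π').place c = M.place δ ρ (M.nextFun δ ρ h t (π c)) (t + h) := by
      rw [← nextPerm_apply hM hg hE ht]; rfl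
    rw [h1, meetingSnapshot_place, nextFun]
    by_cases h2 : M.mate δ ρ t (π c) = π c
    · exact Or.inl ⟨h2, by rw [if_pos h2], by rw [h2, ite_self]⟩
    · refine Or.inr ⟨Ne.symm h2, by rw [if_neg h2], ?_⟩
      by_cases h3 : M.Returns δ ρ h t (π c) ∧ M.Returns δ ρ h t (M.mate δ ρ t (π c))
      · exact Or.inl ⟨h3.1, h3.2, by rw [if_pos h3]; exact h3.1.symm⟩
      · exact Or.inr ⟨h3, by rw [if_neg h3]⟩
  refine ⟨lt_add_of_pos_right t hh, fun c => ?_, fun c => ?_, fun c d hcd θ hθ => ?_, fun i => ?_,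
    fun i => ⟨count_mono i (lt_add_of_pos_right t hh).le, fun m h1 h2 => ?_⟩⟩
  · change _ ≤ t + h - t
    rw [add_sub_cancel_left]
    rcases motion c with ⟨-, h2, h3⟩ | ⟨h1, h2, ⟨-, -, h3⟩ | ⟨-, h3⟩⟩
    · rw [h2, h3]; exact hE.dist_right hM ht _
    · rw [h2, h3, dist_self]; exact hh.le
    · rw [h2, h3]
      exact (motion_after hM hg hE ht h1 (place_mate hM hg hE ht _).symm).1
  · rcases motion c with ⟨-, h2, h3⟩ | ⟨h1, h2, ⟨-, -, h3⟩ | ⟨-, h3⟩⟩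
    · rw [h2, h3]; exact (hE.uniform_right hM ht _).onRoutes
    · rw [h2, h3]; exact Or.inl rfl
    · rw [h2, h3]
      exact (motion_after hM hg hE ht h1 (place_mate hM hg hE ht _).symm).2
  · have hne := π.injective.ne hcd
    by_cases heq : M.place δ ρ (π c) t = M.place δ ρ (π d) t
    · have h1 := mate_eq hM hg hE ht hne heq
      have h2 := mate_eq hM hg hE ht hne.symm heq.symm
      rcases motion c with ⟨h3, -, -⟩ | ⟨-, h3, h4⟩
      · exact absurd (h3.symm.trans h1) hne
      rcases motion d with ⟨h5, -, -⟩ | ⟨-, h5, h6⟩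
      · exact absurd (h5.symm.trans h2) hne.symm
      rw [h3, h5]
      rw [h1] at h4
      rw [h2] at h6
      -- The two carriers agree on whether the exchange is undone, so the mixed cases are
      -- contradictory.
      rcases h4 with ⟨h4, h7, h8⟩ | ⟨h4, h8⟩ <;> rcases h6 with ⟨h6, h9, h10⟩ | ⟨h6, h10⟩
      · rw [h8, h10, AffineMap.lineMap_same_apply, AffineMap.lineMap_same_apply]
        exact place_ne hM hg (hE.not_event ht (by linarith) ⟨le_rfl, by linarith⟩) hne
      · exact absurd ⟨h7, h4⟩ h6
      · exact absurd ⟨h9, h6⟩ h4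
      · rw [h8, h10]; exact no_collision_after hM hg hE ht hne heq h4 hθ
    · exact lineMap_ne_lineMap_of_balls (dist_meetingSnapshot_place hM hE ht π c)
        (dist_ideal_right hM hg hE ht π c) (dist_meetingSnapshot_place hM hE ht π d)
        (dist_ideal_right hM hg hE ht π d) (hE.sep t ht _ _ heq) hθ
  · have h1 := dist_ideal_right hM hg hE ht π ((M.meetingSnapshot δ ρ h t π).holder i)
    have h2 := dist_ideal_right hM hg hE ht π ((M.ideal δ ρ (t + h) π').holder i)
    have h3 : M.mate δ ρ t (π ((M.meetingSnapshot δ ρ h t π).holder i)) = i :=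
      (π.trans (M.mate δ ρ t)).apply_symm_apply i
    have h4 : M.nextPerm δ ρ h t (π ((M.ideal δ ρ (t + h) π').holder i)) = i :=
      π'.apply_symm_apply i
    rw [← place_mate hM hg hE ht, h3] at h1
    rw [← place_nextPerm hM hg hE ht, h4] at h2
    have := hE.le
    exact (dist_triangle_right _ _ _).trans (by linarith)
  -- A goal visited in the second half would be an event too close to `t`.
  · obtain ⟨v, hv, hvb⟩ := (lt_count_iff i (t + h) m).1 h2
    have hva : t < v := not_le.1 fun hva =>
      absurd ((lt_count_iff i t m).2 ⟨v, hv, hva⟩) (not_lt.2 h1)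
    have := hE.gap t ht v (hE.mem_of_times (visit_mem_times (List.mem_of_getElem? hv))) hva
    linarith

end Mission

namespace Mission

variable {n k : ℕ} {M : Mission n k} {δ ρ ε h : ℝ} {E : List ℝ}

/-! ### The beginning -/

/-- Parking means moving by `ρ` along an edge longer than `2 * ρ` of some route; it can be done in
time `ρ`. -/
theorem home_spec (hg : Generic M δ ρ) (i : Fin k) :
    dist (M.pos (M.start i)) (M.token δ ρ i).home ≤ ρ ∧
      Snapshot.OnRoutes M (M.pos (M.start i)) (M.token δ ρ i).home := by
  have hρ := hg.park_pos
  by_cases hi : M.goals i = []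
  · rw [home_of_eq_nil hi]
    rcases tracePos_park ρ (M.allSegs δ) (M.pos (M.start i)) with ⟨h1, -⟩ | ⟨s, hs, h1, h2⟩
    · rw [h1, dist_self]; exact ⟨hρ.le, Or.inl rfl⟩
    · obtain ⟨j, hj⟩ := mem_allSegs.1 hs
      obtain ⟨d, hd, hd1, hd2⟩ := exists_dart hj
      have hL : 2 * ρ < dist (M.pos (M.start i)) s.src := by
        rw [← h1, dist_comm, dist_eq_of_seg hj]; exact hg.long j s hj
      have hL0 : 0 < dist (M.pos (M.start i)) s.src := by linarith
      rw [h2]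
      refine ⟨?_, Or.inr ⟨j, d, hd, ?_, ?_⟩⟩
      · rw [dist_left_lineMap, Real.norm_eq_abs, abs_of_nonneg (by positivity),
          div_mul_cancel₀ _ hL0.ne']
      · rw [← h1, ← hd2]; exact hd2 ▸ right_mem_segment ℝ _ _
      · rw [← hd1, ← hd2, h1, segment_symm, segment_eq_image_lineMap]
        exact ⟨_, ⟨by positivity, (div_le_one hL0).2 (by linarith)⟩, rfl⟩
  · rw [home_of_ne_nil hi, dist_self]
    exact ⟨hρ.le, Or.inl rfl⟩

theorem Windows.start_lt (hE : Windows M δ ρ ε h E) (i : Fin k) : ρ < (M.startOf δ i).1 := by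
  have := hE.early _ (hE.mem_of_times (start_mem_times i))
  linarith [hE.pos]

theorem Windows.place_early (hE : Windows M δ ρ ε h E) (i : Fin k) :
    M.place δ ρ i ρ = (M.token δ ρ i).home := by
  rw [place_eq]; exact tracePos_of_le (hE.start_lt i).le _

theorem Windows.count_early (hE : Windows M δ ρ ε h E) (i : Fin k) :
    (M.token δ ρ i).count ρ = 0 := by
  by_contra h0
  obtain ⟨v, hv, hvρ⟩ := (lt_count_iff i ρ 0).1 (Nat.pos_of_ne_zero h0)
  have := (le_of_mem_times (visit_mem_times (List.mem_of_getElem? hv))).1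
  linarith [hE.start_lt i]

variable (hM : M.IsTourAssignment) (hg : Generic M δ ρ) (hE : Windows M δ ρ ε h E)

include hM hg hE

omit hM in
theorem step_initial (hstart : ∀ i j, i ≠ j →
      2 * ρ < dist (M.pos (M.start i)) (M.pos (M.start j))) (hε : 0 ≤ ε) :
    Snapshot.Step M ε M.initial (M.ideal δ ρ ρ 1) := by
  have hp : ∀ i, (M.ideal δ ρ ρ 1).place i = (M.token δ ρ i).home := fun i => hE.place_early i
  have hs := home_spec hg
  refine ⟨hg.park_pos, fun a => ?_, fun a => ?_, fun a b hab θ hθ => ?_,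
    fun i => (dist_self _).trans_le hε, fun i => ⟨Nat.zero_le _, fun m _ h2 => ?_⟩⟩
  · rw [hp]; simpa [initial, ideal] using (hs a).1
  · rw [hp]; exact (hs a).2
  · rw [hp, hp]
    refine lineMap_ne_lineMap_of_balls (c := M.pos (M.start a)) (c' := M.pos (M.start b)) (r := ρ)
      ?_ ?_ ?_ ?_ (hstart a b hab) hθ
    · exact (dist_self _).trans_le hg.park_pos.le
    · rw [dist_comm]; exact (hs a).1
    · exact (dist_self _).trans_le hg.park_pos.le
    · rw [dist_comm]; exact (hs b).1
  · change m < (M.token δ ρ i).count ρ at h2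
    rw [hE.count_early] at h2
    omega

/-! ### The whole schedule -/

/-- The induction runs along the remaining events. By the last condition on `a`, every event is past
or still in the list, so none lies between `a` and the beginning of the next window. -/
theorem isChain_eventList (hε : 0 ≤ ε) (l : List ℝ) (hl : l.Pairwise (· < ·))
    (hlE : ∀ e ∈ l, e ∈ E) (a : ℝ) (ha : ∀ e ∈ l, a < e - h) (ha' : ∀ e ∈ E, e < a ∨ e ∈ l)
    (π : Equiv.Perm (Fin k)) :
    (M.ideal δ ρ a π :: M.eventList δ ρ h π l).IsChain (Snapshot.Step M ε) := by
  have hh := hE.pos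
  induction l generalizing a π with
  | nil => simp [eventList]
  | cons t l ih =>
    rw [List.pairwise_cons] at hl
    have ht := hlE t List.mem_cons_self
    have hgap : ∀ e ∈ l, t + 2 * h < e := fun e he =>
      hE.gap t ht e (hlE e (List.mem_cons_of_mem _ he)) (hl.1 e he)
    rw [eventList, List.isChain_cons_cons, List.isChain_cons_cons, List.isChain_cons_cons]
    refine ⟨step_ideal hM hg hE hε (ha t List.mem_cons_self) (fun e he hea => ?_) π,
      step_before hM hg hE ht π, step_after hM hg hE ht π,
      ih hl.2 (fun e he => hlE e (List.mem_cons_of_mem _ he)) _ (fun e he => ?_) (fun e he => ?_) _⟩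
    · rcases ha' e he with h1 | h1
      · exact absurd hea.1 (not_le.2 h1)
      · rcases List.mem_cons.1 h1 with rfl | h1
        · linarith [hea.2]
        · linarith [hea.2, hgap e h1]
    · linarith [hgap e he]
    · rcases ha' e he with h1 | h1
      · exact Or.inl (by linarith [ha t List.mem_cons_self])
      · rcases List.mem_cons.1 h1 with rfl | h1
        · exact Or.inl (by linarith)
        · exact Or.inr h1

omit hM hg in
theorem exists_getLast_eventList (l : List ℝ) (hl : l.Pairwise (· < ·)) (a : ℝ)
    (π : Equiv.Perm (Fin k)) : ∃ b π', (M.ideal δ ρ a π :: M.eventList δ ρ h π l).getLast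
      (List.cons_ne_nil _ _) = M.ideal δ ρ b π' ∧ (∀ e ∈ l, e < b) ∧
        (b = a ∨ ∃ e ∈ l, b = e + h) := by
  have hh := hE.pos
  induction l generalizing a π with
  | nil => exact ⟨a, π, rfl, by simp, Or.inl rfl⟩
  | cons t l ih =>
    rw [List.pairwise_cons] at hl
    obtain ⟨b, π', h1, h2, h3⟩ := ih hl.2 (t + h) (π.trans (M.nextPerm δ ρ h t))
    refine ⟨b, π', ?_, fun e he => ?_, ?_⟩
    · rw [← h1]
      simp only [eventList]
      rw [List.getLast_cons_cons, List.getLast_cons_cons, List.getLast_cons_cons]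
    · rcases List.mem_cons.1 he with rfl | he
      · rcases h3 with rfl | ⟨e', he', rfl⟩
        · linarith
        · linarith [hl.1 e' he']
      · exact h2 e he
    · rcases h3 with rfl | ⟨e', he', rfl⟩
      · exact Or.inr ⟨t, by simp, rfl⟩
      · exact Or.inr ⟨e', by simp [he'], rfl⟩

theorem schedule_resolves (hstart : ∀ i j, i ≠ j →
      2 * ρ < dist (M.pos (M.start i)) (M.pos (M.start j))) :
    (M.schedule δ ρ h E).Resolves M ε := by
  have hh := hE.pos
  have hε : 0 ≤ ε := by linarith [hE.le]
  obtain ⟨b, π', h1, h2, -⟩ := exists_getLast_eventList hE E hE.sorted ρ 1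
  have hlast : (M.schedule δ ρ h E).last = M.ideal δ ρ b π' := by
    rw [← h1]
    simp only [Schedule.last, Schedule.snapshots, schedule]
    rw [List.getLast_cons_cons]
  refine ⟨rfl, fun _ => rfl, rfl, fun i => ⟨le_rfl, fun m _ h => absurd h (Nat.not_lt_zero m)⟩,
    ?_, fun i => ?_, fun i g hgl => ?_⟩
  · simp only [Schedule.snapshots, schedule]
    rw [List.isChain_cons_cons]
    exact ⟨step_initial hg hE hstart hε, isChain_eventList hM hg hE hε E hE.sorted
      (fun _ he => he) ρ hE.early (fun _ he => Or.inr he) 1⟩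
  · rw [hlast]
    exact count_of_finishTime_le i (h2 _ (hE.mem_of_times (finishTime_mem_times i))).le
  · have hi : M.goals i ≠ [] := by rintro hi; simp [hi] at hgl
    rw [(M.route i).getLast?_eq hi, Option.some.injEq] at hgl
    rw [hlast, ← hgl]
    have h3 : π' ((M.ideal δ ρ b π').holder i) = i := π'.apply_symm_apply i
    change M.place δ ρ (π' ((M.ideal δ ρ b π').holder i)) b = _
    rw [h3]
    exact place_finish hM hi (h2 _ (hE.mem_of_times (finishTime_mem_times i))).le

omit hM hg in
theorem makespan_le {B : ℝ} (h0 : ρ ≤ B) (h1 : ∀ e ∈ E, e + h ≤ B) :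
    (M.schedule δ ρ h E).makespan ≤ B := by
  obtain ⟨b, π', h2, -, h3⟩ := exists_getLast_eventList hE E hE.sorted ρ 1
  have hlast : (M.schedule δ ρ h E).last = M.ideal δ ρ b π' := by
    rw [← h2]
    simp only [Schedule.last, Schedule.snapshots, schedule]
    rw [List.getLast_cons_cons]
  rw [Schedule.makespan, hlast]
  rcases h3 with rfl | ⟨e, he, rfl⟩
  · exact h0
  · exact h1 e he

/-! ### Costs -/

omit hM hg hE in
open Classical in
/-- The time that an agent with agenda `i` needs up to time `t` in the absence of exchanges. -/
def work (M : Mission n k) (δ t : ℝ) (i : Fin k) : ℝ :=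
  if M.goals i = [] then 0 else min (M.finishTime δ i) t

omit hM hg hE in
theorem work_mono {a b : ℝ} (hab : a ≤ b) (i : Fin k) : M.work δ a i ≤ M.work δ b i := by
  unfold work; split_ifs
  · exact le_rfl
  · exact min_le_min_left _ hab

omit hM hg hE in
-- A crude bound, sufficient for parking and for the windows, whose total length is small.
theorem stepCost_le {s s' : Snapshot k} (hs : s.time ≤ s'.time) :
    Snapshot.stepCost M s s' ≤ k * (s'.time - s.time) := by
  unfold Snapshot.stepCost
  refine (Finset.sum_le_card_nsmul _ _ (s'.time - s.time) fun a _ => ?_).trans_eq (by simp)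
  split_ifs <;> linarith

omit hg in
-- The time at which an agenda finishes is itself an event, so between events an agenda is either
-- unfinished throughout or finished throughout. The sum over agents is rearranged into a sum over
-- agendas.
theorem stepCost_ideal_le {a b : ℝ} (hab : a < b) (hab' : ∀ e ∈ E, e ∉ Set.Icc a b)
    (π : Equiv.Perm (Fin k)) :
    Snapshot.stepCost M (M.ideal δ ρ a π) (M.ideal δ ρ b π) ≤
      ∑ i, M.work δ b i - ∑ i, M.work δ a i := by
  rw [← Finset.sum_sub_distrib, ← Equiv.sum_comp π]
  refine Finset.sum_le_sum fun c _ => ?_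
  have hu : UniformOn M δ ρ (π c) a b := uniformOn hM hab.le fun w hw hwt =>
    hab' w (hE.mem_of_times hw) ⟨hwt.1.le, hwt.2.le⟩
  split_ifs with h1
  · have h2 : M.goals (π c) ≠ [] ∧ b ≤ M.finishTime δ (π c) := by
      rcases h1 with h1 | h1
      · exact hu.le_finish h1
      · change (M.token δ ρ (π c)).count a < (M.goals (π c)).length at h1
        refine ⟨by rintro h2; simp [h2] at h1, le_of_not_gt fun h3 => ?_⟩
        rcases le_or_gt (M.finishTime δ (π c)) a with h4 | h4
        · exact h1.ne (count_of_finishTime_le _ h4)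
        · exact hab' _ (hE.mem_of_times (finishTime_mem_times _)) ⟨h4.le, h3.le⟩
    simp only [work, if_neg h2.1, min_eq_right h2.2, min_eq_right (hab.le.trans h2.2)]
    exact le_rfl
  · exact sub_nonneg.2 (work_mono hab.le _)

omit hg in
-- Between windows the costs telescope to differences of `work`. Each window adds at most its length
-- for every agent, and the work attributed to it is simply dropped.
theorem listCost_eventList_le (l : List ℝ) (hl : l.Pairwise (· < ·))
    (hlE : ∀ e ∈ l, e ∈ E) (a : ℝ) (ha : ∀ e ∈ l, a < e - h) (ha' : ∀ e ∈ E, e < a ∨ e ∈ l)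
    (π : Equiv.Perm (Fin k)) {B : ℝ} (haB : a ≤ B) (hB : ∀ e ∈ l, e + h ≤ B) :
    Snapshot.listCost M (M.ideal δ ρ a π :: M.eventList δ ρ h π l) ≤
      ∑ i, M.work δ B i - ∑ i, M.work δ a i + l.length * (k * (2 * h)) := by
  have hh := hE.pos
  induction l generalizing a π with
  | nil =>
    simp only [eventList, Snapshot.listCost, List.length_nil, Nat.cast_zero, zero_mul, add_zero]
    exact sub_nonneg.2 (Finset.sum_le_sum fun i _ => work_mono haB i)
  | cons t l ih =>
    rw [List.pairwise_cons] at hl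
    have ht := hlE t List.mem_cons_self
    have hgap : ∀ e ∈ l, t + 2 * h < e := fun e he =>
      hE.gap t ht e (hlE e (List.mem_cons_of_mem _ he)) (hl.1 e he)
    have h1 := stepCost_ideal_le hM hE (ha t List.mem_cons_self) (fun e he hea => by
      rcases ha' e he with h1 | h1
      · exact absurd hea.1 (not_le.2 h1)
      · rcases List.mem_cons.1 h1 with rfl | h1
        · linarith [hea.2]
        · linarith [hea.2, hgap e h1]) π
    have h2 := stepCost_le (M := M) (s := M.ideal δ ρ (t - h) π)
      (s' := M.meetingSnapshot δ ρ h t π) (sub_lt_self t hh).le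
    have h3 := stepCost_le (M := M) (s := M.meetingSnapshot δ ρ h t π)
      (s' := M.ideal δ ρ (t + h) (π.trans (M.nextPerm δ ρ h t))) (lt_add_of_pos_right t hh).le
    have h4 := ih hl.2 (fun e he => hlE e (List.mem_cons_of_mem _ he)) (t + h)
      (fun e he => by linarith [hgap e he]) (fun e he => by
        rcases ha' e he with h1 | h1
        · exact Or.inl (by linarith [ha t List.mem_cons_self])
        · rcases List.mem_cons.1 h1 with rfl | h1
          · exact Or.inl (by linarith)
          · exact Or.inr h1) (π.trans (M.nextPerm δ ρ h t)) (hB t List.mem_cons_self)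
      (fun e he => hB e (List.mem_cons_of_mem _ he))
    have h5 : ∑ i, M.work δ (t - h) i ≤ ∑ i, M.work δ (t + h) i :=
      Finset.sum_le_sum fun i _ => work_mono (by linarith) i
    have h6 : (M.meetingSnapshot δ ρ h t π).time - (M.ideal δ ρ (t - h) π).time = h := by
      change t - (t - h) = h; ring
    have h7 : (M.ideal δ ρ (t + h) (π.trans (M.nextPerm δ ρ h t))).time -
        (M.meetingSnapshot δ ρ h t π).time = h := by
      change t + h - t = h; ring
    rw [h6] at h2
    rw [h7] at h3
    simp only [eventList, Snapshot.listCost, List.length_cons, Nat.cast_add, Nat.cast_one] at h4 ⊢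
    linarith

omit hg in
theorem sumOfCosts_le (hρ : 0 ≤ ρ) : (M.schedule δ ρ h E).sumOfCosts M ≤
    ∑ i, M.finishTime δ i + k * ρ + E.length * (k * (2 * h)) := by
  have hh := hE.pos
  obtain ⟨B, hB0, hB⟩ : ∃ B, ρ ≤ B ∧ ∀ e ∈ E, e + h ≤ B := by
    have key : ∀ l : List ℝ, ∃ B, ρ ≤ B ∧ ∀ e ∈ l, e + h ≤ B := by
      intro l
      induction l with
      | nil => exact ⟨ρ, le_rfl, by simp⟩
      | cons a l ih =>
        obtain ⟨B, h1, h2⟩ := ih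
        refine ⟨max B (a + h), le_max_of_le_left h1, fun e he => ?_⟩
        rcases List.mem_cons.1 he with rfl | he
        · exact le_max_right _ _
        · exact le_max_of_le_left (h2 e he)
    exact key E
  have h1 := listCost_eventList_le hM hE E hE.sorted (fun _ he => he) ρ hE.early
    (fun _ he => Or.inr he) 1 hB0 hB
  have h2 := stepCost_le (M := M) (s := M.initial) (s' := M.ideal δ ρ ρ 1) hρ
  have h3 : (M.ideal δ ρ ρ 1).time - M.initial.time = ρ := sub_zero ρ
  have h4 : ∑ i, M.work δ B i - ∑ i, M.work δ ρ i ≤ ∑ i, M.finishTime δ i := by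
    rw [← Finset.sum_sub_distrib]
    refine Finset.sum_le_sum fun i _ => ?_
    have h5 := hE.start_lt i
    have h6 := (le_of_mem_times (start_mem_times (M := M) (δ := δ) i)).2
    unfold work
    split_ifs
    · linarith
    · have h7 := min_le_left (M.finishTime δ i) B
      have h8 : 0 ≤ min (M.finishTime δ i) ρ := le_min (by linarith) hρ
      linarith
  rw [h3] at h2
  simp only [Schedule.sumOfCosts, Schedule.snapshots, schedule, Snapshot.listCost]
  linarith

end Mission

/-! ### Least positive gaps and sorting -/

open Classical in
-- The start value `1` of the fold makes positivity unconditional; only lower bounds for distances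
-- and gaps are needed, not their exact minimum.
theorem posMin_spec (l : List ℝ) : 0 < posMin l ∧ posMin l ≤ 1 ∧ ∀ x ∈ l, 0 < x → posMin l ≤ x := by
  induction l using List.reverseRecOn with
  | nil => simp [posMin]
  | append_singleton l a ih =>
    have key : posMin (l ++ [a]) = if 0 < a ∧ a < posMin l then a else posMin l := by
      unfold posMin; rw [List.foldl_append, List.foldl_cons, List.foldl_nil]
    obtain ⟨h1, h2, h3⟩ := ih
    rw [key]
    split_ifs with h
    · refine ⟨h.1, by linarith, fun x hx hx0 => ?_⟩
      rcases List.mem_append.1 hx with hx | hx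
      · have := h3 x hx hx0; linarith
      · rw [List.mem_singleton.1 hx]
    · refine ⟨h1, h2, fun x hx hx0 => ?_⟩
      rcases List.mem_append.1 hx with hx | hx
      · exact h3 x hx hx0
      · rw [List.mem_singleton.1 hx] at hx0 ⊢
        exact not_lt.1 fun h4 => h ⟨hx0, h4⟩

theorem minGap_pos (l : List ℝ) : 0 < minGap l := (posMin_spec _).1

theorem minGap_le {l : List ℝ} {x y : ℝ} (hx : x ∈ l) (hy : y ∈ l) (h : x < y) :
    minGap l ≤ y - x :=
  (posMin_spec _).2.2 _ (List.mem_flatMap.2 ⟨y, hy, List.mem_map.2 ⟨x, hx, rfl⟩⟩) (sub_pos.2 h)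

theorem mem_insertSorted {l : List ℝ} {x y : ℝ} : y ∈ insertSorted l x ↔ y = x ∨ y ∈ l := by
  simp only [insertSorted, List.mem_append, List.mem_filter, decide_eq_true_eq, List.mem_cons]
  rcases lt_trichotomy y x with h | rfl | h
  · simp [h, h.not_gt, h.ne]
  · simp
  · simp [h, h.not_gt, h.ne']

theorem pairwise_insertSorted {l : List ℝ} (hl : l.Pairwise (· < ·)) (x : ℝ) :
    (insertSorted l x).Pairwise (· < ·) := by
  refine List.pairwise_append.2 ⟨hl.filter _, List.pairwise_cons.2 ⟨fun y hy => ?_, hl.filter _⟩,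
    fun y hy z hz => ?_⟩
  · simpa using (List.mem_filter.1 hy).2
  · have hy' : y < x := by simpa using (List.mem_filter.1 hy).2
    rcases List.mem_cons.1 hz with rfl | hz
    · exact hy'
    · exact hy'.trans (by simpa using (List.mem_filter.1 hz).2)

theorem sortDedup_spec (l : List ℝ) :
    (sortDedup l).Pairwise (· < ·) ∧ ∀ x, x ∈ sortDedup l ↔ x ∈ l := by
  induction l using List.reverseRecOn with
  | nil => simp [sortDedup]
  | append_singleton l a ih =>
    have key : sortDedup (l ++ [a]) = insertSorted (sortDedup l) a := by simp [sortDedup]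
    rw [key]
    exact ⟨pairwise_insertSorted ih.1 a, fun x => by
      rw [mem_insertSorted, ih.2]; simp [or_comm]⟩

/-! ### Choice of delay, parking distance and windows -/

namespace Mission

variable {n k : ℕ} (M : Mission n k) (ε : ℝ)

/-- The tours of all agents. -/
def tours : List Tour := List.ofFn M.tour

/-- The delay used by the algorithm. -/
def theDelay : ℝ := delayOf ε M.tours

/-- The candidates for meeting times used by the algorithm. -/
def theMeets : List ℝ := meetTimes (cornerTimes (M.theDelay ε) M.tours)

/-- The parking distance used by the algorithm. -/
def thePark : ℝ := parkDist (M.theDelay ε) M.tours (M.theMeets ε)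

/-- The events used by the algorithm. -/
def theEvents : List ℝ := eventTimes (M.thePark ε) (M.theMeets ε)

/-- The window length used by the algorithm. -/
def theWindow : ℝ :=
  windowOf (M.thePark ε) (List.ofFn (M.token (M.theDelay ε) (M.thePark ε))) (M.theEvents ε)

variable {M ε} {δ ρ h : ℝ}

theorem zipIdx_ofFn {α : Type*} (f : Fin k → α) :
    (List.ofFn f).zipIdx = List.ofFn fun i => (f i, i.val) := by
  apply List.ext_getElem <;> simp

/-- The times at which the motion along route `i` without delay is at a vertex. -/
def baseTimes (M : Mission n k) (i : Fin k) : List ℝ :=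
  pathTimes (0, (M.tour i).1) (M.tour i).2.flatten

theorem mem_times_iff {i : Fin k} {t : ℝ} :
    t ∈ M.times δ i ↔ ∃ b ∈ M.baseTimes i, b + (M.startOf δ i).1 = t := by
  have h1 := pathTimes_shift (0, (M.tour i).1) (M.tour i).2.flatten (M.startOf δ i).1
  rw [zero_add] at h1
  rw [times, show M.startOf δ i = ((M.startOf δ i).1, (M.tour i).1) from rfl, h1]
  simp [baseTimes]

theorem mem_cornerTimes {t : ℝ} : t ∈ cornerTimes δ M.tours ↔ ∃ i, t ∈ M.times δ i := by
  rw [cornerTimes, tours, zipIdx_ofFn, List.mem_flatMap]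
  constructor
  · rintro ⟨x, hx, ht⟩
    obtain ⟨i, rfl⟩ := List.mem_ofFn.1 hx
    exact ⟨i, ht⟩
  · rintro ⟨i, ht⟩
    exact ⟨_, List.mem_ofFn.2 ⟨i, rfl⟩, ht⟩

theorem mem_meetTimes {t : ℝ} :
    t ∈ meetTimes (cornerTimes δ M.tours) ↔ M.IsMeetTime δ t := by
  simp only [meetTimes, List.mem_flatMap, List.mem_map, mem_cornerTimes]
  constructor
  · rintro ⟨a, ⟨i, hi⟩, b, ⟨j, hj⟩, rfl⟩
    exact ⟨i, j, a, hi, b, hj, rfl⟩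
  · rintro ⟨i, j, a, hi, b, hj, rfl⟩
    exact ⟨a, ⟨i, hi⟩, b, ⟨j, hj⟩, rfl⟩

theorem mem_theEvents {t : ℝ} :
    t ∈ M.theEvents ε ↔ M.IsEventTime (M.theDelay ε) (M.thePark ε) t := by
  rw [theEvents, eventTimes, (sortDedup_spec _).2]
  simp [theMeets, mem_meetTimes, IsEventTime]

/-! ### Sizes of the parameters -/

theorem length_tours : M.tours.length = k := by simp [tours]

theorem mem_base {i : Fin k} {b : ℝ} (hb : b ∈ M.baseTimes i) :
    b ∈ M.tours.flatMap fun r => pathTimes (0, r.1) r.2.flatten :=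
  List.mem_flatMap.2 ⟨M.tour i, List.mem_ofFn.2 ⟨i, rfl⟩, hb⟩

/-- The least gap between times without delay. -/
def baseGap (M : Mission n k) : ℝ :=
  minGap (M.tours.flatMap fun r => pathTimes (0, r.1) r.2.flatten)

/-- Each of the `k` agendas is delayed by at most `k * δ`, which costs `k * k * δ` in total; hence
the square in the factor. The same factor keeps all delays below the least gap of undelayed times.
-/
theorem theDelay_bounds (hε : 0 < ε) : 0 < M.theDelay ε ∧
    M.theDelay ε * (8 * ((k + 1) * (k + 1))) ≤ M.baseGap ∧
    M.theDelay ε * (8 * ((k + 1) * (k + 1))) ≤ ε := by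
  have h1 : (0 : ℝ) < 8 * ((k + 1) * (k + 1)) := by positivity
  have h2 : M.theDelay ε * (8 * ((k + 1) * (k + 1))) = min M.baseGap ε := by
    rw [theDelay, delayOf, length_tours]
    push_cast
    exact div_mul_cancel₀ _ h1.ne'
  have h3 : 0 < min M.baseGap ε := lt_min (minGap_pos _) hε
  refine ⟨?_, h2 ▸ min_le_left _ _, h2 ▸ min_le_right _ _⟩
  rw [← h2] at h3
  exact pos_of_mul_pos_left h3 h1.le

theorem startOf_bounds (hδ : 0 < δ) (i : Fin k) :
    δ ≤ (M.startOf δ i).1 ∧ (M.startOf δ i).1 ≤ δ * k := by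
  rw [startOf_fst]
  have h1 : (1 : ℝ) ≤ ((i.val + 1 : ℕ) : ℝ) := by exact_mod_cast Nat.succ_le_succ (Nat.zero_le _)
  have h2 : ((i.val + 1 : ℕ) : ℝ) ≤ k := by exact_mod_cast i.isLt
  exact ⟨by nlinarith, by nlinarith⟩

theorem startOf_lt_baseGap (hε : 0 < ε) (i : Fin k) :
    (M.startOf (M.theDelay ε) i).1 < M.baseGap := by
  obtain ⟨h1, h2, -⟩ := theDelay_bounds (M := M) hε
  have h3 := (startOf_bounds (M := M) h1 i).2
  have h4 : M.theDelay ε * k < M.theDelay ε * (8 * ((k + 1) * (k + 1))) := by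
    apply mul_lt_mul_of_pos_left _ h1
    have : (0 : ℝ) ≤ k := k.cast_nonneg
    nlinarith
  linarith

/-- Parking costs at most `k * ρ`, hence the factor `k + 1`. The gap of the meeting times serves
`Generic`, and the distances of the starts serve the first step of the schedule. -/
theorem thePark_bounds (hM : M.IsTourAssignment) (hε : 0 < ε) : 0 < M.thePark ε ∧
    M.thePark ε * (8 * (k + 1)) ≤ M.theDelay ε ∧
    M.thePark ε * (8 * (k + 1)) ≤ minGap (M.theMeets ε) ∧
    ∀ i j, i ≠ j →
      M.thePark ε * (8 * (k + 1)) ≤ dist (M.pos (M.start i)) (M.pos (M.start j)) := by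
  have h1 : (0 : ℝ) < 8 * (k + 1) := by positivity
  set D := posMin (M.tours.flatMap fun r => M.tours.map fun r' => dist r.1 r'.1) with hD
  have h2 : M.thePark ε * (8 * (k + 1)) =
      min (min (M.theDelay ε) (minGap (M.theMeets ε))) D := by
    rw [thePark, parkDist, length_tours]
    push_cast
    exact div_mul_cancel₀ _ h1.ne'
  have h3 : 0 < min (min (M.theDelay ε) (minGap (M.theMeets ε))) D :=
    lt_min (lt_min (theDelay_bounds hε).1 (minGap_pos _)) (posMin_spec _).1
  refine ⟨?_, h2 ▸ (min_le_left _ _).trans (min_le_left _ _),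
    h2 ▸ (min_le_left _ _).trans (min_le_right _ _), fun i j hij => ?_⟩
  · rw [← h2] at h3
    exact pos_of_mul_pos_left h3 h1.le
  · refine (h2 ▸ min_le_right _ _ : M.thePark ε * (8 * (k + 1)) ≤ D).trans ?_
    refine (posMin_spec _).2.2 _ (List.mem_flatMap.2 ⟨M.tour i, List.mem_ofFn.2 ⟨i, rfl⟩,
      List.mem_map.2 ⟨M.tour j, List.mem_ofFn.2 ⟨j, rfl⟩, rfl⟩⟩) (dist_pos.2 fun h => hij ?_)
    exact hM.start_injective (hM.embedded.injective h)

/-- For each event, all `k` agents may use the whole window of length `2 * h`; hence the factors for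
the numbers of agents and events. Dropping these factors leaves the bounds that keep windows and
agents apart. -/
theorem theWindow_bounds (hM : M.IsTourAssignment) (hε : 0 < ε) : 0 < M.theWindow ε ∧
    M.theWindow ε * (8 * ((k + 1) * ((M.theEvents ε).length + 1))) ≤ M.thePark ε ∧
    M.theWindow ε * 8 ≤ minGap (M.theEvents ε) ∧
    ∀ t ∈ M.theEvents ε, ∀ i j,
      M.place (M.theDelay ε) (M.thePark ε) i t ≠ M.place (M.theDelay ε) (M.thePark ε) j t →
      M.theWindow ε * 8 ≤ dist (M.place (M.theDelay ε) (M.thePark ε) i t)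
        (M.place (M.theDelay ε) (M.thePark ε) j t) := by
  have h1 : (0 : ℝ) < 8 * ((k + 1) * ((M.theEvents ε).length + 1)) := by positivity
  set toks := List.ofFn (M.token (M.theDelay ε) (M.thePark ε)) with htoks
  set D := posMin ((M.theEvents ε).flatMap fun t => toks.flatMap fun x =>
    toks.map fun y => dist (x.pos t) (y.pos t)) with hD
  have h2 : M.theWindow ε * (8 * ((k + 1) * ((M.theEvents ε).length + 1))) =
      min (min (M.thePark ε) (minGap (M.theEvents ε))) D := by
    rw [theWindow, windowOf, ← htoks, show toks.length = k by simp [htoks]]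
    push_cast
    exact div_mul_cancel₀ _ h1.ne'
  have h3 : 0 < min (min (M.thePark ε) (minGap (M.theEvents ε))) D :=
    lt_min (lt_min (thePark_bounds hM hε).1 (minGap_pos _)) (posMin_spec _).1
  have h4 : 0 < M.theWindow ε := by
    rw [← h2] at h3
    exact pos_of_mul_pos_left h3 h1.le
  have h5 : M.theWindow ε * 8 ≤ M.theWindow ε * (8 * ((k + 1) * ((M.theEvents ε).length + 1))) := by
    apply mul_le_mul_of_nonneg_left _ h4.le
    have h6 : (0 : ℝ) ≤ k := k.cast_nonneg
    have h7 : (0 : ℝ) ≤ (M.theEvents ε).length := Nat.cast_nonneg _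
    nlinarith [mul_nonneg h6 h7]
  refine ⟨h4, h2 ▸ (min_le_left _ _).trans (min_le_left _ _),
    h5.trans (h2 ▸ (min_le_left _ _).trans (min_le_right _ _)), fun t ht i j hij => ?_⟩
  refine h5.trans ((h2 ▸ min_le_right _ _ : _ ≤ D).trans ?_)
  exact (posMin_spec _).2.2 _ (List.mem_flatMap.2 ⟨t, ht, List.mem_flatMap.2
    ⟨_, List.mem_ofFn.2 ⟨i, rfl⟩, List.mem_map.2 ⟨_, List.mem_ofFn.2 ⟨j, rfl⟩, rfl⟩⟩⟩)
    (dist_pos.2 hij)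

/-- Differences of undelayed corner times vanish or exceed all delays. This gives disjointness and
lateness; the other two conditions hold because `2 * ρ` is less than every positive difference of
meeting times. -/
theorem generic (hM : M.IsTourAssignment) (hε : 0 < ε) :
    Generic M (M.theDelay ε) (M.thePark ε) := by
  obtain ⟨h1, h2, h3⟩ := theDelay_bounds (M := M) hε
  obtain ⟨h4, h5, h6, h7⟩ := thePark_bounds hM hε
  have hk : (0 : ℝ) ≤ k := k.cast_nonneg
  have h8 : 2 * M.thePark ε < minGap (M.theMeets ε) := by nlinarith
  refine ⟨h4, fun i j t hi hj => ?_, fun i j s hs => ?_, fun i s hs => ?_, fun s t hs ht hst => ?_⟩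
  · obtain ⟨a, ha, hat⟩ := mem_times_iff.1 hi
    obtain ⟨b, hb, hbt⟩ := mem_times_iff.1 hj
    have hi1 := startOf_lt_baseGap (M := M) hε i
    have hj1 := startOf_lt_baseGap (M := M) hε j
    have hi2 := (startOf_bounds (M := M) h1 i).1
    have hj2 := (startOf_bounds (M := M) h1 j).1
    -- Different undelayed times are farther apart than any two delays, so a common delayed time
    -- forces equal undelayed times and then equal delays.
    have hab : a = b := by
      rcases lt_trichotomy a b with h | h | h
      · have := minGap_le (mem_base ha) (mem_base hb) h
        rw [← baseGap] at this; linarith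
      · exact h
      · have := minGap_le (mem_base hb) (mem_base ha) h
        rw [← baseGap] at this; linarith
    have h9 : (M.startOf (M.theDelay ε) i).1 = (M.startOf (M.theDelay ε) j).1 := by linarith
    rw [startOf_fst, startOf_fst] at h9
    have h10 := mul_left_cancel₀ h1.ne' h9
    have h11 : i.val + 1 = j.val + 1 := by exact_mod_cast h10
    exact Fin.ext (by omega)
  · obtain ⟨b, hb, hbt⟩ := mem_times_iff.1 (t₁_mem_times hs)
    have h9 := (le_of_mem_times (t₀_mem_times hs)).1
    have h10 := hM.seg_lt hs
    -- Time `0` is an undelayed corner time of every route; a segment therefore ends, without delay,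
    -- no earlier than the least gap, which exceeds every delay.
    have h11 : (0 : ℝ) ∈ M.baseTimes i := List.mem_cons_self
    have h12 := minGap_le (mem_base h11) (mem_base hb) (by linarith)
    rw [← baseGap] at h12
    have h13 := startOf_lt_baseGap (M := M) hε j
    have h14 := (startOf_bounds (M := M) h1 i).1
    linarith
  · have h9 := minGap_le (mem_meetTimes.2 (isMeetTime_of_mem (t₀_mem_times hs)))
      (mem_meetTimes.2 (isMeetTime_of_mem (t₁_mem_times hs))) (hM.seg_lt hs)
    exact h8.trans_le h9
  · have h9 := minGap_le (mem_meetTimes.2 ht) (mem_meetTimes.2 hs) (by linarith)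
    have : minGap (M.theMeets ε) ≤ s - t := h9
    linarith

theorem meetTime_bounds (hε : 0 < ε) {t : ℝ} (ht : M.IsMeetTime (M.theDelay ε) t) :
    M.theDelay ε ≤ t ∧ t ≤ M.maxTime + M.theDelay ε * k := by
  have h1 := (theDelay_bounds (M := M) hε).1
  have key : ∀ i, ∀ a ∈ M.times (M.theDelay ε) i,
      M.theDelay ε ≤ a ∧ a ≤ M.maxTime + M.theDelay ε * k := by
    intro i a ha
    have h2 := le_of_mem_times ha
    have h3 := startOf_bounds (M := M) h1 i
    have h4 : (M.route i).time M.pos ≤ M.maxTime :=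
      le_ciSup (f := fun i => (M.route i).time M.pos) (Set.finite_range _).bddAbove i
    rw [finishTime_eq] at h2
    exact ⟨by linarith, by linarith⟩
  obtain ⟨i, j, a, ha, b, hb, rfl⟩ := ht
  have h2 := key i a ha
  have h3 := key j b hb
  exact ⟨by linarith, by linarith⟩

theorem windows (hM : M.IsTourAssignment) (hε : 0 < ε) :
    Windows M (M.theDelay ε) (M.thePark ε) ε (M.theWindow ε) (M.theEvents ε) := by
  obtain ⟨h1, h2, h3⟩ := theDelay_bounds (M := M) hε
  obtain ⟨h4, h5, -, -⟩ := thePark_bounds hM hε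
  obtain ⟨h6, h7, h8, h9⟩ := theWindow_bounds hM hε
  have hk : (0 : ℝ) ≤ k := k.cast_nonneg
  have hl : (0 : ℝ) ≤ (M.theEvents ε).length := Nat.cast_nonneg _
  have h10 : 8 * M.theDelay ε ≤ ε := by nlinarith [mul_nonneg h1.le hk, mul_nonneg hk hk]
  have h11 : 8 * M.thePark ε ≤ M.theDelay ε := by nlinarith
  have h12 : 8 * M.theWindow ε ≤ M.thePark ε := by
    have : 0 ≤ M.theWindow ε * (k * (M.theEvents ε).length + k + (M.theEvents ε).length) := by
      positivity
    nlinarith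
  refine ⟨h6, by linarith, (sortDedup_spec _).1, fun a ha b hb hab => ?_,
    fun t ht => mem_theEvents.2 ht, fun t ht i j hij => ?_, fun t ht => ?_⟩
  · have := minGap_le ha hb hab
    linarith
  · have := h9 t ht i j hij
    linarith
  · obtain ⟨s, hs, hst⟩ := mem_theEvents.1 ht
    have h13 := (meetTime_bounds hε hs).1
    rcases hst with rfl | rfl | rfl <;> linarith

/-- The schedule found by the algorithm. -/
def theSchedule (M : Mission n k) (ε : ℝ) : Schedule k :=
  M.schedule (M.theDelay ε) (M.thePark ε) (M.theWindow ε) (M.theEvents ε)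

theorem theSchedule_resolves (hM : M.IsTourAssignment) (hε : 0 < ε) :
    (M.theSchedule ε).Resolves M ε := by
  obtain ⟨h4, -, -, h7⟩ := thePark_bounds hM hε
  have hk : (0 : ℝ) ≤ k := k.cast_nonneg
  exact schedule_resolves hM (generic hM hε) (windows hM hε) fun i j hij => by
    have := h7 i j hij
    nlinarith

theorem maxTime_nonneg (M : Mission n k) : 0 ≤ M.maxTime := by
  have hw : ∀ {u v : Fin n} (p : M.graph.Walk u v), 0 ≤ walkTime M.pos p := fun p =>
    List.sum_nonneg (by simp only [List.mem_map]; rintro _ ⟨d, -, rfl⟩; exact dist_nonneg)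
  have hr : ∀ {u : Fin n} {gs : List (Fin n)} (r : Route M.graph u gs), 0 ≤ r.time M.pos := by
    intro u gs r
    induction r with
    | done u => exact le_rfl
    | leg p rest ih => exact add_nonneg (hw p) ih
  exact Real.iSup_nonneg fun i => hr _

/-- The last event is at most `ρ` after the last meeting candidate, which exceeds the longest tour
by at most `k * δ`; the last window adds `h`. -/
theorem theSchedule_makespan_le (hM : M.IsTourAssignment) (hε : 0 < ε) :
    (M.theSchedule ε).makespan ≤ M.maxTime + ε := by
  obtain ⟨h1, h2, h3⟩ := theDelay_bounds (M := M) hε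
  obtain ⟨h4, h5, -, -⟩ := thePark_bounds hM hε
  obtain ⟨h6, h7, -, -⟩ := theWindow_bounds hM hε
  have hk : (0 : ℝ) ≤ k := k.cast_nonneg
  have hl : (0 : ℝ) ≤ (M.theEvents ε).length := Nat.cast_nonneg _
  have h10 : 8 * M.theDelay ε * k + 8 * M.theDelay ε ≤ ε := by
    nlinarith [mul_nonneg h1.le hk, mul_nonneg (mul_nonneg h1.le hk) hk]
  have h11 : 8 * M.thePark ε ≤ M.theDelay ε := by nlinarith
  have h12 : 8 * M.theWindow ε ≤ M.thePark ε := by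
    have : 0 ≤ M.theWindow ε * (k * (M.theEvents ε).length + k + (M.theEvents ε).length) := by
      positivity
    nlinarith
  have h13 := M.maxTime_nonneg
  have h15 := mul_nonneg h1.le hk
  refine makespan_le (windows hM hε) (by linarith) fun e he => ?_
  obtain ⟨s, hs, hst⟩ := mem_theEvents.1 he
  have h14 := (meetTime_bounds hε hs).2
  rcases hst with rfl | rfl | rfl <;> linarith

/-- Delays, parking and windows exceed the given travel times by at most `k * k * δ`, `k * ρ` and `2
* h * k` per event; their sum is bounded by `ε`. -/
theorem theSchedule_sumOfCosts_le (hM : M.IsTourAssignment) (hε : 0 < ε) :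
    (M.theSchedule ε).sumOfCosts M ≤ M.totalTime + ε := by
  obtain ⟨h1, h2, h3⟩ := theDelay_bounds (M := M) hε
  obtain ⟨h4, h5, -, -⟩ := thePark_bounds hM hε
  obtain ⟨h6, h7, -, -⟩ := theWindow_bounds hM hε
  have hk : (0 : ℝ) ≤ k := k.cast_nonneg
  have hl : (0 : ℝ) ≤ (M.theEvents ε).length := Nat.cast_nonneg _
  have h10 : 8 * (M.theDelay ε * k * k) + 8 * M.theDelay ε ≤ ε := by
    nlinarith [mul_nonneg h1.le hk, mul_nonneg (mul_nonneg h1.le hk) hk]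
  have h11 : 8 * (k * M.thePark ε) + 8 * M.thePark ε ≤ M.theDelay ε := by nlinarith
  have h12 : 8 * ((M.theEvents ε).length * (k * M.theWindow ε)) ≤ M.thePark ε := by
    have : 0 ≤ M.theWindow ε * (k + (M.theEvents ε).length + 1) := by positivity
    nlinarith
  have h8 := sumOfCosts_le hM (windows hM hε) h4.le
  have h9 : ∑ i, M.finishTime (M.theDelay ε) i ≤ M.totalTime + k * (M.theDelay ε * k) := by
    calc ∑ i, M.finishTime (M.theDelay ε) i
        ≤ ∑ i, ((M.route i).time M.pos + M.theDelay ε * k) := Finset.sum_le_sum fun i _ => by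
          rw [finishTime_eq]; linarith [(startOf_bounds (M := M) h1 i).2]
      _ = _ := by rw [Finset.sum_add_distrib]; simp [totalTime]
  have h13 : (M.theSchedule ε).sumOfCosts M ≤ _ := h8
  linarith

end Mission

/-! ## The algorithm computes the schedule -/

/-- A route as the list of its legs. -/
def Route.rawLegs {n : ℕ} {G : SimpleGraph (Fin n)} :
    {u : Fin n} → {gs : List (Fin n)} → Route G u gs → List (List ℕ)
  | _, _, .done _ => []
  | _, _, .leg p rest => p.support.map Fin.val :: rest.rawLegs

theorem Route.enc_rawLegs {n : ℕ} {G : SimpleGraph (Fin n)} {u : Fin n} {gs : List (Fin n)}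
    (r : Route G u gs) : enc r.rawLegs = r.encode := by
  induction r with
  | done u => rfl
  | leg p rest ih =>
    rw [Route.encode, ← ih]
    simp only [Route.rawLegs, enc, List.map_cons, Val.list, List.map_map]
    rfl

/-- A snapshot in the format of the output. -/
def Snapshot.raw {k : ℕ} (s : Snapshot k) : RawSnapshot :=
  (s.time, List.ofFn s.place, List.ofFn fun a => (s.job a).val, List.ofFn s.served, ())

theorem Snapshot.enc_raw {k : ℕ} (s : Snapshot k) : enc s.raw = s.encode := by
  simp only [Snapshot.raw, Snapshot.encode, enc, List.map_ofFn, Val.list]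
  rfl

theorem Schedule.enc_raw {k : ℕ} (S : Schedule k) :
    enc (S.snapshots.map Snapshot.raw) = S.encode := by
  simp only [Schedule.encode, enc, List.map_map]
  congr 2
  funext s
  exact s.enc_raw

namespace Mission

variable {n k : ℕ} (M : Mission n k) (ε : ℝ)

open Classical in
/-- The input of the algorithm. -/
def raw : RawMission :=
  (ε, List.ofFn M.pos,
    List.ofFn fun u => ((List.finRange n).filter fun v => M.graph.Adj u v).map Fin.val,
    List.ofFn fun i => ((M.start i).val, (M.route i).rawLegs), ())

theorem enc_raw : enc (M.raw ε) = M.encode ε := by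
  have h : (List.ofFn fun i => Val.cons (.nat (M.start i).val) (M.route i).encode) =
      List.ofFn fun i => enc ((M.start i).val, (M.route i).rawLegs) :=
    congrArg List.ofFn (funext fun i => congrArg (Val.cons _) (M.route i).enc_rawLegs.symm)
  rw [encode, h]
  simp only [raw, enc, List.map_ofFn, Val.list, List.map_map, Function.comp_def]

variable {M ε} {δ ρ h : ℝ}

theorem getD_pos (v : Fin n) : (List.ofFn M.pos).getD v.val 0 = M.pos v := by
  simp [List.getD]

theorem map_rawLegs {u : Fin n} {gs : List (Fin n)} (r : Route M.graph u gs) :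
    r.rawLegs.map (fun leg => leg.tail.map fun v => (List.ofFn M.pos).getD v 0) =
      r.legPoints M.pos := by
  induction r with
  | done u => rfl
  | leg p rest ih =>
    rw [Route.rawLegs, List.map_cons, ih, Route.legPoints, ← List.map_tail, List.map_map]
    congr 2
    funext v
    exact getD_pos v

theorem toursOf_raw : toursOf (M.raw ε).2.1 (M.raw ε).2.2.2.1 = M.tours := by
  simp only [toursOf, raw, List.map_ofFn, tours]
  congr 1
  funext i
  exact Prod.ext (getD_pos _) (map_rawLegs _)

theorem parkTokens_eq : parkTokens ρ (delayedTokens δ M.tours) = List.ofFn (M.token δ ρ) := by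
  have h1 : delayedTokens δ M.tours = List.ofFn fun i => delayedToken δ (M.tour i, i.val) := by
    rw [delayedTokens, tours, zipIdx_ofFn, List.map_ofFn]; rfl
  have h2 : (List.ofFn fun i => delayedToken δ (M.tour i, i.val)).flatMap Token.segs =
      M.allSegs δ := by
    rw [List.flatMap_def, List.map_ofFn]; rfl
  rw [parkTokens, h1, h2, List.map_ofFn]; rfl

theorem getToken_ofFn (f : Fin k → Token) (j : Fin k) :
    getToken (List.ofFn f) j.val = f j := by
  simp [getToken, List.getD]

/-- Such a fold returns the value at the last selected element. Since meeting partners are unique,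
it does not matter that it is the last. -/
theorem foldl_select {α β : Type*} (T : α → Prop) [DecidablePred T] (f : α → β) (l : List α)
    (b : β) : (l.foldl (fun j y => if T y then f y else j) b = b ∧ ∀ y ∈ l, ¬ T y) ∨
      ∃ y ∈ l, T y ∧ l.foldl (fun j y => if T y then f y else j) b = f y := by
  induction l using List.reverseRecOn with
  | nil => simp
  | append_singleton l a ih =>
    rw [List.foldl_append, List.foldl_cons, List.foldl_nil]
    by_cases ha : T a
    · exact Or.inr ⟨a, by simp, ha, by simp [ha]⟩
    · rw [if_neg ha]
      rcases ih with ⟨h1, h2⟩ | ⟨y, hy, h1, h2⟩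
      · refine Or.inl ⟨h1, fun y hy => ?_⟩
        rcases List.mem_append.1 hy with hy | hy
        · exact h2 y hy
        · rwa [List.mem_singleton.1 hy]
      · exact Or.inr ⟨y, by simp [hy], h1, h2⟩

section

variable {E : List ℝ} (hM : M.IsTourAssignment) (hg : Generic M δ ρ)
  (hE : Windows M δ ρ ε h E)

include hM hg hE

open Classical in
theorem partner_eq {t : ℝ} (ht : t ∈ E) (i : Fin k) :
    partner (List.ofFn (M.token δ ρ)) t (M.token δ ρ i) = (M.mate δ ρ t i).val := by
  rcases foldl_select (fun y : Token => y.idx ≠ (M.token δ ρ i).idx ∧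
    y.pos t = (M.token δ ρ i).pos t) Token.idx (List.ofFn (M.token δ ρ)) (M.token δ ρ i).idx with
    ⟨h1, h2⟩ | ⟨y, hy, ⟨h1, h2⟩, h3⟩
  · refine h1.trans (congrArg Fin.val ?_ : i.val = _)
    by_contra hne
    exact h2 _ (List.mem_ofFn.2 ⟨M.mate δ ρ t i, rfl⟩)
      ⟨fun h3 => hne (Fin.ext h3.symm), place_mate hM hg hE ht i⟩
  · obtain ⟨j, rfl⟩ := List.mem_ofFn.1 hy
    refine h3.trans (congrArg Fin.val (mate_eq hM hg hE ht (j := j) ?_ h2.symm).symm : j.val = _)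
    rintro rfl
    exact h1 rfl

omit hM hg hE in
theorem idealSnapshot_eq (t : ℝ) (π : Equiv.Perm (Fin k)) :
    idealSnapshot (List.ofFn (M.token δ ρ)) t (List.ofFn fun a => (π a).val) =
      (M.ideal δ ρ t π).raw := by
  simp only [idealSnapshot, List.map_ofFn, Snapshot.raw, ideal, Function.comp_def, getToken_ofFn]
  rfl

theorem eventSnapshot_eq {t : ℝ} (ht : t ∈ E) (π : Equiv.Perm (Fin k)) :
    eventSnapshot (List.ofFn (M.token δ ρ)) h t (List.ofFn fun a => (π a).val) =
      (M.meetingSnapshot δ ρ h t π).raw := by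
  simp only [eventSnapshot, List.map_ofFn, Snapshot.raw, meetingSnapshot, Function.comp_def,
    getToken_ofFn, partner_eq hM hg hE ht]
  have h1 : ∀ i, (M.mate δ ρ t i).val = (M.token δ ρ i).idx ↔ M.mate δ ρ t i = i :=
    fun i => ⟨fun h => Fin.ext h, fun h => congrArg Fin.val h⟩
  simp only [h1]
  rfl

theorem nextJobs_eq {t : ℝ} (ht : t ∈ E) (π : Equiv.Perm (Fin k)) :
    nextJobs (List.ofFn (M.token δ ρ)) h t (List.ofFn fun a => (π a).val) =
      List.ofFn fun a => ((π.trans (M.nextPerm δ ρ h t)) a).val := by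
  simp only [nextJobs, List.map_ofFn, Function.comp_def, getToken_ofFn, partner_eq hM hg hE ht,
    Equiv.trans_apply, nextPerm_apply hM hg hE ht, nextFun]
  congr 1
  funext a
  have key : ((getToken (List.ofFn (M.token δ ρ)) (π a).val).Returns h t ∧
      (getToken (List.ofFn (M.token δ ρ)) (partner (List.ofFn (M.token δ ρ)) t
        (getToken (List.ofFn (M.token δ ρ)) (π a).val))).Returns h t) ↔
      M.Returns δ ρ h t (π a) ∧ M.Returns δ ρ h t (M.mate δ ρ t (π a)) := by
    rw [getToken_ofFn, partner_eq hM hg hE ht, getToken_ofFn]; rfl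
  by_cases h1 : M.Returns δ ρ h t (π a) ∧ M.Returns δ ρ h t (M.mate δ ρ t (π a))
  · rw [if_pos h1]; exact if_pos (key.2 h1)
  · rw [if_neg h1]; exact if_neg fun h2 => h1 (key.1 h2)

theorem eventSnapshots_eq (l : List ℝ) (hl : ∀ e ∈ l, e ∈ E) (π : Equiv.Perm (Fin k)) :
    eventSnapshots (List.ofFn (M.token δ ρ)) h (List.ofFn fun a => (π a).val) l =
      (M.eventList δ ρ h π l).map Snapshot.raw := by
  induction l generalizing π with
  | nil => rfl
  | cons t l ih =>
    have ht := hl t List.mem_cons_self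
    rw [eventSnapshots, eventGroup, nextJobs_eq hM hg hE ht, eventSnapshot_eq hM hg hE ht,
      idealSnapshot_eq, idealSnapshot_eq, ih fun e he => hl e (List.mem_cons_of_mem _ he)]
    rfl

theorem outputOf_eq : (M.schedule δ ρ h E).snapshots.map Snapshot.raw =
    (0, M.tours.map Prod.fst, (List.ofFn (M.token δ ρ)).map Token.idx,
      (List.ofFn (M.token δ ρ)).map fun _ => 0, ()) ::
    idealSnapshot (List.ofFn (M.token δ ρ)) ρ ((List.ofFn (M.token δ ρ)).map Token.idx) ::
      eventSnapshots (List.ofFn (M.token δ ρ)) h ((List.ofFn (M.token δ ρ)).map Token.idx) E := by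
  have h1 : (List.ofFn (M.token δ ρ)).map Token.idx =
      List.ofFn fun a => ((1 : Equiv.Perm (Fin k)) a).val := by
    rw [List.map_ofFn]; rfl
  rw [h1, idealSnapshot_eq, eventSnapshots_eq hM hg hE E (fun _ he => he)]
  simp only [Schedule.snapshots, schedule, List.map_cons, Snapshot.raw, initial, tours,
    List.map_ofFn]
  rfl

end

theorem solve_raw (hM : M.IsTourAssignment) (hε : 0 < ε) :
    solve (M.raw ε) = (M.theSchedule ε).snapshots.map Snapshot.raw := by
  have h1 := outputOf_eq hM (generic hM hε) (windows hM hε)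
  rw [solve, toursOf_raw]
  change solveDelayed (M.theDelay ε) M.tours = _
  rw [solveDelayed, parkTokens_eq]
  exact h1.symm

/-! ## The size of the input -/

/-- Omitting an element of positive weight would strictly decrease the sum. -/
theorem _root_.List.Sublist.eq_of_sum_le {α : Type*} {f : α → ℝ} {l l' : List α}
    (hl : l.Sublist l') (hf : ∀ a ∈ l', 0 < f a) (hs : (l'.map f).sum ≤ (l.map f).sum) :
    l = l' := by
  induction hl with
  | slnil => rfl
  | @cons l l' a hl ih =>
    have h1 := hl.map f |>.sum_le_sum (fun x hx => by
      obtain ⟨b, hb, rfl⟩ := List.mem_map.1 hx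
      exact (hf b (List.mem_cons_of_mem _ hb)).le)
    have h2 := hf a List.mem_cons_self
    simp only [List.map_cons, List.sum_cons] at hs
    linarith
  | @cons_cons l l' a hl ih =>
    rw [ih (fun b hb => hf b (List.mem_cons_of_mem _ hb)) (by simpa using hs)]

/-- Cutting out loops deletes darts of positive length, so a shortest walk has no loops and visits
each vertex at most once. -/
theorem IsTourAssignment.length_support_le (hM : M.IsTourAssignment) {u v : Fin n}
    (p : M.graph.Walk u v)
    (hp : ∀ q : M.graph.Walk u v, walkTime M.pos p ≤ walkTime M.pos q) : p.support.length ≤ n := by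
  have h0 := hp p.bypass
  unfold walkTime at h0
  have h1 : p.bypass.darts = p.darts := List.Sublist.eq_of_sum_le
    p.darts_bypass_sublist_darts (fun d _ => dist_pos.2 (hM.pos_ne d.adj)) h0
  have h2 := p.bypass_eq_self_of_length_le_length_bypass (by
    rw [← SimpleGraph.Walk.length_darts, ← SimpleGraph.Walk.length_darts, h1])
  have h3 : p.IsPath := h2 ▸ p.bypass_isPath
  have := h3.length_lt
  rw [SimpleGraph.Walk.length_support]
  simpa using this

theorem IsTourAssignment.esize_rawLegs_le (hM : M.IsTourAssignment) {u : Fin n}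
    {gs : List (Fin n)} (r : Route M.graph u gs) (hr : r.IsShortest M.pos) :
    esize r.rawLegs ≤ gs.length * (2 * n + 2) + 1 := by
  induction r with
  | done u => simp [Route.rawLegs]
  | leg p rest ih =>
    have h1 := hM.length_support_le p hr.1
    have h2 := ih hr.2
    simp only [Route.rawLegs, esize_cons, esize_list_nat, List.length_map, List.length_cons,
      add_mul, one_mul]
    omega

theorem esize_ofFn {α : Type} [Enc α] (f : Fin k → α) :
    esize (List.ofFn f) = ∑ i, (esize (f i) + 1) + 1 := by
  induction k with
  | zero => simp
  | succ k ih =>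
    rw [List.ofFn_succ, esize_cons, ih, Fin.sum_univ_succ]
    omega

/-- Each of the goals contributes one leg with at most `n` vertices, and the adjacency lists have at
most `n * n` entries; hence a quadratic bound. -/
theorem IsTourAssignment.esize_raw_le (hM : M.IsTourAssignment) :
    esize (M.raw ε) ≤ 100 * (n + k + M.numGoals + 1) ^ 2 := by
  classical
  have h1 : esize (List.ofFn M.pos) = 4 * n + 1 := by
    rw [esize_ofFn]; simp; ring
  have h2 : esize (List.ofFn fun u =>
      ((List.finRange n).filter fun v => M.graph.Adj u v).map Fin.val) ≤ n * (2 * n + 2) + 1 := by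
    rw [esize_ofFn]
    refine Nat.add_le_add_right ((Finset.sum_le_card_nsmul _ _ (2 * n + 2) fun u _ => ?_).trans_eq
      (by simp)) 1
    rw [esize_list_nat, List.length_map]
    have := List.length_filter_le (fun v => decide (M.graph.Adj u v)) (List.finRange n)
    rw [List.length_finRange] at this
    omega
  have h3 : esize (List.ofFn fun i => ((M.start i).val, (M.route i).rawLegs)) ≤
      M.numGoals * (2 * n + 2) + 4 * k + 1 := by
    rw [esize_ofFn, numGoals, Finset.sum_mul]
    have : ∑ i, (esize ((M.start i).val, (M.route i).rawLegs) + 1) ≤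
        ∑ i, ((M.goals i).length * (2 * n + 2) + 4) := Finset.sum_le_sum fun i _ => by
      have := hM.esize_rawLegs_le (M.route i) (hM.shortest i)
      simp only [esize_pair, esize_nat]; omega
    rw [Finset.sum_add_distrib (f := fun i => (M.goals i).length * (2 * n + 2))] at this
    simp only [Finset.sum_const, Finset.card_univ, Fintype.card_fin, smul_eq_mul] at this
    omega
  have h4 : esize (M.raw ε) = 1 + (esize (List.ofFn M.pos) + (esize (List.ofFn fun u =>
      ((List.finRange n).filter fun v => M.graph.Adj u v).map Fin.val) +
      (esize (List.ofFn fun i => ((M.start i).val, (M.route i).rawLegs)) + 1 + 1) + 1) + 1) + 1 := by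
    rfl
  nlinarith [Nat.zero_le (n * k), Nat.zero_le (n * M.numGoals), Nat.zero_le (k * M.numGoals),
    Nat.zero_le (n ^ 2), Nat.zero_le (k ^ 2), Nat.zero_le (M.numGoals ^ 2)]

end Mission

end

/-! ### Assembly of the theorem -/

theorem mainTheorem3 :
    ∃ (prog : Prog) (P : Polynomial ℕ),
      ∀ (n k : ℕ) (M : Mission n k), M.IsTourAssignment → ∀ ε : ℝ, 0 < ε →
        ∃ (S : Schedule k) (t : ℕ),
          Runs prog (M.encode ε) S.encode t ∧
          t + S.encode.size ≤ P.eval (n + k + M.numGoals) ∧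
          S.Resolves M ε ∧
          S.sumOfCosts M ≤ M.totalTime + ε ∧
          S.makespan ≤ M.maxTime + ε := by
  obtain ⟨prog, Q, hQ⟩ := polyTime_solve
  -- `Q` is a polynomial in the size of the input, for which the quadratic bound is substituted.
  refine ⟨prog, Q.comp (100 * (.X + 1) ^ 2), fun n k M hM ε hε => ?_⟩
  obtain ⟨t, h1, h2⟩ := hQ (M.raw ε)
  rw [Mission.solve_raw hM hε] at h1 h2
  rw [Mission.enc_raw, Schedule.enc_raw] at h1
  rw [esize, Schedule.enc_raw] at h2
  refine ⟨M.theSchedule ε, t, h1, h2.trans ?_, Mission.theSchedule_resolves hM hε,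
    Mission.theSchedule_sumOfCosts_le hM hε, Mission.theSchedule_makespan_le hM hε⟩
  simpa [Polynomial.eval_comp] using Q.eval_mono_nat (hM.esize_raw_le (ε := ε))
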